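/- A \emph{B\"uchi reset VASS} $\mathcal V=(Q,q_0,T,F)$ of dimension $d\in\mathbb N$ over an alphabet $\Sigma$ has a finite set $Q$ of states, an initial state $q_0\in Q$, final states $F\subseteq Q$, and a finite set $T\subseteq Q\times(\mathbb Z^d\cup\{\mathsf r_1,\dots,\mathsf r_d\})\times\Sigma^*\times Q$ of transitions. Its configurations are the elements of $Q\times\mathbb N^d$. There is a step $(q,\mathbf m)\xrightarrow{w}(q',\mathbf m')$ if there is $(q,x,w,q')\in T$ such that either $x\in\mathbb Z^d$ and $\mathbf m'=\mathbf m+x$, or $x=\mathsf r_i$ and $\mathbf m'$ arises from $\mathbf m$ by setting entry $i$ to $0$. The language $L(\mathcal V)\subseteq\Sigma^\omega$ is the set of infinite words that label an infinite run from $(q_0,\mathbf 0)$ visiting final states infinitely often. $\mathcal V$ is \emph{weak} if its control graph has no path (of length $\geq 0$) from a final state to the source of a reset transition. A \emph{reset VASS} is a B\"uchi reset VASS all of whose transitions are labelled by $\varepsilon$ and which has no final states; if $d\ge1$, it is \emph{place bounded} if there is $k\in\mathbb N$ with $\mathbf m(1)\le k$ for all configurations $(q,\mathbf m)$ reachable from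 $(q_0,\mathbf 0)$. The \emph{place boundedness problem} asks whether a given reset VASS of dimension $d\geq1$ is place bounded. A language is \emph{regular} if it is the language of a B\"uchi automaton (the case $d=0$). Languages $L_1,L_2\subseteq\Sigma^\omega$ are \emph{regularly separable} if there is a regular $R\subseteq\Sigma^\omega$ with $L_1\subseteq R$ and $R\cap L_2=\emptyset$. Let $\Sigma_1=\{a_1,\bar a_1\}$, and let $D_1\subseteq\Sigma_1^\omega$ be the set of infinite words each of whose finite prefixes $v$ satisfies $|v|_{a_1}\ge|v|_{\bar a_1}$. Then the following hold. \begin{enumerate} \item For every weak B\"uchi reset VASS, the steps between configurations, ordered by $(q,\mathbf m)\le(q',\mathbf m')$ iff $q=q'$ and $\mathbf m\le\mathbf m'$ componentwise, form a well-structured transition system: $\le$ is a well-quasi-order, $c_1\xrightarrow{w}c_1'$ and $c_1\le c_2$ imply that there is $c_2'$ with $c_2\xrightarrow{w}c_2'$ and $c_1'\le c_2'$, and the set of final configurations is upward closed. \item Over every finite alphabet (and, more generally, over every countable alphabet with a fixed effective coding), it is decidable whether $L(\mathcal V)=\emptyset$ for a given weak B\"uchi reset VASS $\mathcal V$, and whether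 $L(\mathcal V_1)\cap L(\mathcal V_2)=\emptyset$ for given weak B\"uchi reset VASS $\mathcal V_1,\mathcal V_2$. \item The place boundedness problem for reset VASS is many-one reducible to the problem whether $L(\mathcal V)$ and $D_1$ are regularly separable, for a given weak B\"uchi reset VASS $\mathcal V$ over $\Sigma_1$. The latter problem is undecidable. \item Consequently, it is undecidable whether $L(\mathcal V_1)$ and $L(\mathcal V_2)$ are regularly separable, for given weak B\"uchi reset VASS $\mathcal V_1,\mathcal V_2$ over $\Sigma_1$, although it is decidable whether $L(\mathcal V_1)\cap L(\mathcal V_2)=\emptyset$. \end{enumerate} -/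

import Mathlib

open Filter

namespace RegSep

/-! ## Labelled transition systems with Büchi acceptance, and WSTS -/

/-- A transition system whose steps carry finite words over `A`, with an initial state and a set
of final states. -/
structure BuchiTS (A : Type) where
  State : Type
  start : State
  step : State → List A → State → Prop
  final : Set State

/-- The infinite concatenation `u 0 ++ u 1 ++ u 2 ++ ⋯` is the infinite word `w` (in particular it
is infinite, i.e. infinitely many of the `u i` are nonempty). -/
def IsInfiniteConcat {A : Type} (u : ℕ → List A) (w : ℕ → A) : Prop :=
  (∀ n, (List.range n).flatMap u =
      (List.range ((List.range n).flatMap u).length).map w) ∧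
    ∀ N, ∃ n, N ≤ ((List.range n).flatMap u).length

/-- The set of infinite words that label an accepting run: one from the initial state that visits
final states infinitely often. -/
def BuchiTS.language {A : Type} (S : BuchiTS A) : Set (ℕ → A) :=
  {w | ∃ (c : ℕ → S.State) (u : ℕ → List A),
    c 0 = S.start ∧ (∀ i, S.step (c i) (u i) (c (i + 1))) ∧
      (∃ᶠ i in atTop, c i ∈ S.final) ∧ IsInfiniteConcat u w}

/-- `S`, ordered by `le`, is a well-structured transition system: `le` is a well-quasi-order, larger
states simulate smaller ones, and the final states are upward closed. -/
structure BuchiTS.IsWSTS {A : Type} (S : BuchiTS A) (le : S.State → S.State → Prop) : Prop where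
  refl : ∀ c, le c c
  trans : ∀ c₁ c₂ c₃, le c₁ c₂ → le c₂ c₃ → le c₁ c₃
  wqo : WellQuasiOrdered le
  compat : ∀ c₁ w c₁' c₂, S.step c₁ w c₁' → le c₁ c₂ → ∃ c₂', S.step c₂ w c₂' ∧ le c₁' c₂'
  final_up : ∀ c₁ c₂, c₁ ∈ S.final → le c₁ c₂ → c₂ ∈ S.final

/-! ## Büchi reset VASS -/

/-- A transition between states in `Fin n` over `d` counters. Its operation is either the addition
of a vector in `ℤ^d` or the reset of one counter. -/
structure Transition (n d : ℕ) (A : Type) where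
  src : Fin n
  op : (Fin d → ℤ) ⊕ Fin d
  label : List A
  tgt : Fin n

/-- A Büchi reset VASS over the alphabet `A`. Its finite sets of transitions and of final states are
given by lists, of which only the members matter. -/
structure BuchiResetVASS (A : Type) where
  numStates : ℕ
  dim : ℕ
  start : Fin numStates
  transitions : List (Transition numStates dim A)
  finals : List (Fin numStates)

/-- The effect of an operation on counter valuations; counters stay in `ℕ`. -/
def Fires {d : ℕ} : ((Fin d → ℤ) ⊕ Fin d) → (Fin d → ℕ) → (Fin d → ℕ) → Prop
  | Sum.inl δ, m, m' => ∀ i, (m' i : ℤ) = (m i : ℤ) + δ i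
  | Sum.inr r, m, m' => m' = Function.update m r 0

namespace BuchiResetVASS

variable {A : Type}

/-- A state together with a counter valuation. -/
abbrev Config (V : BuchiResetVASS A) : Type := Fin V.numStates × (Fin V.dim → ℕ)

/-- The steps between configurations. -/
def Step (V : BuchiResetVASS A) (c : V.Config) (w : List A) (c' : V.Config) : Prop :=
  ∃ t ∈ V.transitions, t.src = c.1 ∧ t.tgt = c'.1 ∧ t.label = w ∧ Fires t.op c.2 c'.2

/-- The transition system of configurations, started in the initial state with all counters zero;
acceptance does not look at the counters. -/
def toTS (V : BuchiResetVASS A) : BuchiTS A where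
  State := V.Config
  start := (V.start, fun _ => 0)
  step := V.Step
  final := {c | c.1 ∈ V.finals}

/-- The usual order on configurations: equal states and componentwise comparison of counters. -/
def configLE (V : BuchiResetVASS A) (c c' : V.Config) : Prop :=
  c.1 = c'.1 ∧ ∀ i, c.2 i ≤ c'.2 i

/-- The language of infinite words accepted by `V`. -/
def language (V : BuchiResetVASS A) : Set (ℕ → A) := V.toTS.language

/-- The edges of the control graph. -/
def Edge (V : BuchiResetVASS A) (q q' : Fin V.numStates) : Prop :=
  ∃ t ∈ V.transitions, t.src = q ∧ t.tgt = q'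

/-- `V` is weak: there is no path in the control graph from a final state to a reset transition. -/
def IsWeak (V : BuchiResetVASS A) : Prop :=
  ∀ q ∈ V.finals, ∀ t ∈ V.transitions, t.op.isRight = true →
    ¬ Relation.ReflTransGen V.Edge q t.src

/-- Some run from the initial configuration leads to `c`. -/
def Reachable (V : BuchiResetVASS A) (c : V.Config) : Prop :=
  Relation.ReflTransGen (fun c₁ c₂ => ∃ w, V.Step c₁ w c₂) (V.start, fun _ => 0) c

/-- `V` is a reset VASS: it has no input words and no final states. -/
def IsResetVASS (V : BuchiResetVASS A) : Prop :=
  (∀ t ∈ V.transitions, t.label = []) ∧ V.finals = []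

/-- The first counter is bounded on the reachable configurations. -/
def PlaceBounded (V : BuchiResetVASS A) (hd : 0 < V.dim) : Prop :=
  ∃ k : ℕ, ∀ c : V.Config, V.Reachable c → c.2 ⟨0, hd⟩ ≤ k

end BuchiResetVASS

/-! ## Regular languages, separability, and the Dyck language -/

/-- `L` is ω-regular: it is the language of a Büchi automaton, i.e. of a Büchi reset VASS without
counters (which then has no reset transitions either). -/
def IsRegular {A : Type} (L : Set (ℕ → A)) : Prop :=
  ∃ V : BuchiResetVASS A, V.dim = 0 ∧ V.language = L

/-- Some regular language contains `L₁` and is disjoint from `L₂`. -/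
def RegSeparable {A : Type} (L₁ L₂ : Set (ℕ → A)) : Prop :=
  ∃ R : Set (ℕ → A), IsRegular R ∧ L₁ ⊆ R ∧ R ∩ L₂ = ∅

/-- The alphabet of `n` pairs of matching letters; `(i, true)` is the opening letter `a_i` and
`(i, false)` is the closing letter. -/
abbrev Letter (n : ℕ) : Type := Fin n × Bool

/-- The `i`-th letter balance of a finite word. -/
def balance {n : ℕ} (i : Fin n) (v : List (Letter n)) : ℤ :=
  (v.count (i, true) : ℤ) - (v.count (i, false) : ℤ)

/-- The Dyck language of infinite words all of whose finite prefixes have nonnegative balances. -/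
def Dyck (n : ℕ) : Set (ℕ → Letter n) :=
  {w | ∀ (k : ℕ) (i : Fin n), 0 ≤ balance i ((List.range k).map w)}

/-! ## Decision problems -/

/-- The problem `P`, whose instances `x` are presented by their codes, is decidable. -/
def DecidableProblem {I C : Type} [Primcodable C] (code : I → C) (P : I → Prop) : Prop :=
  ∃ f : C → Bool, Computable f ∧ ∀ x, f (code x) = true ↔ P x

/-- The problem `P` is many-one reducible to the problem `Q`. -/
def ReducesTo {I C I' C' : Type} [Primcodable C] [Primcodable C']
    (code : I → C) (P : I → Prop) (code' : I' → C') (Q : I' → Prop) : Prop :=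
  ∃ f : C → C', Computable f ∧ ∀ x, ∃ y, f (code x) = code' y ∧ (P x ↔ Q y)

/-- Codes of transitions: states and counters are numbers, integers are given by their positive and
negative parts. -/
abbrev TransitionCode (A : Type) : Type := ℕ × (List (ℕ × ℕ) ⊕ ℕ) × List A × ℕ

/-- The code of an operation. -/
def opCode {d : ℕ} : ((Fin d → ℤ) ⊕ Fin d) → List (ℕ × ℕ) ⊕ ℕ
  | Sum.inl δ => Sum.inl (List.ofFn fun i => ((δ i).toNat, (-δ i).toNat))
  | Sum.inr r => Sum.inr r.val

/-- The code of a transition. -/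
def Transition.code {n d : ℕ} {A : Type} (t : Transition n d A) : TransitionCode A :=
  (t.src.val, opCode t.op, t.label, t.tgt.val)

/-- Codes of Büchi reset VASS: number of states, dimension, initial state, transitions, final
states. -/
abbrev VASSCode (A : Type) : Type := ℕ × ℕ × ℕ × List (TransitionCode A) × List ℕ

/-- The code of a Büchi reset VASS. -/
def BuchiResetVASS.code {A : Type} (V : BuchiResetVASS A) : VASSCode A :=
  (V.numStates, V.dim, V.start.val, V.transitions.map Transition.code, V.finals.map Fin.val)

/-- Weak Büchi reset VASS over `A`. -/
abbrev WeakBRVASS (A : Type) : Type := {V : BuchiResetVASS A // V.IsWeak}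

/-- Reset VASS with a first counter (the alphabet plays no role). -/
abbrev ResetVASS : Type := {V : BuchiResetVASS (Letter 1) // V.IsResetVASS ∧ 0 < V.dim}

end RegSep

open RegSep

namespace RegSep

/-! Well-structuredness is Dickson's lemma together with the monotonicity of additions and resets.

Decidability. Two weak systems are synchronized in a product that buffers their labels and emits
common letters; its edges carry the flags `0` and `1` for final states of the components and `2` for
an emitted letter. Since no reset follows a final state, Dickson's lemma turns a common word into a
run to some configuration that afterwards, without resets, reaches a configuration in the same state
with counters at least as large, and sees all three flags on the way. Conversely such a loop can be
repeated forever (`accepts_product_iff`). The existence of the loop is recursively enumerable, and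
so is its absence: the configurations that do not reach a loop form a downward closed set, hence a
finite union of ideals. The reset-free edges between these ideals form a finite graph without closed
walks of nonnegative effect that see all flags, because such a walk could be fired from a large
element of its ideal (`exists_closed_of_not_accepts`). By Farkas' lemma and an Eulerian walk
argument, this absence is witnessed by finitely many ranking functions (`ranked_of_forall_walk`),
and such a witness refutes acceptance (`not_accepts_of_closed`).

Reduction. To a reset VASS a final phase is appended in which an opening letter costs two units of
the first counter and a closing letter returns one. If the counter is bounded by `k`, every accepted
word has negative balance after `2 * k + 1` letters, which is a regular condition. Otherwise the
periodic words with blocks of `N` opening and `2 * N` closing letters are accepted for all `N`, and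
a Büchi automaton that accepts one of them for large `N` can be pumped inside the opening blocks
until it accepts a Dyck word (`inter_dyck_nonempty`). This gives `placeBounded_iff`.

Undecidability. Halting reduces to place boundedness. A search is compiled to a register program,
and the program is simulated on a budget: register units are borrowed from a budget counter, so the
total is conserved, and a zero test is replaced by a reset, which loses units if the register was
positive. A round ends by resetting the budget, collecting the registers into it and adding one. It
makes a net gain only if the simulation was faithful and had used up the whole budget, so the budget
counter is unbounded exactly if the search fails. As the Dyck language belongs to a weak system with
one counter, separability of two weak systems is undecidable too. -/

/-! ## Integer Farkas lemma -/

/-- Farkas' lemma over the integers, for additive functionals. -/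
theorem farkas_int {M κ : Type*} [AddCommGroup M] [DecidableEq κ] (S : Finset κ) :
    ∀ (a : κ → M →+ ℤ) (b : M →+ ℤ),
      (∃ y, (∀ k ∈ S, a k y ≤ 0) ∧ 0 < b y) ∨
        ∃ (N : ℕ) (u : κ → ℕ), 0 < N ∧ ∀ y, (N : ℤ) * b y = ∑ k ∈ S, (u k : ℤ) * a k y := by
  induction S using Finset.induction_on with
  | empty =>
    intro a b
    by_cases h : ∃ y, b y ≠ 0
    · obtain ⟨y, hy⟩ := h
      left
      rcases lt_or_gt_of_ne hy with h | h
      · exact ⟨-y, by simp, by simpa using h⟩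
      · exact ⟨y, by simp, h⟩
    · push Not at h
      exact Or.inr ⟨1, fun _ => 0, one_pos, fun y => by simp [h y]⟩
  | insert n S hn ih =>
    intro a b
    rcases ih a b with ⟨z, hz, hbz⟩ | ⟨N, u, hN, hu⟩
    · by_cases hnz : a n z ≤ 0
      · refine Or.inl ⟨z, fun k hk => ?_, hbz⟩
        rcases Finset.mem_insert.1 hk with rfl | hk
        exacts [hnz, hz k hk]
      push Not at hnz
      obtain ⟨p, hp⟩ := Int.eq_ofNat_of_zero_le hnz.le
      obtain ⟨q, hq⟩ := Int.eq_ofNat_of_zero_le hbz.le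
      choose! r hr using fun k (hk : k ∈ S) =>
        Int.eq_ofNat_of_zero_le (neg_nonneg.2 (hz k hk))
      -- All these functionals vanish at `z`, so a solution for them may be shifted along `z` into
      -- the kernel of `a n`. Dually, the coefficients `-a k z` are nonnegative, which keeps the
      -- multiplier of `a n` nonnegative.
      rcases ih (fun k => (a n z) • a k - (a k z) • a n) ((a n z) • b - (b z) • a n) with
        ⟨y, hy, hby⟩ | ⟨N, u, hN, hu⟩
      · left
        refine ⟨(a n z) • y - (a n y) • z, fun k hk => ?_, ?_⟩
        · rcases Finset.mem_insert.1 hk with rfl | hk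
          · simp [mul_comm]
          · have := hy k hk
            simp only [AddMonoidHom.sub_apply, AddMonoidHom.coe_smul, Pi.smul_apply, smul_eq_mul,
              map_sub, map_zsmul] at this ⊢
            linarith
        · simp only [AddMonoidHom.sub_apply, AddMonoidHom.coe_smul, Pi.smul_apply, smul_eq_mul,
            map_sub, map_zsmul] at hby ⊢
          linarith
      · right
        refine ⟨N * p, fun k => if k = n then N * q + ∑ j ∈ S, u j * r j else u k * p,
          Nat.mul_pos hN (by omega), fun y => ?_⟩
        have h := hu y
        simp only [AddMonoidHom.sub_apply, AddMonoidHom.coe_smul, Pi.smul_apply, smul_eq_mul] at h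
        rw [Finset.sum_insert hn]
        beta_reduce
        rw [if_pos rfl]
        have e1 : ∑ k ∈ S, ((if k = n then N * q + ∑ j ∈ S, u j * r j else u k * p : ℕ) : ℤ) * a k y
            = ∑ k ∈ S, (u k : ℤ) * p * a k y := by
          refine Finset.sum_congr rfl fun k hk => ?_
          rw [if_neg fun h : k = n => hn (h ▸ hk)]; push_cast; ring
        have e2 : ∑ k ∈ S, (u k : ℤ) * (a n z * a k y - a k z * a n y) =
            ∑ k ∈ S, (u k : ℤ) * p * a k y + (∑ k ∈ S, (u k : ℤ) * r k) * a n y := by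
          rw [Finset.sum_mul, ← Finset.sum_add_distrib]
          refine Finset.sum_congr rfl fun k hk => ?_
          have := hr k hk
          rw [hp, show a k z = -(r k : ℤ) by linarith]
          ring
        rw [e1]
        rw [e2, hp, hq] at h
        push_cast
        linarith
    · refine Or.inr ⟨N, fun k => if k = n then 0 else u k, hN, fun y => ?_⟩
      rw [Finset.sum_insert hn, hu y]
      simp only [if_true, Nat.cast_zero, zero_mul, zero_add]
      refine Finset.sum_congr rfl fun k hk => ?_
      rw [if_neg fun h : k = n => hn (h ▸ hk)]

/-! ## Walks and circulations in finite directed multigraphs -/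

section Walks

variable {ν ε : Type*} (src tgt : ε → ν)

/-- The list of edges `w` is a walk from `u` to `v`. -/
def IsWalk : ν → List ε → ν → Prop
  | u, [], v => u = v
  | u, e :: w, v => src e = u ∧ IsWalk (tgt e) w v

variable {src tgt}

theorem isWalk_append {u v : ν} {w₁ w₂ : List ε} :
    IsWalk src tgt u (w₁ ++ w₂) v ↔ ∃ n, IsWalk src tgt u w₁ n ∧ IsWalk src tgt n w₂ v := by
  induction w₁ generalizing u with
  | nil => simp [IsWalk]
  | cons e w ih => simp [IsWalk, ih, and_assoc]

/-- Both multisets list the nodes along the walk. For a closed walk the end points cancel, which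
makes it a circulation. -/
theorem IsWalk.map_src {u v : ν} {w : List ε} (h : IsWalk src tgt u w v) :
    (v ::ₘ (w.map src : Multiset ν)) = u ::ₘ (w.map tgt : Multiset ν) := by
  induction w generalizing u with
  | nil => cases h; rfl
  | cons e w ih =>
    obtain ⟨rfl, h⟩ := h
    have := ih h
    simp only [List.map_cons, ← Multiset.cons_coe]
    rw [Multiset.cons_swap, this]

theorem IsWalk.rotate {u : ν} {w : List ε} (h : IsWalk src tgt u w u) {e : ε} (he : e ∈ w) :
    ∃ w', IsWalk src tgt (src e) w' (src e) ∧ w'.Perm w := by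
  obtain ⟨w₁, w₂, rfl⟩ := List.append_of_mem he
  obtain ⟨n, h1, h2⟩ := isWalk_append.1 h
  have h2' := h2
  obtain ⟨rfl, -⟩ := h2'
  exact ⟨e :: w₂ ++ w₁, isWalk_append.2 ⟨u, h2, h1⟩, List.perm_append_comm⟩

theorem isWalk_iterate {g : ε → ε} (hg : ∀ e, src (g e) = tgt e) (e : ε) (n : ℕ) :
    IsWalk src tgt (src e) ((List.range n).map fun i => g^[i] e) (src (g^[n] e)) := by
  induction n with
  | zero => simp [IsWalk]
  | succ n ih =>
    rw [List.range_succ, List.map_append]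
    refine isWalk_append.2 ⟨_, ih, rfl, ?_⟩
    rw [Function.iterate_succ_apply']
    exact (hg _).symm

/-- A nonempty circulation contains a nonempty closed walk. -/
theorem exists_cycle_le [DecidableEq ε] (m : Multiset ε) (hm : m.map src = m.map tgt)
    (h0 : m ≠ 0) : ∃ (u : ν) (w : List ε), w ≠ [] ∧ IsWalk src tgt u w u ∧ (w : Multiset ε) ≤ m := by
  -- Every target is the source of another edge in `m`, so a choice of successors can be iterated,
  -- and finiteness forces a period.
  have hnext : ∀ e : {e // e ∈ m}, ∃ e' : {e // e ∈ m}, src e'.1 = tgt e.1 := by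
    rintro ⟨e, he⟩
    have : tgt e ∈ m.map src := hm ▸ Multiset.mem_map_of_mem tgt he
    obtain ⟨e', he', h⟩ := Multiset.mem_map.1 this
    exact ⟨⟨e', he'⟩, h⟩
  choose g hg using hnext
  obtain ⟨e0, he0⟩ := Multiset.exists_mem_of_ne_zero h0
  have hfin : Finite {e // e ∈ m} := Finite.of_injective
    (fun e : {e // e ∈ m} => (⟨e.1, Multiset.mem_toFinset.2 e.2⟩ : m.toFinset))
    (fun a b h => Subtype.ext (by simpa using h))
  obtain ⟨i, j, hij, heq⟩ := Finite.exists_ne_map_eq_of_infinite fun i : ℕ => g^[i] ⟨e0, he0⟩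
  have key : ∃ e : {e // e ∈ m}, ∃ n, 0 < n ∧ g^[n] e = e := by
    rcases lt_or_gt_of_ne hij with h | h
    · refine ⟨g^[i] ⟨e0, he0⟩, j - i, by omega, ?_⟩
      rw [← Function.iterate_add_apply, Nat.sub_add_cancel h.le]; exact heq.symm
    · refine ⟨g^[j] ⟨e0, he0⟩, i - j, by omega, ?_⟩
      rw [← Function.iterate_add_apply, Nat.sub_add_cancel h.le]; exact heq
  obtain ⟨e, n, hn, hper⟩ := key
  have hpp : e ∈ Function.periodicPts g := ⟨n, hn, hper⟩
  have hp := Function.minimalPeriod_pos_of_mem_periodicPts hpp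
  -- Within a minimal period no edge is repeated, so the cycle is a submultiset of `m`.
  set p := Function.minimalPeriod g e
  have hw := isWalk_iterate (src := fun e : {e // e ∈ m} => src e.1)
    (tgt := fun e : {e // e ∈ m} => tgt e.1) hg e p
  rw [Function.iterate_minimalPeriod] at hw
  have hconv : ∀ (w : List {e // e ∈ m}) u v, IsWalk (fun e : {e // e ∈ m} => src e.1)
      (fun e => tgt e.1) u w v → IsWalk src tgt u (w.map Subtype.val) v := by
    intro w
    induction w with
    | nil => intro u v h; exact h
    | cons a w ih => intro u v h; exact ⟨h.1, ih _ _ h.2⟩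
  refine ⟨src e.1, _, ?_, hconv _ _ _ hw, ?_⟩
  · intro h
    have := congrArg List.length h
    simp only [List.length_map, List.length_range, List.length_nil] at this
    omega
  · rw [Multiset.le_iff_subset]
    · intro a ha
      simp only [Multiset.mem_coe, List.mem_map] at ha
      obtain ⟨b, -, rfl⟩ := ha
      exact b.2
    · rw [Multiset.coe_nodup]
      refine List.Nodup.map Subtype.val_injective ?_
      refine List.Nodup.map_on ?_ List.nodup_range
      intro a ha b hb hab
      exact Function.iterate_injOn_Iio_minimalPeriod (List.mem_range.1 ha) (List.mem_range.1 hb) hab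

/-- A circulation is a union of closed walks. -/
theorem exists_cycle_decomposition [DecidableEq ε] (m : Multiset ε) (hm : m.map src = m.map tgt) :
    ∃ L : List (List ε), (∀ w ∈ L, w ≠ [] ∧ ∃ u, IsWalk src tgt u w u) ∧
      (L.flatten : Multiset ε) = m := by
  induction m using Multiset.strongInductionOn with
  | ih m ih =>
    by_cases h0 : m = 0
    · exact ⟨[], by simp, by simp [h0]⟩
    obtain ⟨u, w, hw0, hw, hle⟩ := exists_cycle_le m hm h0
    obtain ⟨m', rfl⟩ := Multiset.le_iff_exists_add.1 hle
    have hm' : m'.map src = m'.map tgt := by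
      have h1 := hw.map_src
      rw [Multiset.cons_inj_right] at h1
      rw [Multiset.map_add, Multiset.map_add, Multiset.map_coe, Multiset.map_coe, h1] at hm
      exact add_left_cancel hm
    obtain ⟨L, hL, hLm⟩ := ih m' (by
      rw [lt_iff_le_and_ne]
      refine ⟨Multiset.le_add_left _ _, fun h => hw0 ?_⟩
      have := congrArg Multiset.card h
      simp only [Multiset.card_add, Multiset.coe_card] at this
      exact List.length_eq_zero_iff.1 (by omega)) hm'
    refine ⟨w :: L, ?_, ?_⟩
    · intro v hv
      rcases List.mem_cons.1 hv with rfl | hv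
      exacts [⟨hw0, u, hw⟩, hL v hv]
    · rw [List.flatten_cons, ← Multiset.coe_add, hLm]

/-- A connected circulation is a single closed walk. -/
theorem exists_eulerian [DecidableEq ε] (m : Multiset ε) (hm : m.map src = m.map tgt) (h0 : m ≠ 0)
    (hconn : ∀ P : ν → Prop, (∀ e ∈ m, P (src e) ↔ P (tgt e)) →
      ∀ e ∈ m, P (src e) → ∀ e' ∈ m, P (src e')) :
    ∃ (u : ν) (w : List ε), IsWalk src tgt u w u ∧ (w : Multiset ε) = m := by
  have hex : ∃ n, ∃ L : List (List ε), L.length = n ∧ (∀ w ∈ L, w ≠ [] ∧ ∃ u, IsWalk src tgt u w u) ∧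
      (L.flatten : Multiset ε) = m :=
    let ⟨L, h⟩ := exists_cycle_decomposition m hm; ⟨_, L, rfl, h⟩
  classical
  -- A decomposition with the fewest closed walks: two of them that share a node could be merged, so
  -- they are disjoint, and connectedness leaves only one.
  obtain ⟨L, hlen, hL, hLm⟩ := Nat.find_spec hex
  have hmin := fun {k} => Nat.find_min hex (m := k)
  rw [← hlen] at hmin
  clear hlen
  cases L with
  | nil => exact absurd (by simpa using hLm.symm) h0
  | cons w L =>
    obtain ⟨hw0, u, hw⟩ := hL w (by simp)
    have hmem : ∀ e, e ∈ m ↔ e ∈ w ∨ ∃ w' ∈ L, e ∈ w' := by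
      intro e; rw [← hLm]; simp
    have htgt : ∀ {u' w'}, IsWalk src tgt u' w' u' → ∀ e ∈ w', ∃ e' ∈ w', src e' = tgt e := by
      intro u' w' hw' e he
      have h1 := hw'.map_src
      rw [Multiset.cons_inj_right] at h1
      have : tgt e ∈ (w'.map src : Multiset ν) := by
        rw [h1]; simpa using ⟨e, he, rfl⟩
      simpa using this
    have hdisj : ∀ w' ∈ L, ∀ e ∈ w, ∀ e' ∈ w', src e ≠ src e' := by
      intro w' hw' e he e' he' heq
      obtain ⟨-, u', hwalk'⟩ := hL w' (by simp [hw'])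
      obtain ⟨a, ha, hap⟩ := hw.rotate he
      obtain ⟨b, hb, hbp⟩ := hwalk'.rotate he'
      refine hmin (k := (L.erase w').length + 1) ?_ ⟨(a ++ b) :: L.erase w', by simp, ?_, ?_⟩
      · rw [List.length_erase_of_mem hw']
        have := List.length_pos_of_mem hw'
        simp; omega
      · intro v hv
        rcases List.mem_cons.1 hv with rfl | hv
        · refine ⟨fun h => ?_, src e, isWalk_append.2 ⟨_, ha, heq ▸ hb⟩⟩
          simp only [List.append_eq_nil_iff] at h
          rw [h.1] at hap
          simp [hap.symm.eq_nil] at he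
        · exact hL v (by simp [List.mem_of_mem_erase hv])
      · rw [← hLm, Multiset.coe_eq_coe]
        have h2 : (w :: L).Perm (w :: w' :: L.erase w') := (List.perm_cons_erase hw').cons _
        refine List.Perm.trans ?_ h2.flatten.symm
        simp only [List.flatten_cons, ← List.append_assoc]
        exact (hap.append hbp).append_right _
    have hall : ∀ e ∈ m, ∃ e' ∈ w, src e' = src e := by
      obtain ⟨e0, he0⟩ := List.exists_mem_of_ne_nil w hw0
      refine hconn (fun n => ∃ e' ∈ w, src e' = n) ?_ e0 ((hmem _).2 (Or.inl he0)) ⟨e0, he0, rfl⟩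
      intro e he
      rcases (hmem e).1 he with he | ⟨w', hw', he⟩
      · exact ⟨fun _ => htgt hw e he, fun _ => ⟨e, he, rfl⟩⟩
      · obtain ⟨-, u', hwalk'⟩ := hL w' (by simp [hw'])
        refine ⟨fun ⟨a, ha, h⟩ => absurd h (hdisj w' hw' a ha e he), fun ⟨a, ha, h⟩ => ?_⟩
        obtain ⟨b, hb, h'⟩ := htgt hwalk' e he
        exact absurd (h.trans h'.symm) (hdisj w' hw' a ha b hb)
    refine ⟨u, w, hw, ?_⟩
    cases L with
    | nil => rw [← hLm]; simp
    | cons w' L =>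
      obtain ⟨hw0', -⟩ := hL w' (by simp)
      obtain ⟨e', he'⟩ := List.exists_mem_of_ne_nil w' hw0'
      obtain ⟨e, he, h⟩ := hall e' ((hmem e').2 (Or.inr ⟨w', by simp, he'⟩))
      exact absurd h (hdisj w' (by simp) e he e' he')

end Walks


/-! ## Rankings that exclude cycles of nonnegative effect -/

section Ranked

variable {ε ι : Type} [Fintype ι]

/-- A certificate that the edges in `E` admit no closed walk of nonnegative effect that sees all of
the flags `0, 1, 2`: ranking functions successively remove edges, until every component
misses one of the flags. -/
inductive Ranked (src tgt : ε → ℕ) (x : ε → ι → ℤ) (flag : ε → ℕ) : List ε → Prop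
  | base (E : List ε) (χ : ℕ → ℕ)
      (h : ∀ e ∈ E, χ (src e) = χ (tgt e) ∧ χ (src e) < 3 ∧ flag e ≠ χ (src e)) :
      Ranked src tgt x flag E
  | step (E E' : List ε) (φ : ℕ → ℕ) (l : ℕ → ι → ℕ)
      (h : ∀ e ∈ E, (∀ i, l (src e) i = l (tgt e) i) ∧
        ((φ (tgt e) : ℤ) + ∑ i, (l (src e) i : ℤ) * x e i < φ (src e) ∨
          (φ (tgt e) : ℤ) + ∑ i, (l (src e) i : ℤ) * x e i ≤ φ (src e) ∧ e ∈ E'))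
      (h' : Ranked src tgt x flag E') : Ranked src tgt x flag E

variable {src tgt : ε → ℕ} {x : ε → ι → ℤ} {flag : ε → ℕ}

/-- The sum of `φ` and the `l`-weighted counters does not increase along the walk. The weights are
constant on it, as they agree at both ends of each edge. -/
theorem IsWalk.potential {u v : ℕ} {w : List ε} (h : IsWalk src tgt u w v)
    {φ : ℕ → ℕ} {l : ℕ → ι → ℕ} (hl : ∀ e ∈ w, ∀ i, l (src e) i = l (tgt e) i)
    (hφ : ∀ e ∈ w, (φ (tgt e) : ℤ) + ∑ i, (l (src e) i : ℤ) * x e i ≤ φ (src e)) :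
    (φ v : ℤ) + ∑ i, (l u i : ℤ) * (w.map (x · i)).sum ≤ φ u ∧
      ∀ e ∈ w, (φ (tgt e) : ℤ) + ∑ i, (l (src e) i : ℤ) * x e i < φ (src e) →
        (φ v : ℤ) + ∑ i, (l u i : ℤ) * (w.map (x · i)).sum < φ u := by
  induction w generalizing u with
  | nil => cases h; simp
  | cons a w ih =>
    obtain ⟨rfl, h⟩ := h
    have hla := hl a (by simp)
    have hφa := hφ a (by simp)
    obtain ⟨h1, h2⟩ := ih h (fun e he => hl e (by simp [he])) (fun e he => hφ e (by simp [he]))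
    have key : ∑ i, (l (src a) i : ℤ) * ((a :: w).map (x · i)).sum =
        ∑ i, (l (src a) i : ℤ) * x a i + ∑ i, (l (tgt a) i : ℤ) * (w.map (x · i)).sum := by
      rw [← Finset.sum_add_distrib]
      refine Finset.sum_congr rfl fun i _ => ?_
      rw [List.map_cons, List.sum_cons, ← hla i]; ring
    refine ⟨by linarith, fun e he hlt => ?_⟩
    rcases List.mem_cons.1 he with rfl | he
    · linarith
    · have := h2 e he hlt
      linarith

/-- A closed walk returns to the same value of `φ`, so if its effect is nonnegative, it contains no
strictly decreasing edge. It therefore survives every ranking step, and in the base case it stays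
within one value of `χ`. -/
theorem Ranked.exists_missing {E : List ε} (hE : Ranked src tgt x flag E) {u : ℕ} {w : List ε}
    (hwE : ∀ e ∈ w, e ∈ E) (hw : IsWalk src tgt u w u) (hx : ∀ i, 0 ≤ (w.map (x · i)).sum) :
    ∃ f < 3, ∀ e ∈ w, flag e ≠ f := by
  induction hE with
  | base E χ h =>
    have : ∀ v, IsWalk src tgt v w u → ∀ e ∈ w, χ (src e) = χ v := by
      clear hw hx
      induction w with
      | nil => simp
      | cons a w ih =>
        rintro v ⟨rfl, hw⟩ e he
        rcases List.mem_cons.1 he with rfl | he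
        · rfl
        · rw [ih (fun e he => hwE e (by simp [he])) _ hw e he, (h a (hwE a (by simp))).1]
    cases w with
    | nil => exact ⟨0, by simp⟩
    | cons a w =>
      refine ⟨χ u, ?_, fun e he => ?_⟩
      · rw [← this u hw a (by simp)]; exact (h a (hwE a (by simp))).2.1
      · rw [← this u hw e he]; exact (h e (hwE e he)).2.2
  | step E E' φ l h h' ih =>
    refine ih fun e he => ?_
    obtain ⟨h1, h2⟩ := hw.potential (x := x) (φ := φ) (l := l) (fun e he => (h e (hwE e he)).1)
      (fun e he => by rcases (h e (hwE e he)).2 with h | h; exacts [h.le, h.1])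
    rcases (h e (hwE e he)).2 with h3 | h3
    · have := h2 e he h3
      have h0 : 0 ≤ ∑ i, (l u i : ℤ) * (w.map (x · i)).sum :=
        Finset.sum_nonneg fun i _ => mul_nonneg (by positivity) (hx i)
      linarith
    · exact h3.2

/-- If no ranking for the edges of `K` strictly decreases along any edge, then there are positive
multiplicities that form a circulation of nonnegative effect. -/
theorem exists_circulation [DecidableEq ε] (K : Finset ε)
    (h : ∀ (φ : ℕ → ℤ) (l : ι → ℤ), (∀ i, 0 ≤ l i) →
      (∀ e ∈ K, φ (tgt e) - φ (src e) + ∑ i, l i * x e i ≤ 0) →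
        ∀ e ∈ K, φ (tgt e) - φ (src e) + ∑ i, l i * x e i = 0) :
    ∃ f : ε → ℕ, (∀ e ∈ K, 0 < f e) ∧ (∀ i, 0 ≤ ∑ e ∈ K, (f e : ℤ) * x e i) ∧
      ∀ n, ∑ e ∈ K, (f e : ℤ) * (if tgt e = n then 1 else 0) =
        ∑ e ∈ K, (f e : ℤ) * (if src e = n then 1 else 0) := by
  classical
  let A : ε → ((ℕ → ℤ) × (ι → ℤ)) →+ ℤ := fun e =>
    { toFun := fun y => y.1 (tgt e) - y.1 (src e) + ∑ i, y.2 i * x e i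
      map_zero' := by simp
      map_add' := fun y z => by simp [add_mul, Finset.sum_add_distrib]; ring }
  let B : ι → ((ℕ → ℤ) × (ι → ℤ)) →+ ℤ := fun i =>
    { toFun := fun y => - y.2 i
      map_zero' := by simp
      map_add' := fun y z => by simp; ring }
  have one : ∀ e0 ∈ K, ∃ f : ε → ℕ, 0 < f e0 ∧ (∀ i, 0 ≤ ∑ e ∈ K, (f e : ℤ) * x e i) ∧
      ∀ n, ∑ e ∈ K, (f e : ℤ) * (if tgt e = n then 1 else 0) =
        ∑ e ∈ K, (f e : ℤ) * (if src e = n then 1 else 0) := by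
    intro e0 he0
    -- Either some ranking strictly decreases along `e0`, which `h` excludes, or the multipliers
    -- form a circulation through `e0`.
    rcases farkas_int (K.disjSum (Finset.univ : Finset ι)) (Sum.elim A B) (- A e0) with
      ⟨y, hy, hy0⟩ | ⟨N, u, hN, hu⟩
    · have h1 := h y.1 y.2 (fun i => by
        have := hy (Sum.inr i) (by simp)
        simpa [B] using this) (fun e he => by
        have := hy (Sum.inl e) (by simpa using he)
        simpa [A] using this) e0 he0
      have h2 : A e0 y = 0 := h1
      rw [AddMonoidHom.neg_apply, h2] at hy0
      simp at hy0
    · simp only [Finset.sum_disjSum, Sum.elim_inl, Sum.elim_inr, AddMonoidHom.neg_apply] at hu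
      refine ⟨fun e => u (Sum.inl e) + if e = e0 then N else 0, by simp; omega, ?_⟩
      have hsum : ∀ g : ε → ℤ, ∑ e ∈ K, ((u (Sum.inl e) + if e = e0 then N else 0 : ℕ) : ℤ) * g e =
          ∑ e ∈ K, (u (Sum.inl e) : ℤ) * g e + N * g e0 := by
        intro g
        have : ∑ e ∈ K, (if e = e0 then (N : ℤ) else 0) * g e = N * g e0 := by
          rw [Finset.sum_eq_single_of_mem e0 he0 (fun b _ hb => by rw [if_neg hb, zero_mul]),
            if_pos rfl]
        rw [← this, ← Finset.sum_add_distrib]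
        refine Finset.sum_congr rfl fun e _ => ?_
        push_cast; ring
      constructor
      · intro i
        rw [hsum]
        -- At unit vectors of weights, the Farkas identity says that the effect on counter `i` is
        -- the multiplier of `B i`; at unit vectors of potentials, it is conservation of flow.
        have := hu (0, Pi.single i 1)
        simp [A, B, Pi.single_apply] at this
        rw [show ∑ e ∈ K, (u (Sum.inl e) : ℤ) * x e i + N * x e0 i = (u (Sum.inr i) : ℤ) by
          linarith]
        positivity
      · intro n
        have := hu (Pi.single n 1, 0)
        simp only [A, B, Pi.single_apply, AddMonoidHom.coe_mk, ZeroHom.coe_mk, Pi.zero_apply,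
          zero_mul, Finset.sum_const_zero, add_zero, neg_zero, mul_zero, mul_sub,
          Finset.sum_sub_distrib] at this
        rw [hsum, hsum]
        linarith
  choose! f hf0 hf1 hf2 using one
  have hsum : ∀ g : ε → ℤ, ∑ e ∈ K, ((∑ e0 ∈ K, f e0 e : ℕ) : ℤ) * g e =
      ∑ e0 ∈ K, ∑ e ∈ K, (f e0 e : ℤ) * g e := by
    intro g
    rw [Finset.sum_comm]
    refine Finset.sum_congr rfl fun e _ => ?_
    push_cast
    rw [Finset.sum_mul]
  -- The sum of the circulations through the single edges is positive on every edge.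
  refine ⟨fun e => ∑ e0 ∈ K, f e0 e, fun e he => ?_, fun i => ?_, fun n => ?_⟩
  · exact Finset.sum_pos' (fun _ _ => Nat.zero_le _) ⟨e, he, hf0 e he⟩
  · rw [hsum]
    exact Finset.sum_nonneg fun e he => hf1 e he i
  · rw [hsum, hsum]
    exact Finset.sum_congr rfl fun e he => hf2 e he n

theorem map_sum_replicate [DecidableEq ε] {γ : Type*} (K : Finset ε) (f : ε → ℕ) (g : ε → γ)
    [DecidableEq γ] (n : γ) :
    (((∑ e ∈ K, Multiset.replicate (f e) e).map g).count n : ℤ) =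
      ∑ e ∈ K, (f e : ℤ) * (if g e = n then 1 else 0) := by
  induction K using Finset.induction_on with
  | empty => simp
  | insert a K ha ih =>
    rw [Finset.sum_insert ha, Finset.sum_insert ha, Multiset.map_add, Multiset.count_add]
    push_cast
    rw [ih, Multiset.map_replicate, Multiset.count_replicate]
    split <;> simp

/-- If some component has a ranking that strictly decreases along one of its edges, that edge is
removed and induction on the number of edges applies. Otherwise every component carries a positive
circulation of nonnegative effect. An Eulerian walk of it uses all edges of the component, so the
component misses a flag by hypothesis. -/
theorem ranked_of_forall_walk [DecidableEq ε] (E : List ε)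
    (h : ∀ (u : ℕ) (w : List ε), (∀ e ∈ w, e ∈ E) → IsWalk src tgt u w u →
      (∀ i, 0 ≤ (w.map (x · i)).sum) → ∃ f < 3, ∀ e ∈ w, flag e ≠ f) :
    Ranked src tgt x flag E := by
  classical
  induction hn : E.length using Nat.strong_induction_on generalizing E with
  | _ n ih =>
  subst hn
  let R : ℕ → ℕ → Prop := fun a b => ∃ e ∈ E, src e = a ∧ tgt e = b
  let c : ℕ → Quot R := Quot.mk R
  have hc : ∀ e ∈ E, c (src e) = c (tgt e) := fun e he => Quot.sound ⟨e, he, rfl, rfl⟩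
  let K : Quot R → Finset ε := fun k => E.toFinset.filter fun e => c (src e) = k
  have hK : ∀ k e, e ∈ K k ↔ e ∈ E ∧ c (src e) = k := fun k e => by simp [K]
  by_cases hsep : ∃ (k : Quot R) (φ : ℕ → ℤ) (l : ι → ℤ), (∀ i, 0 ≤ l i) ∧
      (∀ e ∈ K k, φ (tgt e) - φ (src e) + ∑ i, l i * x e i ≤ 0) ∧
      ∃ e ∈ K k, φ (tgt e) - φ (src e) + ∑ i, l i * x e i ≠ 0
  · obtain ⟨k, φ, l, hl, hφ, e0, he0, hne⟩ := hsep
    -- Adding this constant makes the potentials nonnegative at all nodes that occur, as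
    -- certificates use natural numbers.
    let C : ℤ := ∑ e ∈ E.toFinset, (|φ (src e)| + |φ (tgt e)|)
    have hC : ∀ e ∈ E, 0 ≤ φ (src e) + C ∧ 0 ≤ φ (tgt e) + C := by
      intro e he
      have : |φ (src e)| + |φ (tgt e)| ≤ C :=
        Finset.single_le_sum (f := fun e => |φ (src e)| + |φ (tgt e)|)
          (fun e _ => by positivity) (List.mem_toFinset.2 he)
      have h1 := neg_abs_le (φ (src e))
      have h2 := neg_abs_le (φ (tgt e))
      have h3 := abs_nonneg (φ (src e))
      have h4 := abs_nonneg (φ (tgt e))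
      constructor <;> linarith
    -- Outside of the component `k` the ranking is zero, so all edges there satisfy equality and are
    -- kept.
    let φ' : ℕ → ℕ := fun n => if c n = k then (φ n + C).toNat else 0
    let l' : ℕ → ι → ℕ := fun n i => if c n = k then (l i).toNat else 0
    have hφ' : ∀ e ∈ E, c (src e) = k → (φ' (tgt e) : ℤ) + ∑ i, (l' (src e) i : ℤ) * x e i - φ' (src e)
        = φ (tgt e) - φ (src e) + ∑ i, l i * x e i := by
      intro e he hk
      have h1 := hC e he
      have hk' : c (tgt e) = k := (hc e he).symm.trans hk
      simp only [φ', l', if_pos hk, if_pos hk', Int.toNat_of_nonneg h1.1, Int.toNat_of_nonneg h1.2,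
        Int.toNat_of_nonneg (hl _)]
      ring
    have hφ0 : ∀ e ∈ E, c (src e) ≠ k →
        (φ' (tgt e) : ℤ) + ∑ i, (l' (src e) i : ℤ) * x e i = φ' (src e) := by
      intro e he hk
      have hk' : c (tgt e) ≠ k := fun h => hk ((hc e he).trans h)
      simp [φ', l', if_neg hk, if_neg hk']
    refine Ranked.step E (E.filter fun e =>
      (φ' (tgt e) : ℤ) + ∑ i, (l' (src e) i : ℤ) * x e i = φ' (src e)) φ' l' ?_ ?_
    · intro e he
      refine ⟨fun i => by simp only [l', hc e he], ?_⟩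
      by_cases hk : c (src e) = k
      · have h1 := hφ e ((hK k e).2 ⟨he, hk⟩)
        have h2 := hφ' e he hk
        rcases lt_or_eq_of_le h1 with h1 | h1
        · left; linarith
        · right
          refine ⟨by linarith, List.mem_filter.2 ⟨he, ?_⟩⟩
          rw [decide_eq_true_iff]; linarith
      · right
        have := hφ0 e he hk
        exact ⟨this.le, List.mem_filter.2 ⟨he, by simpa using this⟩⟩
    · refine ih _ ?_ _ (fun u w hw => h u w fun e he => (List.mem_filter.1 (hw e he)).1) rfl
      rw [List.length_filter_lt_length_iff_exists]
      obtain ⟨he0E, hk⟩ := (hK k e0).1 he0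
      refine ⟨e0, he0E, ?_⟩
      rw [decide_eq_true_iff]
      intro h3
      have := hφ' e0 he0E hk
      exact hne (by linarith)
  · push Not at hsep
    have hmiss : ∀ k, ∃ f < 3, ∀ e ∈ E, c (src e) = k → flag e ≠ f := by
      intro k
      by_cases hne : (K k).Nonempty
      swap
      · refine ⟨0, by simp, fun e he hk => absurd ⟨e, (hK k e).2 ⟨he, hk⟩⟩ hne⟩
      obtain ⟨f, hf0, hf1, hf2⟩ := exists_circulation (src := src) (tgt := tgt) (x := x) (K k)
        (fun φ l => hsep k φ l)
      let m : Multiset ε := ∑ e ∈ K k, Multiset.replicate (f e) e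
      have hmem : ∀ e, e ∈ m ↔ e ∈ K k := by
        intro e
        simp only [m, Multiset.mem_sum, Multiset.mem_replicate]
        constructor
        · rintro ⟨a, ha, -, rfl⟩; exact ha
        · intro he; exact ⟨e, he, (hf0 e he).ne', rfl⟩
      have hm : m.map src = m.map tgt := by
        ext n
        have h1 := map_sum_replicate (K k) f src n
        have h2 := map_sum_replicate (K k) f tgt n
        have := hf2 n
        have h3 : ((m.map src).count n : ℤ) = (m.map tgt).count n := by
          rw [h1, h2, this]
        exact_mod_cast h3
      obtain ⟨e1, he1⟩ := hne
      obtain ⟨u, w, hw, hwm⟩ := exists_eulerian m hm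
        (fun h0 => by have := (hmem e1).2 he1; simp [h0] at this) (by
        intro P hP e he hPe e' he'
        -- All edges of the component occur in `m`, so `P` is invariant along them and thus constant
        -- on the component.
        have key : ∀ a b, c a = c b → ((c a = k ∧ P a) ↔ (c b = k ∧ P b)) := by
          intro a b hab
          have := Quot.eqvGen_exact hab
          induction this with
          | rel a b hr =>
            obtain ⟨e, he, rfl, rfl⟩ := hr
            rw [← hc e he]
            refine and_congr_right fun hk => hP e ((hmem e).2 ((hK k e).2 ⟨he, hk⟩))
          | refl => rfl
          | symm a b h ih => exact (ih (Quot.eqvGen_sound h)).symm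
          | trans a b d h1 h2 ih1 ih2 =>
            exact (ih1 (Quot.eqvGen_sound h1)).trans (ih2 (Quot.eqvGen_sound h2))
        have h1 := ((hK k e).1 ((hmem e).1 he)).2
        have h2 := ((hK k e').1 ((hmem e').1 he')).2
        exact ((key _ _ (h1.trans h2.symm)).1 ⟨h1, hPe⟩).2)
      have hwK : ∀ e, e ∈ w ↔ e ∈ K k := fun e => by rw [← hmem, ← hwm]; rfl
      obtain ⟨g, hg, hgw⟩ := h u w (fun e he => ((hK k e).1 ((hwK e).1 he)).1) hw (by
        intro i
        have h1 : (w.map (x · i)).sum = (m.map (x · i)).sum := by rw [← hwm]; simp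
        have h2 : (m.map (x · i)).sum = ∑ e ∈ K k, (f e : ℤ) * x e i := by
          rw [← Multiset.coe_mapAddMonoidHom, map_sum, ← Multiset.coe_sumAddMonoidHom, map_sum]
          simp
        rw [h1, h2]; exact hf1 i)
      exact ⟨g, hg, fun e he hk => hgw e ((hwK e).2 ((hK k e).2 ⟨he, hk⟩))⟩
    choose χ hχ using hmiss
    refine Ranked.base E (fun n => χ (c n)) fun e he => ⟨by simp only [hc e he], (hχ _).1, ?_⟩
    exact (hχ _).2 e he rfl

end Ranked

/-! ## Primitive recursive predicates and recursively enumerable predicates -/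

section Primrec

-- With these rules, primitive recursiveness of the long witness predicates and of the constructed
-- codes follows from their syntax.
attribute [fun_prop] Primrec PrimrecPred
attribute [fun_prop] Primrec.id Primrec.const Primrec.comp Primrec.fst Primrec.snd Primrec.pair
  Primrec.succ PrimrecPred.and PrimrecPred.or PrimrecPred.not Primrec.sumInl Primrec.sumInr

variable {α β γ : Type*} [Primcodable α] [Primcodable β] [Primcodable γ]

@[fun_prop] theorem primrec_fst {f : α → β × γ} (hf : Primrec f) : Primrec fun a => (f a).1 :=
  Primrec.fst.comp hf

@[fun_prop] theorem primrec_snd {f : α → β × γ} (hf : Primrec f) : Primrec fun a => (f a).2 :=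
  Primrec.snd.comp hf

@[fun_prop] theorem primrec_add {f g : α → ℕ} (hf : Primrec f) (hg : Primrec g) :
    Primrec fun a => f a + g a := Primrec.nat_add.comp hf hg

@[fun_prop] theorem primrec_mul {f g : α → ℕ} (hf : Primrec f) (hg : Primrec g) :
    Primrec fun a => f a * g a := Primrec.nat_mul.comp hf hg

@[fun_prop] theorem primrec_getD {f : α → List β} {g : α → ℕ} {d : β} (hf : Primrec f)
    (hg : Primrec g) : Primrec fun a => (f a).getD (g a) d := (Primrec.list_getD d).comp hf hg

@[fun_prop] theorem primrec_optionGetD {f : α → Option β} {d : α → β} (hf : Primrec f)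
    (hd : Primrec d) : Primrec fun a => (f a).getD (d a) := Primrec.option_getD.comp hf hd

@[fun_prop] theorem primrec_getElem? {f : α → List β} {g : α → ℕ} (hf : Primrec f)
    (hg : Primrec g) : Primrec fun a => (f a)[g a]? := Primrec.list_getElem?.comp hf hg

@[fun_prop] theorem primrec_cons {f : α → β} {g : α → List β} (hf : Primrec f)
    (hg : Primrec g) : Primrec fun a => f a :: g a := Primrec.list_cons.comp hf hg

@[fun_prop] theorem primrec_append {f g : α → List β} (hf : Primrec f)
    (hg : Primrec g) : Primrec fun a => f a ++ g a := Primrec.list_append.comp hf hg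

@[fun_prop] theorem primrec_drop {f : α → ℕ} {g : α → List β} (hf : Primrec f)
    (hg : Primrec g) : Primrec fun a => (g a).drop (f a) := Primrec.list_drop.comp hf hg

@[fun_prop] theorem primrec_tail {g : α → List β} (hg : Primrec g) :
    Primrec fun a => (g a).tail := Primrec.list_tail.comp hg

@[fun_prop] theorem primrec_length {g : α → List β} (hg : Primrec g) :
    Primrec fun a => (g a).length := Primrec.list_length.comp hg

@[fun_prop] theorem primrec_range {g : α → ℕ} (hg : Primrec g) :
    Primrec fun a => List.range (g a) := Primrec.list_range.comp hg

@[fun_prop] theorem primrec_map {f : α → List β} {g : α → β → γ} (hf : Primrec f)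
    (hg : Primrec fun p : α × β => g p.1 p.2) : Primrec fun a => (f a).map (g a) :=
  Primrec.list_map hf hg

@[fun_prop] theorem primrec_flatMap {f : α → List β} {g : α → β → List γ} (hf : Primrec f)
    (hg : Primrec fun p : α × β => g p.1 p.2) : Primrec fun a => (f a).flatMap (g a) :=
  Primrec.list_flatMap hf hg

@[fun_prop] theorem primrec_sum {f : α → List ℕ} (hf : Primrec f) :
    Primrec fun a => (f a).sum := by
  have : Primrec fun a => (f a).foldr (fun b s => b + s) 0 :=
    Primrec.list_foldr hf (Primrec.const 0) (h := fun _ p => p.1 + p.2)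
      (show Primrec fun q : α × (ℕ × ℕ) => q.2.1 + q.2.2 by fun_prop)
  exact this

@[fun_prop] theorem primrec_ite {p : α → Prop} [DecidablePred p] {f g : α → β}
    (hp : PrimrecPred p) (hf : Primrec f) (hg : Primrec g) :
    Primrec fun a => if p a then f a else g a := Primrec.ite hp hf hg

@[fun_prop] theorem primrecPred_le {f g : α → ℕ} (hf : Primrec f) (hg : Primrec g) :
    PrimrecPred fun a => f a ≤ g a := Primrec.nat_le.comp hf hg

@[fun_prop] theorem primrecPred_lt {f g : α → ℕ} (hf : Primrec f) (hg : Primrec g) :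
    PrimrecPred fun a => f a < g a := Primrec.nat_lt.comp hf hg

@[fun_prop] theorem primrecPred_eq {f g : α → β} (hf : Primrec f) (hg : Primrec g) :
    PrimrecPred fun a => f a = g a := Primrec.eq.comp hf hg

@[fun_prop] theorem primrecPred_imp {p q : α → Prop} (hp : PrimrecPred p) (hq : PrimrecPred q) :
    PrimrecPred fun a => p a → q a :=
  (hp.not.or hq).of_eq fun a => by tauto

@[fun_prop] theorem primrecPred_ball {f : α → List β} {R : α → β → Prop} (hf : Primrec f)
    (hR : PrimrecPred fun p : α × β => R p.1 p.2) : PrimrecPred fun a => ∀ b ∈ f a, R a b := by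
  have : PrimrecRel fun (b : β) (a : α) => R a b := hR.comp (Primrec.pair Primrec.snd Primrec.fst)
  exact this.forall_mem_list.comp hf Primrec.id

@[fun_prop] theorem primrecPred_bex {f : α → List β} {R : α → β → Prop} (hf : Primrec f)
    (hR : PrimrecPred fun p : α × β => R p.1 p.2) : PrimrecPred fun a => ∃ b ∈ f a, R a b := by
  have : PrimrecRel fun (b : β) (a : α) => R a b := hR.comp (Primrec.pair Primrec.snd Primrec.fst)
  exact this.exists_mem_list.comp hf Primrec.id

@[fun_prop] theorem primrecPred_forall_lt {f : α → ℕ} {R : α → ℕ → Prop} (hf : Primrec f)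
    (hR : PrimrecPred fun p : α × ℕ => R p.1 p.2) : PrimrecPred fun a => ∀ b < f a, R a b := by
  have : PrimrecPred fun a => ∀ b ∈ List.range (f a), R a b := by fun_prop
  exact this.of_eq fun a => by simp

@[fun_prop] theorem primrecPred_mem {f : α → List β} {g : α → β} (hf : Primrec f)
    (hg : Primrec g) : PrimrecPred fun a => g a ∈ f a := by
  have : PrimrecPred fun a => ∃ b ∈ f a, b = g a := by fun_prop
  exact this.of_eq fun a => by simp

@[fun_prop] theorem primrec_encode {f : α → β} (hf : Primrec f) :
    Primrec fun a => Encodable.encode (f a) := Primrec.encode.comp hf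

/-- A projection of a primitive recursive predicate is recursively enumerable. -/
theorem rePred_exists {R : α → β → Prop} (h : PrimrecPred fun p : α × β => R p.1 p.2) :
    REPred fun a => ∃ b, R a b := by
  classical
  let f : α → ℕ → Option Unit := fun a n =>
    (Encodable.decode (α := β) n).bind fun b => if R a b then some () else none
  have hf : Computable₂ f := by
    refine Primrec.to_comp (Primrec.option_bind (Primrec.decode.comp Primrec.snd) ?_)
    exact Primrec.ite (h.comp (f := fun q : (α × ℕ) × β => (q.1.1, q.2)) (by fun_prop))
      (Primrec.const _) (Primrec.const _)
  refine (Partrec.dom_re (Partrec.rfindOpt hf)).of_eq fun a => ?_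
  rw [Nat.rfindOpt_dom]
  simp only [f, Option.mem_def, Option.bind_eq_some_iff]
  constructor
  · rintro ⟨n, u, b, -, hu⟩
    refine ⟨b, ?_⟩
    by_contra hc
    rw [if_neg hc] at hu
    cases hu
  · rintro ⟨b, hb⟩
    exact ⟨Encodable.encode b, (), b, Encodable.encodek b, by simp [hb]⟩

/-! ### Finite paths coded as lists -/

/-- `l` lists the steps of a finite `R`-path that starts in `a`. -/
def IsPath {α : Type*} (R : α → α → Prop) (a : α) (l : List α) : Prop :=
  -- The indices are in range and the default is never used; this form is a bounded quantifier over
  -- primitive recursive functions.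
  ∀ i < l.length, R (((a :: l)[i]?).getD a) (((a :: l)[i + 1]?).getD a)

/-- The end of the path `l` from `a`. -/
def pathEnd {α : Type*} (a : α) (l : List α) : α := ((a :: l)[l.length]?).getD a

theorem isPath_nil {α : Type*} {R : α → α → Prop} {a : α} : IsPath R a [] := by simp [IsPath]

theorem pathEnd_nil {α : Type*} {a : α} : pathEnd a [] = a := by simp [pathEnd]

theorem isPath_cons {α : Type*} {R : α → α → Prop} {a b : α} {l : List α} :
    IsPath R a (b :: l) ↔ R a b ∧ IsPath R b l := by
  have key : ∀ i < l.length + 1, (((a :: b :: l)[i + 1]?).getD a) = ((b :: l)[i]?).getD b := by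
    intro i hi
    rw [List.getElem?_cons_succ, List.getElem?_eq_getElem (by simpa using hi)]
    rfl
  constructor
  · intro h
    refine ⟨by simpa using h 0 (by simp), fun i hi => ?_⟩
    have := h (i + 1) (by simpa using hi)
    rwa [key i (by omega), key (i + 1) (by omega)] at this
  · rintro ⟨h0, h⟩ i hi
    cases i with
    | zero => simpa using h0
    | succ i =>
      simp only [List.length_cons, add_lt_add_iff_right] at hi
      rw [key i (by omega), key (i + 1) (by omega)]
      exact h i hi

theorem pathEnd_cons {α : Type*} {a b : α} {l : List α} : pathEnd a (b :: l) = pathEnd b l := by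
  simp only [pathEnd, List.length_cons, List.getElem?_cons_succ]
  rw [List.getElem?_eq_getElem (by simp)]
  rfl

@[fun_prop] theorem primrecPred_isPath {R : α → β → β → Prop} {a : α → β} {l : α → List β}
    (hR : PrimrecPred fun p : α × β × β => R p.1 p.2.1 p.2.2) (ha : Primrec a) (hl : Primrec l) :
    PrimrecPred fun x => IsPath (R x) (a x) (l x) := by
  unfold IsPath
  refine primrecPred_forall_lt (by fun_prop) ?_
  exact hR.comp (f := fun p : α × ℕ => (p.1, ((a p.1 :: l p.1)[p.2]?).getD (a p.1),
    ((a p.1 :: l p.1)[p.2 + 1]?).getD (a p.1))) (by fun_prop)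

@[fun_prop] theorem primrec_pathEnd {a : α → β} {l : α → List β}
    (ha : Primrec a) (hl : Primrec l) : Primrec fun x => pathEnd (a x) (l x) := by
  unfold pathEnd; fun_prop

end Primrec

/-! ## Reset machines with flagged edges -/

/-- An edge of a reset machine: source, operation, flag, target. The operation consists of a list
of pairs (increment, decrement) and of a number that is `0` if no counter is reset and `r + 1` if
counter `r` is reset. -/
abbrev GEdge (σ : Type) : Type := σ × (List (ℕ × ℕ) × ℕ) × ℕ × σ

/-- A reset machine with flagged edges: start, dimension, edges. -/
abbrev Gen (σ : Type) : Type := σ × ℕ × List (GEdge σ)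

namespace GEdge

variable {σ : Type}

abbrev src (e : GEdge σ) : σ := e.1
abbrev tgt (e : GEdge σ) : σ := e.2.2.2
abbrev flag (e : GEdge σ) : ℕ := e.2.2.1
abbrev rst (e : GEdge σ) : ℕ := e.2.1.2
abbrev pos (e : GEdge σ) (i : ℕ) : ℕ := (e.2.1.1.getD i (0, 0)).1
abbrev neg (e : GEdge σ) (i : ℕ) : ℕ := (e.2.1.1.getD i (0, 0)).2

/-- The effect of an edge on the counters below `D`. -/
def Fires (D : ℕ) (e : GEdge σ) (m m' : ℕ → ℕ) : Prop :=
  ∀ i < D, (e.rst = i + 1 → m' i = 0) ∧ (e.rst ≠ i + 1 → m' i + e.neg i = m i + e.pos i)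

/-- The change of counter `i` by an edge that is not a reset. -/
def delta (e : GEdge σ) (i : ℕ) : ℤ := (e.pos i : ℤ) - e.neg i

end GEdge

section Gen

variable {σ : Type}

/-- The edges in `w` can be fired one after the other, from `c` to `c'`. -/
def Runs (D : ℕ) : σ × (ℕ → ℕ) → List (GEdge σ) → σ × (ℕ → ℕ) → Prop
  | c, [], c' => c = c'
  | c, e :: w, c' => ∃ d, e.src = c.1 ∧ e.tgt = d.1 ∧ e.Fires D c.2 d.2 ∧ Runs D d w c'

/-- Without resets, `c` reaches a larger configuration and sees all flags on the way. -/
def SelfCovers (g : Gen σ) (c : σ × (ℕ → ℕ)) : Prop :=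
  ∃ w c', (∀ e ∈ w, e ∈ g.2.2 ∧ e.rst = 0) ∧ Runs g.2.1 c w c' ∧ c.1 = c'.1 ∧
    (∀ i < g.2.1, c.2 i ≤ c'.2 i) ∧ ∀ f < 3, ∃ e ∈ w, e.flag = f

/-- `c` reaches a configuration that covers itself without resets, seeing all flags. -/
def ReachesSelfCover (g : Gen σ) (c : σ × (ℕ → ℕ)) : Prop :=
  ∃ w c', (∀ e ∈ w, e ∈ g.2.2) ∧ Runs g.2.1 c w c' ∧ SelfCovers g c'

/-- The start configuration reaches one that covers itself without resets, seeing all flags. -/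
def Gen.Accepts (g : Gen σ) : Prop := ReachesSelfCover g (g.1, fun _ => 0)

variable {D : ℕ}

theorem runs_append {c c' : σ × (ℕ → ℕ)} {w₁ w₂ : List (GEdge σ)} :
    Runs D c (w₁ ++ w₂) c' ↔ ∃ d, Runs D c w₁ d ∧ Runs D d w₂ c' := by
  induction w₁ generalizing c with
  | nil => simp [Runs]
  | cons e w ih =>
    simp only [List.cons_append, Runs, ih]
    constructor
    · rintro ⟨d, h1, h2, h3, d', h4, h5⟩; exact ⟨d', ⟨d, h1, h2, h3, h4⟩, h5⟩
    · rintro ⟨d', ⟨d, h1, h2, h3, h4⟩, h5⟩; exact ⟨d, h1, h2, h3, d', h4, h5⟩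

theorem GEdge.Fires.mono {e : GEdge σ} {m m' k : ℕ → ℕ} (h : e.Fires D m m')
    (hk : ∀ i < D, m i ≤ k i) : ∃ k', e.Fires D k k' ∧ ∀ i < D, m' i ≤ k' i := by
  refine ⟨fun i => if e.rst = i + 1 then 0 else k i + e.pos i - e.neg i, fun i hi => ?_,
    fun i hi => ?_⟩
  · obtain ⟨h1, h2⟩ := h i hi
    have := hk i hi
    refine ⟨fun h => by simp [h], fun h => ?_⟩
    have := h2 h
    simp only [if_neg h]; omega
  · obtain ⟨h1, h2⟩ := h i hi
    have := hk i hi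
    by_cases hr : e.rst = i + 1
    · simp [h1 hr]
    · have := h2 hr
      simp only [if_neg hr]; omega

theorem Runs.mono {c c' d : σ × (ℕ → ℕ)} {w : List (GEdge σ)} (h : Runs D c w c')
    (hs : c.1 = d.1) (hd : ∀ i < D, c.2 i ≤ d.2 i) :
    ∃ d', Runs D d w d' ∧ c'.1 = d'.1 ∧ ∀ i < D, c'.2 i ≤ d'.2 i := by
  induction w generalizing c d with
  | nil => cases h; exact ⟨d, rfl, hs, hd⟩
  | cons e w ih =>
    obtain ⟨b, h1, h2, h3, h4⟩ := h
    obtain ⟨k, hk, hk'⟩ := h3.mono hd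
    obtain ⟨d', h5, h6⟩ := ih (d := (b.1, k)) h4 rfl hk'
    exact ⟨d', ⟨(b.1, k), h1.trans hs, h2, hk, h5⟩, h6⟩

theorem Runs.sum_delta {c c' : σ × (ℕ → ℕ)} {w : List (GEdge σ)} (h : Runs D c w c')
    (hr : ∀ e ∈ w, e.rst = 0) (i : ℕ) (hi : i < D) :
    (c'.2 i : ℤ) = c.2 i + (w.map (GEdge.delta · i)).sum := by
  induction w generalizing c with
  | nil => cases h; simp
  | cons e w ih =>
    obtain ⟨b, h1, h2, h3, h4⟩ := h
    have h5 := ih h4 (fun e he => hr e (by simp [he]))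
    have h6 := (h3 i hi).2 (by rw [hr e (by simp)]; omega)
    rw [h5, List.map_cons, List.sum_cons, GEdge.delta]
    have : (b.2 i : ℤ) + e.neg i = c.2 i + e.pos i := by exact_mod_cast h6
    linarith

/-- Edges without resets can be fired if no counter becomes negative. -/
theorem exists_runs {w : List (GEdge σ)} (hr : ∀ e ∈ w, e.rst = 0) {q q' : σ}
    (hw : IsWalk GEdge.src GEdge.tgt q w q') (m : ℕ → ℕ)
    (hm : ∀ p s, w = p ++ s → ∀ i < D, 0 ≤ (m i : ℤ) + (p.map (GEdge.delta · i)).sum) :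
    ∃ m', Runs D (q, m) w (q', m') := by
  induction w generalizing q m with
  | nil => cases hw; exact ⟨m, rfl⟩
  | cons e w ih =>
    obtain ⟨rfl, hw⟩ := hw
    have h1 : ∀ i < D, e.neg i ≤ m i + e.pos i := by
      intro i hi
      have := hm [e] w rfl i hi
      simp only [List.map_cons, List.map_nil, List.sum_cons, List.sum_nil, GEdge.delta] at this
      omega
    obtain ⟨m', h⟩ := ih (fun e he => hr e (by simp [he])) hw (fun i => m i + e.pos i - e.neg i) (by
      intro p s hp i hi
      have h2 := hm (e :: p) s (by rw [hp]; rfl) i hi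
      have h3 := h1 i hi
      rw [List.map_cons, List.sum_cons, GEdge.delta] at h2
      push_cast [Nat.cast_sub h3]
      linarith)
    refine ⟨m', (e.tgt, _), rfl, rfl, fun i hi => ⟨fun h => ?_, fun _ => ?_⟩, h⟩
    · rw [hr e (by simp)] at h; omega
    · have := h1 i hi
      simp only; omega

/-- Without resets, the effect of `w` does not depend on the configuration in which it starts. -/
theorem SelfCovers.mono {g : Gen σ} {c d : σ × (ℕ → ℕ)} (h : SelfCovers g c)
    (hs : c.1 = d.1) (hd : ∀ i < g.2.1, c.2 i ≤ d.2 i) : SelfCovers g d := by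
  obtain ⟨w, c', hw, hrun, hc, hle, hf⟩ := h
  obtain ⟨d', h1, h2, h3⟩ := hrun.mono hs hd
  refine ⟨w, d', hw, h1, hs.symm.trans (hc.trans h2), fun i hi => ?_, hf⟩
  have h4 := h1.sum_delta (fun e he => (hw e he).2) i hi
  have h5 := hrun.sum_delta (fun e he => (hw e he).2) i hi
  have := hle i hi
  omega

/-- Hence the configurations that do not reach a self-cover form a downward closed set, to which
`exists_ideals` applies. -/
theorem ReachesSelfCover.mono {g : Gen σ} {c d : σ × (ℕ → ℕ)} (h : ReachesSelfCover g c)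
    (hs : c.1 = d.1) (hd : ∀ i < g.2.1, c.2 i ≤ d.2 i) : ReachesSelfCover g d := by
  obtain ⟨w, c', hw, hrun, hc⟩ := h
  obtain ⟨d', h1, h2, h3⟩ := hrun.mono hs hd
  exact ⟨w, d', hw, h1, hc.mono h2 h3⟩

/-! ### Downward closed sets are finite unions of ideals -/

/-- `m` is below the ideal `v`; the number `0` stands for an unbounded entry, and `k + 1` for the
bound `k`. -/
def Below {ι : Type*} (m v : ι → ℕ) : Prop := ∀ i, v i = 0 ∨ m i + 1 ≤ v i

/-- The complement of `X` has finitely many minimal elements by Dickson's lemma. Avoiding the cone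
above one of them means being smaller in some coordinate, so it splits an ideal into finitely many
ideals. -/
theorem exists_ideals {n : ℕ} (X : Set (Fin n → ℕ)) (hX : ∀ m k, k ≤ m → m ∈ X → k ∈ X) :
    ∃ B : Finset (Fin n → ℕ), ∀ m, m ∈ X ↔ ∃ v ∈ B, Below m v := by
  classical
  have hfin : {m | Minimal (· ∈ Xᶜ) m}.Finite :=
    WellQuasiOrderedLE.finite_of_isAntichain (setOfPred_minimal_antichain (· ∈ Xᶜ))
  have hmin : ∀ m, m ∉ X ↔ ∃ k ∈ hfin.toFinset, k ≤ m := by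
    intro m
    constructor
    · intro hm
      obtain ⟨k, hk, hmink⟩ := exists_minimal_le_of_wellFoundedLT (· ∈ Xᶜ) m hm
      exact ⟨k, by simpa using hmink, hk⟩
    · rintro ⟨k, hk, hkm⟩ hm
      have : Minimal (· ∈ Xᶜ) k := by simpa using hk
      exact this.prop (hX m k hkm hm)
  have key : ∀ S : Finset (Fin n → ℕ), ∃ B : Finset (Fin n → ℕ),
      ∀ m : Fin n → ℕ, (¬ ∃ k ∈ S, k ≤ m) ↔ ∃ v ∈ B, Below m v := by
    intro S
    induction S using Finset.induction_on with
    | empty => exact ⟨{fun _ => 0}, fun m => by simp [Below]⟩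
    | insert k S hk ih =>
      obtain ⟨B, hB⟩ := ih
      -- The condition `m i < k i` is the ideal entry `k i`, because entries exceed bounds by one.
      -- The case `k i = 0` is unsatisfiable and has to be removed, since the entry `0` stands for
      -- an unbounded coordinate.
      refine ⟨((B ×ˢ Finset.univ).filter fun p => k p.2 ≠ 0).image fun p =>
        Function.update p.1 p.2 (if p.1 p.2 = 0 then k p.2 else min (p.1 p.2) (k p.2)), fun m => ?_⟩
      have h1 : (¬ ∃ k' ∈ insert k S, k' ≤ m) ↔ (∃ v ∈ B, Below m v) ∧ ∃ i, m i < k i := by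
        rw [← hB m]
        simp only [Finset.mem_insert, exists_eq_or_imp, not_or, Pi.le_def, not_forall, not_le]
        tauto
      rw [h1]
      simp only [Finset.mem_image, Finset.mem_filter, Finset.mem_product, Finset.mem_univ, and_true,
        Prod.exists]
      constructor
      · rintro ⟨⟨v, hv, hmv⟩, i, hi⟩
        refine ⟨_, ⟨v, i, ⟨hv, by omega⟩, rfl⟩, fun j => ?_⟩
        by_cases hj : j = i
        · subst hj
          have := hmv j
          rw [Function.update_self]
          split_ifs <;> omega
        · rw [Function.update_of_ne hj]; exact hmv j
      · rintro ⟨_, ⟨v, i, ⟨hv, hi⟩, rfl⟩, h⟩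
        have h2 := h i
        rw [Function.update_self] at h2
        refine ⟨⟨v, hv, fun j => ?_⟩, i, ?_⟩
        · by_cases hj : j = i
          · subst hj; split_ifs at h2 with h0 <;> omega
          · have := h j
            rwa [Function.update_of_ne hj] at this
        · split_ifs at h2 with h0 <;> omega
  obtain ⟨B, hB⟩ := key hfin.toFinset
  exact ⟨B, fun m => by rw [← hB m, ← hmin m, not_not]⟩

end Gen

/-! ## Certificates of non-acceptance -/

section Cert

variable {σ : Type}

/-- An edge between two nodes, which are given by numbers. -/
abbrev NodeEdge (σ : Type) : Type := ℕ × GEdge σ × ℕ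

/-- The ideal `b` bounds all results of firing `e` below the ideal `a`. -/
def Covers (D : ℕ) (e : GEdge σ) (v v' : ℕ → ℕ) : Prop :=
  -- Both entries exceed their bounds by one, so the offsets cancel. A counter that was reset is `0`
  -- and lies below every entry.
  ∀ i < D, e.rst = i + 1 ∨ v' i = 0 ∨ (v i ≠ 0 ∧ v i + e.pos i ≤ v' i + e.neg i)

/-- Some element below the ideal `v` enables `e`. -/
def Enabled (D : ℕ) (e : GEdge σ) (v : ℕ → ℕ) : Prop :=
  -- The largest value below a bounded entry is `v i - 1`.
  ∀ i < D, e.rst = i + 1 ∨ v i = 0 ∨ e.neg i + 1 ≤ v i + e.pos i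

/-- The change of the counters along an edge between nodes. -/
def nodeDelta (D : ℕ) (e : NodeEdge σ) (i : Fin D) : ℤ := e.2.1.delta i

/-- The ranking certificates for a list of edges between nodes. -/
abbrev RankedNodes (D : ℕ) (E : List (NodeEdge σ)) : Prop :=
  Ranked (fun e : NodeEdge σ => e.1) (fun e => e.2.2) (nodeDelta D) (fun e => e.2.1.flag) E

variable [Primcodable σ]

/-- The number of a node. -/
abbrev nodeNum (a : σ × List ℕ) : ℕ := Encodable.encode a

/-- The entries of a list as a function. -/
abbrev entries (l : List ℕ) (i : ℕ) : ℕ := l.getD i 0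

/-- The ideals in `nodes` contain the start configuration and are closed under steps, and `EG`
contains the edges between them that are not resets. -/
def Closed (g : Gen σ) (nodes : List (σ × List ℕ)) (EG : List (NodeEdge σ)) : Prop :=
  -- Every ideal contains the zero valuation, so only the state of the start configuration matters.
  (∃ a ∈ nodes, a.1 = g.1) ∧ ∀ a ∈ nodes, ∀ e ∈ g.2.2, e.src = a.1 →
    Enabled g.2.1 e (entries a.2) → ∃ b ∈ nodes, e.tgt = b.1 ∧
      Covers g.2.1 e (entries a.2) (entries b.2) ∧
      (e.rst ≠ 0 ∨ (nodeNum a, e, nodeNum b) ∈ EG)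

variable {g : Gen σ} {nodes : List (σ × List ℕ)} {EG : List (NodeEdge σ)}

/-- The configuration `c` lies in the ideal `a`. -/
def InNode (D : ℕ) (c : σ × (ℕ → ℕ)) (a : σ × List ℕ) : Prop :=
  c.1 = a.1 ∧ ∀ i < D, entries a.2 i = 0 ∨ c.2 i + 1 ≤ entries a.2 i

theorem Closed.step (h : Closed g nodes EG) {e : GEdge σ} (he : e ∈ g.2.2)
    {c c' : σ × (ℕ → ℕ)} (hs : e.src = c.1) (ht : e.tgt = c'.1) (hf : e.Fires g.2.1 c.2 c'.2)
    {a : σ × List ℕ} (ha : a ∈ nodes) (hca : InNode g.2.1 c a) :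
    ∃ b ∈ nodes, InNode g.2.1 c' b ∧ (e.rst ≠ 0 ∨ (nodeNum a, e, nodeNum b) ∈ EG) := by
  obtain ⟨b, hb, h1, h2, h3⟩ := h.2 a ha e he (hs.trans hca.1) (fun i hi => by
    by_cases hr : e.rst = i + 1
    · exact Or.inl hr
    have := (hf i hi).2 hr
    have := hca.2 i hi
    omega)
  refine ⟨b, hb, ⟨ht.symm.trans h1, fun i hi => ?_⟩, h3⟩
  have h4 := hf i hi
  have h5 := hca.2 i hi
  rcases h2 i hi with h6 | h6 | h6
  · have := h4.1 h6; omega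
  · exact Or.inl h6
  · by_cases hr : e.rst = i + 1
    · have := h4.1 hr; omega
    · have := h4.2 hr; omega

theorem Closed.runs (h : Closed g nodes EG) {w : List (GEdge σ)} (hw : ∀ e ∈ w, e ∈ g.2.2)
    {c c' : σ × (ℕ → ℕ)} (hrun : Runs g.2.1 c w c') {a : σ × List ℕ} (ha : a ∈ nodes)
    (hca : InNode g.2.1 c a) : ∃ b ∈ nodes, InNode g.2.1 c' b ∧ ((∀ e ∈ w, e.rst = 0) →
      ∃ w' : List (NodeEdge σ), w'.map (fun e => e.2.1) = w ∧ (∀ e ∈ w', e ∈ EG) ∧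
        IsWalk (fun e => e.1) (fun e => e.2.2) (nodeNum a) w' (nodeNum b)) := by
  induction w generalizing c a with
  | nil => cases hrun; exact ⟨a, ha, hca, fun _ => ⟨[], rfl, by simp, rfl⟩⟩
  | cons e w ih =>
    obtain ⟨d, h1, h2, h3, h4⟩ := hrun
    obtain ⟨b, hb, hdb, h5⟩ := h.step (hw e (by simp)) h1 h2 h3 ha hca
    obtain ⟨b', hb', hcb', h6⟩ := ih (fun e he => hw e (by simp [he])) h4 hb hdb
    refine ⟨b', hb', hcb', fun hr => ?_⟩
    obtain ⟨w', h7, h8, h9⟩ := h6 (fun e he => hr e (by simp [he]))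
    have h10 := h5.resolve_left (by simp [hr e (by simp)])
    refine ⟨(nodeNum a, e, nodeNum b) :: w', by simp [h7], ?_, rfl, h9⟩
    intro x hx
    rcases List.mem_cons.1 hx with rfl | hx
    exacts [h10, h8 x hx]

/-- A self-covering loop can be fired again and again, and closedness lets the ideals follow it. As
there are finitely many, one of them recurs, which yields a closed walk in `EG` of nonnegative
effect with all flags, against `Ranked.exists_missing`. -/
theorem not_accepts_of_closed (h : Closed g nodes EG) (hR : RankedNodes g.2.1 EG) :
    ¬ g.Accepts := by
  rintro ⟨w0, c, hw0, hrun0, w, c', hw, hrun, hcc, hle, hflag⟩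
  obtain ⟨a0, ha0, hstart⟩ := h.1
  obtain ⟨a, ha, hca, -⟩ := h.runs hw0 hrun0 ha0 ⟨hstart.symm, fun i _ => by simp; omega⟩
  -- The ideals that contain a configuration above `c`, from which the loop can therefore be fired.
  let Inn : σ × List ℕ → Prop := fun a =>
    ∃ d, c.1 = d.1 ∧ (∀ i < g.2.1, c.2 i ≤ d.2 i) ∧ InNode g.2.1 d a
  let T : σ × List ℕ → σ × List ℕ → Prop := fun a b =>
    ∃ w' : List (NodeEdge σ), (∀ e ∈ w', e ∈ EG) ∧
      IsWalk (fun e => e.1) (fun e => e.2.2) (nodeNum a) w' (nodeNum b) ∧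
      (∀ i : Fin g.2.1, 0 ≤ (w'.map (nodeDelta g.2.1 · i)).sum) ∧ ∀ f < 3, ∃ e ∈ w', e.2.1.flag = f
  have hstep : ∀ p : {a // a ∈ nodes ∧ Inn a}, ∃ q : {a // a ∈ nodes ∧ Inn a}, T p.1 q.1 := by
    rintro ⟨b, hb, d, hd1, hd2, hdb⟩
    obtain ⟨d', h1, h2, h3⟩ := hrun.mono hd1 hd2
    obtain ⟨b', hb', hdb', h4⟩ := h.runs (fun e he => (hw e he).1) h1 hb hdb
    obtain ⟨w', h5, h6, h7⟩ := h4 fun e he => (hw e he).2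
    refine ⟨⟨b', hb', d', hcc.trans h2, fun i hi => (hle i hi).trans (h3 i hi), hdb'⟩,
      w', h6, h7, fun i => ?_, fun f hf => ?_⟩
    · have h8 := hrun.sum_delta (fun e he => (hw e he).2) i i.2
      have h9 := hle i i.2
      have : (w'.map (nodeDelta g.2.1 · i)) = w.map (GEdge.delta · i) := by
        rw [← h5, List.map_map]; rfl
      rw [this]; omega
    · obtain ⟨e, he, hef⟩ := hflag f hf
      rw [← h5, List.mem_map] at he
      obtain ⟨x, hx, rfl⟩ := he
      exact ⟨x, hx, hef⟩
  have htrans : ∀ a b d, T a b → T b d → T a d := by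
    rintro a b d ⟨w1, h1, h2, h3, h4⟩ ⟨w2, k1, k2, k3, k4⟩
    refine ⟨w1 ++ w2, fun e he => ?_, isWalk_append.2 ⟨_, h2, k2⟩, fun i => ?_, fun f hf => ?_⟩
    · rcases List.mem_append.1 he with he | he
      exacts [h1 e he, k1 e he]
    · rw [List.map_append, List.sum_append]; exact add_nonneg (h3 i) (k3 i)
    · obtain ⟨e, he, hef⟩ := h4 f hf
      exact ⟨e, by simp [he], hef⟩
  choose next hnext using hstep
  let s : ℕ → {a // a ∈ nodes ∧ Inn a} := fun n =>
    next^[n] ⟨a, ha, c, rfl, fun _ _ => le_rfl, hca⟩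
  have hs : ∀ n k, T (s n).1 (s (n + k + 1)).1 := by
    intro n k
    induction k with
    | zero => simp only [s, add_zero, Function.iterate_succ_apply']; exact hnext _
    | succ k ih =>
      refine htrans _ _ _ ih ?_
      rw [← add_assoc n k 1]
      simp only [s, Function.iterate_succ_apply' _ (n + k + 1)]; exact hnext _
  have hfin : Finite {a // a ∈ nodes ∧ Inn a} := (nodes.finite_toSet.subset fun a ha => ha.1)
  obtain ⟨i, j, hij, heq⟩ := Finite.exists_ne_map_eq_of_infinite s
  have : ∃ n k, s n = s (n + k + 1) := by
    rcases lt_or_gt_of_ne hij with h | h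
    · exact ⟨i, j - i - 1, by rw [heq]; congr 1; omega⟩
    · exact ⟨j, i - j - 1, by rw [← heq]; congr 1; omega⟩
  obtain ⟨n, k, hnk⟩ := this
  obtain ⟨w', h1, h2, h3, h4⟩ := hs n k
  rw [← hnk] at h2
  obtain ⟨f, hf, hmiss⟩ := hR.exists_missing h1 h2 h3
  obtain ⟨e, he, hef⟩ := h4 f hf
  exact hmiss e he hef

/-- Unbounded coordinates stay unbounded along edges. Hence a coordinate that is bounded at the end
was bounded all along, and the inequalities of `Covers` add up. -/
theorem walk_bound (hEG : ∀ x ∈ EG, ∃ a ∈ nodes, ∃ b ∈ nodes, x.1 = nodeNum a ∧ x.2.2 = nodeNum b ∧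
      x.2.1 ∈ g.2.2 ∧ x.2.1.rst = 0 ∧ x.2.1.src = a.1 ∧ x.2.1.tgt = b.1 ∧
      Covers g.2.1 x.2.1 (entries a.2) (entries b.2))
    {w : List (NodeEdge σ)} (hw : ∀ e ∈ w, e ∈ EG) {a b : σ × List ℕ}
    (h : IsWalk (fun e => e.1) (fun e => e.2.2) (nodeNum a) w (nodeNum b)) :
    IsWalk GEdge.src GEdge.tgt a.1 (w.map fun e => e.2.1) b.1 ∧ ∀ i < g.2.1, entries b.2 i = 0 ∨
      (entries a.2 i ≠ 0 ∧
        (entries a.2 i : ℤ) + ((w.map fun e => e.2.1).map (GEdge.delta · i)).sum ≤ entries b.2 i) := by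
  induction w generalizing a with
  | nil =>
    obtain rfl := Encodable.encode_injective h
    exact ⟨rfl, fun i _ => by simp; omega⟩
  | cons x w ih =>
    obtain ⟨h1, h2⟩ := h
    obtain ⟨a', -, d, -, h3, h4, h5, h6, h7, h8, h9⟩ := hEG x (hw x (by simp))
    obtain rfl := Encodable.encode_injective (h1.symm.trans h3)
    have h2' : IsWalk (fun e : NodeEdge σ => e.1) (fun e => e.2.2) (nodeNum d) w (nodeNum b) := by
      have : x.2.2 = nodeNum d := h4
      rw [← this]; exact h2
    obtain ⟨h10, h11⟩ := ih (fun e he => hw e (by simp [he])) h2'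
    refine ⟨⟨h7, by rw [h8]; exact h10⟩, fun i hi => ?_⟩
    have h12 := h11 i hi
    have h13 := h9 i hi
    rw [h6] at h13
    simp only [List.map_cons, List.sum_cons]
    have h14 : x.2.1.delta i = (x.2.1.pos i : ℤ) - x.2.1.neg i := rfl
    rw [h14]
    omega

/-- The nodes are the ideals of the configurations that do not reach a self-cover. This set is
closed under steps, and the ranking exists because a closed walk of nonnegative effect with all
flags could be fired from a large element of its ideal, which would then cover itself. -/
theorem exists_closed_of_not_accepts (h : ¬ g.Accepts) :
    ∃ (nodes : List (σ × List ℕ)) (EG : List (NodeEdge σ)),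
      Closed g nodes EG ∧ RankedNodes g.2.1 EG := by
  classical
  set D := g.2.1 with hD
  let ext : (Fin D → ℕ) → ℕ → ℕ := fun m i => if h : i < D then m ⟨i, h⟩ else 0
  have hB := fun q : σ => exists_ideals {m : Fin D → ℕ | ¬ ReachesSelfCover g (q, ext m)}
    (fun m k hkm hm hk => hm (hk.mono rfl fun i hi => by
      simp only [ext, dif_pos (show i < D from hi)]; exact hkm _))
  choose B hB using hB
  let states : List σ := g.1 :: g.2.2.map GEdge.tgt
  let nodes : List (σ × List ℕ) := states.flatMap fun q => (B q).toList.map fun v => (q, List.ofFn v)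
  have hnodes : ∀ a, a ∈ nodes ↔ a.1 ∈ states ∧ ∃ v ∈ B a.1, List.ofFn v = a.2 := by
    rintro ⟨q, l⟩
    simp only [nodes, List.mem_flatMap, List.mem_map, Finset.mem_toList, Prod.mk.injEq]
    constructor
    · rintro ⟨q', h1, v, h2, rfl, rfl⟩; exact ⟨h1, v, h2, rfl⟩
    · rintro ⟨h1, v, h2, h3⟩; exact ⟨q, h1, v, h2, rfl, h3⟩
  have hent : ∀ (v : Fin D → ℕ) i (hi : i < D), entries (List.ofFn v) i = v ⟨i, hi⟩ := by
    intro v i hi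
    simp [entries, List.getD_eq_getElem?_getD, hi]
  have hlow : ∀ a ∈ nodes, ∀ m : ℕ → ℕ, InNode D (a.1, m) a → ¬ ReachesSelfCover g (a.1, m) := by
    rintro a ha m ⟨-, hm⟩ hr
    obtain ⟨-, v, hv, hva⟩ := (hnodes a).1 ha
    have : (fun i : Fin D => m i) ∈ {m : Fin D → ℕ | ¬ ReachesSelfCover g (a.1, ext m)} := by
      rw [hB]
      refine ⟨v, hv, fun i => ?_⟩
      have := hm i i.2
      rwa [← hva, hent v i i.2] at this
    exact this (hr.mono rfl fun i hi => by simp [ext, show i < D from hi])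
  let EG : List (NodeEdge σ) := (((nodes ×ˢ g.2.2) ×ˢ nodes).filter fun p =>
    p.1.2.rst = 0 ∧ p.1.2.src = p.1.1.1 ∧ p.1.2.tgt = p.2.1 ∧
      Covers D p.1.2 (entries p.1.1.2) (entries p.2.2)).map fun p => (nodeNum p.1.1, p.1.2, nodeNum p.2)
  have hEG : ∀ x, x ∈ EG ↔ ∃ a ∈ nodes, ∃ b ∈ nodes, x.1 = nodeNum a ∧ x.2.2 = nodeNum b ∧
      x.2.1 ∈ g.2.2 ∧ x.2.1.rst = 0 ∧ x.2.1.src = a.1 ∧ x.2.1.tgt = b.1 ∧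
      Covers D x.2.1 (entries a.2) (entries b.2) := by
    rintro ⟨n, e, n'⟩
    simp only [EG, List.mem_map, List.mem_filter, decide_eq_true_eq]
    constructor
    · rintro ⟨⟨⟨a, e'⟩, b⟩, h1, h2⟩
      cases h2
      obtain ⟨h1, h3⟩ := h1
      obtain ⟨h1, hb⟩ := List.pair_mem_product.1 h1
      obtain ⟨ha, he⟩ := List.pair_mem_product.1 h1
      exact ⟨a, ha, b, hb, rfl, rfl, he, h3⟩
    · rintro ⟨a, h1, b, h2, rfl, rfl, h5, h6⟩
      exact ⟨((a, e), b), ⟨List.pair_mem_product.2 ⟨List.pair_mem_product.2 ⟨h1, h5⟩, h2⟩, h6⟩, rfl⟩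
  refine ⟨nodes, EG, ⟨?_, ?_⟩, ranked_of_forall_walk EG ?_⟩
  · have : (fun _ => 0) ∈ {m : Fin D → ℕ | ¬ ReachesSelfCover g (g.1, ext m)} := by
      intro hr
      exact h (hr.mono rfl fun i hi => by simp [ext])
    obtain ⟨v, hv, -⟩ := (hB _ _).1 this
    exact ⟨(g.1, List.ofFn v), (hnodes _).2 ⟨by simp [states], v, hv, rfl⟩, rfl⟩
  · intro a ha e he hsrc hen
    -- Elements of the ideal that are maximal in the bounded coordinates and tend to infinity in the
    -- others, large enough to enable `e`.
    let M : ℕ → ℕ → ℕ := fun N i => if entries a.2 i = 0 then N + e.neg i else entries a.2 i - 1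
    let M' : ℕ → ℕ → ℕ := fun N i => if e.rst = i + 1 then 0 else M N i + e.pos i - e.neg i
    have hfire : ∀ N, e.Fires D (M N) (M' N) := by
      intro N i hi
      refine ⟨fun hr => by simp [M', hr], fun hr => ?_⟩
      have := hen i hi
      simp only [M', if_neg hr, M]
      split_ifs with h0 <;> omega
    have hgood : ∀ N, ¬ ReachesSelfCover g (e.tgt, M' N) := by
      rintro N ⟨w, c', h1, h2, h3⟩
      refine hlow a ha (M N) ⟨rfl, fun i hi => ?_⟩ ⟨e :: w, c', ?_, ⟨(e.tgt, M' N), hsrc, rfl, hfire N, h2⟩, h3⟩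
      · simp only [M]; split_ifs with h0 <;> omega
      · intro x hx
        rcases List.mem_cons.1 hx with rfl | hx
        exacts [he, h1 x hx]
    have hex : ∀ N, ∃ v : B e.tgt, Below (fun i : Fin D => M' N i) v.1 := by
      intro N
      have : (fun i : Fin D => M' N i) ∈ {m : Fin D → ℕ | ¬ ReachesSelfCover g (e.tgt, ext m)} := by
        intro hr
        exact hgood N (hr.mono rfl fun i hi => by simp [ext, show i < D from hi])
      obtain ⟨v, hv, h⟩ := (hB _ _).1 this
      exact ⟨⟨v, hv⟩, h⟩
    choose v hv using hex
    -- One ideal contains the results for infinitely many `N`, so it is unbounded wherever they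
    -- grow.
    obtain ⟨v0, hv0⟩ := Finite.exists_infinite_fiber v
    have hinf := Set.infinite_coe_iff.1 hv0
    have hbnode : (e.tgt, List.ofFn v0.1) ∈ nodes :=
      (hnodes _).2 ⟨List.mem_cons_of_mem _ (List.mem_map.2 ⟨e, he, rfl⟩), v0.1, v0.2, rfl⟩
    have hcov : Covers D e (entries a.2) (entries (List.ofFn v0.1)) := by
      intro i hi
      rw [hent _ i hi]
      by_contra hc
      push Not at hc
      obtain ⟨hr, h0, hc⟩ := hc
      obtain ⟨N, hN, hlt⟩ := hinf.exists_gt (v0.1 ⟨i, hi⟩)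
      have h1 := hv N ⟨i, hi⟩
      rw [show v N = v0 from hN] at h1
      have h2 := hen i hi
      simp only [M', if_neg hr, M] at h1
      split_ifs at h1 with h3
      · omega
      · have := hc h3
        omega
    refine ⟨_, hbnode, rfl, hcov, ?_⟩
    by_cases hr : e.rst = 0
    · exact Or.inr ((hEG _).2 ⟨a, ha, _, hbnode, rfl, rfl, he, hr, hsrc, rfl, hcov⟩)
    · exact Or.inl hr
  · intro u w hw hwalk hpos
    by_contra hc
    push Not at hc
    cases w with
    | nil => obtain ⟨e, he, -⟩ := hc 0 (by simp); simp at he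
    | cons x w0 =>
    obtain ⟨a, ha, b, hb, h1, -⟩ := (hEG x).1 (hw x (by simp))
    obtain rfl : u = nodeNum a := by rw [← h1]; exact hwalk.1.symm
    generalize hw' : x :: w0 = w at *
    clear hw'
    have hbound := fun {p : List (NodeEdge σ)} {a b : σ × List ℕ} (hp : ∀ e ∈ p, e ∈ EG) =>
      walk_bound (a := a) (b := b) (fun x hx => (hEG x).1 hx) hp
    obtain ⟨hwalk', htight⟩ := hbound hw hwalk
    -- The sum of all decrements on the walk: with this value, no unbounded coordinate can become
    -- negative.
    let N : ℕ := (w.map fun e => ((List.range D).map fun i => e.2.1.neg i).sum).sum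
    let m : ℕ → ℕ := fun i => if entries a.2 i = 0 then N else entries a.2 i - 1
    have hrst : ∀ e ∈ w.map (fun e => e.2.1), e ∈ g.2.2 ∧ e.rst = 0 := by
      intro e he
      obtain ⟨y, hy, rfl⟩ := List.mem_map.1 he
      obtain ⟨_, -, _, -, -, -, h5, h6, -⟩ := (hEG y).1 (hw y hy)
      exact ⟨h5, h6⟩
    obtain ⟨m', hm'⟩ := exists_runs (D := D) (fun e he => (hrst e he).2) hwalk' m (by
      intro p s hps i hi
      obtain ⟨p', s', rfl, rfl, rfl⟩ := List.map_eq_append_iff.1 hps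
      by_cases h0 : entries a.2 i = 0
      · have hle : ∀ l : List (NodeEdge σ), -(((l.map fun e => ((List.range D).map fun i => e.2.1.neg i).sum).sum : ℕ) : ℤ)
            ≤ ((l.map fun e => e.2.1).map (GEdge.delta · i)).sum := by
          intro l
          induction l with
          | nil => simp
          | cons y l ih =>
            have h2 : y.2.1.neg i ≤ ((List.range D).map fun i => y.2.1.neg i).sum :=
              List.single_le_sum (by simp) _ (List.mem_map.2 ⟨i, List.mem_range.2 hi, rfl⟩)
            simp only [List.map_cons, List.sum_cons, GEdge.delta]
            push_cast at ih ⊢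
            have h3 : (y.2.1.neg i : ℤ) ≤ (((List.range D).map fun i => y.2.1.neg i).sum : ℕ) := by
              exact_mod_cast h2
            push_cast at h3
            simp only [GEdge.delta] at ih
            linarith [Int.natCast_nonneg (y.2.1.pos i)]
        have h2 := hle p'
        have h3 : ((p'.map fun e => ((List.range D).map fun i => e.2.1.neg i).sum).sum) ≤ N := by
          simp only [N, List.map_append, List.sum_append]; omega
        simp only [m, if_pos h0]
        have h3' : (((p'.map fun e => ((List.range D).map fun i => e.2.1.neg i).sum).sum : ℕ) : ℤ) ≤ N := by
          exact_mod_cast h3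
        linarith
      -- In a bounded coordinate, `walk_bound` limits the gain of the remaining walk `s'` by the
      -- difference of the entries at `a` and at the current node. As the total effect is
      -- nonnegative, the value after `p'` is at least the maximal value at the current node.
      · obtain ⟨n, hn1, hn2⟩ := isWalk_append.1 hwalk
        have h3 : ∃ d : σ × List ℕ, n = nodeNum d := by
          cases s' with
          | nil => exact ⟨a, hn2⟩
          | cons y s' =>
            obtain ⟨d, -, _, -, h4, -⟩ := (hEG y).1 (hw y (by simp))
            exact ⟨d, by rw [← h4]; exact hn2.1.symm⟩
        obtain ⟨d, rfl⟩ := h3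
        have h4 := (hbound (fun e he => hw e (by simp [he])) hn1).2 i hi
        have h5 := (hbound (fun e he => hw e (by simp [he])) hn2).2 i hi
        have h6 := hpos ⟨i, hi⟩
        have h7 : ((p' ++ s').map (nodeDelta D · ⟨i, hi⟩)).sum =
            ((p'.map fun e => e.2.1).map (GEdge.delta · i)).sum +
            ((s'.map fun e => e.2.1).map (GEdge.delta · i)).sum := by
          rw [List.map_append, List.sum_append, List.map_map, List.map_map]; rfl
        rw [h7] at h6
        simp only [m, if_neg h0]
        omega)
    have hsum := fun i hi => hm'.sum_delta (fun e he => (hrst e he).2) i hi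
    refine hlow a ha m ⟨rfl, fun i hi => ?_⟩ ⟨[], (a.1, m), by simp, rfl, _, (a.1, m'), hrst, hm', rfl, ?_, ?_⟩
    · simp only [m]; split_ifs with h0 <;> omega
    · intro i hi
      have h2 := hsum i hi
      have h3 := hpos ⟨i, hi⟩
      have h4 : (w.map (nodeDelta D · ⟨i, hi⟩)).sum = ((w.map fun e => e.2.1).map (GEdge.delta · i)).sum := by
        rw [List.map_map]; rfl
      rw [h4] at h3
      simp only at h2 ⊢
      omega
    · intro f hf
      obtain ⟨e, he, hef⟩ := hc f hf
      exact ⟨e.2.1, List.mem_map.2 ⟨e, he, rfl⟩, hef⟩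

end Cert

/-! ## Acceptance of reset machines is decidable -/

section Decide

variable {σ : Type}

/-- A configuration given by lists, with the flag of the edge that was taken last. -/
abbrev CodedConfig (σ : Type) : Type := (σ × List ℕ) × ℕ

/-- A step between coded configurations; if `b` holds, then resets are excluded. -/
def CodedStep (b : Bool) (g : Gen σ) (x x' : CodedConfig σ) : Prop :=
  ∃ e ∈ g.2.2, (b = true → e.rst = 0) ∧ e.flag = x'.2 ∧ e.src = x.1.1 ∧ e.tgt = x'.1.1 ∧
    e.Fires g.2.1 (entries x.1.2) (entries x'.1.2)

theorem exists_codedPath {b : Bool} {g : Gen σ} {w : List (GEdge σ)}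
    (hw : ∀ e ∈ w, e ∈ g.2.2 ∧ (b = true → e.rst = 0)) {c c' : σ × (ℕ → ℕ)}
    (h : Runs g.2.1 c w c') (l : List ℕ) (f : ℕ) (hl : ∀ i < g.2.1, entries l i = c.2 i) :
    ∃ p, IsPath (CodedStep b g) ((c.1, l), f) p ∧ (pathEnd ((c.1, l), f) p).1.1 = c'.1 ∧
      (∀ i < g.2.1, entries (pathEnd ((c.1, l), f) p).1.2 i = c'.2 i) ∧
      ∀ e ∈ w, ∃ x ∈ p, x.2 = e.flag := by
  induction w generalizing c l f with
  | nil => cases h; exact ⟨[], isPath_nil, by simp [pathEnd_nil], by simpa [pathEnd_nil] using hl, by simp⟩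
  | cons e w ih =>
    obtain ⟨d, h1, h2, h3, h4⟩ := h
    have hent : ∀ i < g.2.1, entries ((List.range g.2.1).map d.2) i = d.2 i := by
      intro i hi
      simp [entries, List.getD_eq_getElem?_getD, hi]
    obtain ⟨p, k1, k2, k3, k4⟩ := ih (fun e he => hw e (by simp [he])) h4
      ((List.range g.2.1).map d.2) e.flag hent
    refine ⟨((d.1, (List.range g.2.1).map d.2), e.flag) :: p, ?_, ?_, ?_, ?_⟩
    · refine isPath_cons.2 ⟨⟨e, (hw e (by simp)).1, (hw e (by simp)).2, rfl, h1, h2, fun i hi => ?_⟩, k1⟩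
      rw [hent i hi, hl i hi]
      exact h3 i hi
    · rw [pathEnd_cons]; exact k2
    · rw [pathEnd_cons]; exact k3
    · intro e' he'
      rcases List.mem_cons.1 he' with rfl | he'
      · exact ⟨_, List.mem_cons_self, rfl⟩
      · obtain ⟨x, hx, h⟩ := k4 e' he'
        exact ⟨x, by simp [hx], h⟩

theorem exists_runs_of_codedPath {b : Bool} {g : Gen σ} {p : List (CodedConfig σ)}
    {x : CodedConfig σ} (h : IsPath (CodedStep b g) x p) :
    ∃ w, (∀ e ∈ w, e ∈ g.2.2 ∧ (b = true → e.rst = 0)) ∧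
      Runs g.2.1 (x.1.1, entries x.1.2) w ((pathEnd x p).1.1, entries (pathEnd x p).1.2) ∧
      ∀ y ∈ p, ∃ e ∈ w, e.flag = y.2 := by
  induction p generalizing x with
  | nil => exact ⟨[], by simp, rfl, by simp⟩
  | cons y p ih =>
    obtain ⟨⟨e, h1, h2, h3, h4, h5, h6⟩, h⟩ := isPath_cons.1 h
    obtain ⟨w, k1, k2, k3⟩ := ih h
    refine ⟨e :: w, ?_, ⟨(y.1.1, entries y.1.2), h4, h5, h6, by rw [pathEnd_cons]; exact k2⟩, ?_⟩
    · intro e' he'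
      rcases List.mem_cons.1 he' with rfl | he'
      exacts [⟨h1, h2⟩, k1 e' he']
    · intro z hz
      rcases List.mem_cons.1 hz with rfl | hz
      · exact ⟨e, by simp, h3⟩
      · obtain ⟨e', he', h⟩ := k3 z hz
        exact ⟨e', by simp [he'], h⟩

/-- The pair of paths `p` witnesses acceptance of `g`. -/
def AcceptWitness (g : Gen σ) (p : List (CodedConfig σ) × List (CodedConfig σ)) : Prop :=
  -- The list `[]` codes zero counters, because missing entries read `0`. The flag of the start is
  -- never inspected.
  IsPath (CodedStep false g) ((g.1, []), 0) p.1 ∧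
  IsPath (CodedStep true g) (pathEnd ((g.1, []), 0) p.1) p.2 ∧
  (pathEnd ((g.1, []), 0) p.1).1.1 = (pathEnd (pathEnd ((g.1, []), 0) p.1) p.2).1.1 ∧
  (∀ i < g.2.1, entries (pathEnd ((g.1, []), 0) p.1).1.2 i ≤
    entries (pathEnd (pathEnd ((g.1, []), 0) p.1) p.2).1.2 i) ∧
  ∀ f < 3, ∃ x ∈ p.2, x.2 = f

theorem accepts_iff_witness (g : Gen σ) : g.Accepts ↔ ∃ p, AcceptWitness g p := by
  constructor
  · rintro ⟨w0, c, hw0, hrun0, w, c', hw, hrun, hcc, hle, hflag⟩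
    obtain ⟨p1, h1, h2, h3, -⟩ := exists_codedPath (b := false) (fun e he => ⟨hw0 e he, by simp⟩)
      hrun0 [] 0 (by simp [entries])
    have hend : pathEnd ((g.1, []), 0) p1 = ((c.1, (pathEnd ((g.1, []), 0) p1).1.2),
        (pathEnd ((g.1, []), 0) p1).2) := by rw [← h2]
    obtain ⟨p2, k1, k2, k3, k4⟩ := exists_codedPath (b := true) (fun e he => ⟨(hw e he).1, fun _ => (hw e he).2⟩)
      hrun _ (pathEnd ((g.1, []), 0) p1).2 h3
    rw [← hend] at k1 k2 k3
    refine ⟨(p1, p2), h1, k1, h2.trans (hcc.trans k2.symm), fun i hi => ?_, fun f hf => ?_⟩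
    · rw [h3 i hi, k3 i hi]; exact hle i hi
    · obtain ⟨e, he, hef⟩ := hflag f hf
      obtain ⟨x, hx, h⟩ := k4 e he
      exact ⟨x, hx, h.trans hef⟩
  · rintro ⟨⟨p1, p2⟩, h1, h2, h3, h4, h5⟩
    obtain ⟨w0, k1, k2, -⟩ := exists_runs_of_codedPath h1
    obtain ⟨w, l1, l2, l3⟩ := exists_runs_of_codedPath h2
    refine ⟨w0, _, fun e he => (k1 e he).1, k2, w, _, fun e he => ⟨(l1 e he).1, (l1 e he).2 rfl⟩,
      l2, h3, h4, fun f hf => ?_⟩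
    obtain ⟨x, hx, h⟩ := h5 f hf
    obtain ⟨e, he, hef⟩ := l3 x hx
    exact ⟨e, he, hef.trans h⟩

/-- A list of edges together with tables for the ranking functions that led to it. -/
abbrev RankState (σ : Type) : Type := List (NodeEdge σ) × List ℕ × List (List ℕ)

/-- One ranking step. -/
def RankStep (D : ℕ) (x x' : RankState σ) : Prop :=
  ∀ e ∈ x.1, (∀ i < D, (x'.2.2.getD e.1 []).getD i 0 = (x'.2.2.getD e.2.2 []).getD i 0) ∧
    -- Decrements stand on the right, which keeps the inequality in `ℕ`.
    (x'.2.1.getD e.2.2 0 + ((List.range D).map fun i => (x'.2.2.getD e.1 []).getD i 0 * e.2.1.pos i).sum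
      < x'.2.1.getD e.1 0 + ((List.range D).map fun i => (x'.2.2.getD e.1 []).getD i 0 * e.2.1.neg i).sum ∨
    x'.2.1.getD e.2.2 0 + ((List.range D).map fun i => (x'.2.2.getD e.1 []).getD i 0 * e.2.1.pos i).sum
      ≤ x'.2.1.getD e.1 0 + ((List.range D).map fun i => (x'.2.2.getD e.1 []).getD i 0 * e.2.1.neg i).sum ∧
      e ∈ x'.1)

/-- The table `χ` assigns to every component a flag that it misses. -/
def RankBase (E : List (NodeEdge σ)) (χ : List ℕ) : Prop :=
  ∀ e ∈ E, χ.getD e.1 0 = χ.getD e.2.2 0 ∧ χ.getD e.1 0 < 3 ∧ e.2.1.flag ≠ χ.getD e.1 0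

theorem rank_sum (D : ℕ) (l : ℕ → ℕ) (e : NodeEdge σ) (a b : ℕ) :
    ((a : ℤ) + ∑ i : Fin D, (l i : ℤ) * nodeDelta D e i < b ↔
      a + ((List.range D).map fun i => l i * e.2.1.pos i).sum <
        b + ((List.range D).map fun i => l i * e.2.1.neg i).sum) ∧
    ((a : ℤ) + ∑ i : Fin D, (l i : ℤ) * nodeDelta D e i ≤ b ↔
      a + ((List.range D).map fun i => l i * e.2.1.pos i).sum ≤
        b + ((List.range D).map fun i => l i * e.2.1.neg i).sum) := by
  have h : ∑ i : Fin D, (l i : ℤ) * nodeDelta D e i =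
      (((List.range D).map fun i => l i * e.2.1.pos i).sum : ℕ) -
      (((List.range D).map fun i => l i * e.2.1.neg i).sum : ℕ) := by
    refine (Fin.sum_univ_eq_sum_range (fun i => (l i : ℤ) * e.2.1.delta i) D).trans ?_
    have : ∀ f : ℕ → ℕ, ((List.range D).map f).sum = ∑ i ∈ Finset.range D, f i := fun f => rfl
    rw [this, this]
    push_cast
    rw [← Finset.sum_sub_distrib]
    exact Finset.sum_congr rfl fun i _ => by rw [GEdge.delta]; ring
  rw [h]
  omega

theorem getD_map_range {β : Type*} (f : ℕ → β) (d : β) {n N : ℕ} (h : n < N) :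
    ((List.range N).map f).getD n d = f n := by
  simp [List.getD_eq_getElem?_getD, h]

theorem exists_node_bound (E : List (NodeEdge σ)) : ∃ N, ∀ e ∈ E, e.1 < N ∧ e.2.2 < N := by
  induction E with
  | nil => exact ⟨0, by simp⟩
  | cons a E ih =>
    obtain ⟨N, hN⟩ := ih
    refine ⟨N + a.1 + a.2.2 + 1, fun e he => ?_⟩
    rcases List.mem_cons.1 he with rfl | he
    · omega
    · have := hN e he; omega

/-- Only the finitely many nodes on edges of `E` matter, so ranking functions can be replaced by
tables, and a derivation by a path. -/
theorem rankedNodes_iff (D : ℕ) (E : List (NodeEdge σ)) : RankedNodes D E ↔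
    ∃ (p : List (RankState σ)) (χ : List ℕ), IsPath (RankStep D) (E, [], []) p ∧
      RankBase (pathEnd (E, [], []) p).1 χ := by
  constructor
  · intro h
    -- A step reads the tables of the next state only, so the first ones are arbitrary, as the
    -- induction requires.
    have key : ∀ (φ : List ℕ) (l : List (List ℕ)), ∃ (p : List (RankState σ)) (χ : List ℕ),
        IsPath (RankStep D) (E, φ, l) p ∧ RankBase (pathEnd (E, φ, l) p).1 χ := by
      induction h with
      | base E χ h =>
        intro φ l
        obtain ⟨N, hN⟩ := exists_node_bound E
        refine ⟨[], (List.range N).map χ, isPath_nil, fun e he => ?_⟩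
        rw [pathEnd_nil] at he
        rw [getD_map_range _ _ (hN e he).1, getD_map_range _ _ (hN e he).2]
        exact h e he
      | step E E' φ l h h' ih =>
        intro φ0 l0
        obtain ⟨N, hN⟩ := exists_node_bound E
        obtain ⟨p, χ, h1, h2⟩ := ih ((List.range N).map φ)
          ((List.range N).map fun n => (List.range D).map fun i => if hi : i < D then l n ⟨i, hi⟩ else 0)
        refine ⟨_ :: p, χ, isPath_cons.2 ⟨?_, h1⟩, by rw [pathEnd_cons]; exact h2⟩
        intro e he
        obtain ⟨h3, h4⟩ := h e he
        simp only
        rw [getD_map_range _ _ (hN e he).1, getD_map_range _ _ (hN e he).2,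
          getD_map_range _ _ (hN e he).1, getD_map_range _ _ (hN e he).2]
        refine ⟨fun i hi => ?_, ?_⟩
        · rw [getD_map_range _ _ hi, getD_map_range _ _ hi, dif_pos hi, dif_pos hi, h3]
        · rw [← (rank_sum D _ e _ _).1, ← (rank_sum D _ e _ _).2]
          have : ∀ i : Fin D, ((List.range D).map fun i => if hi : i < D then l e.1 ⟨i, hi⟩ else 0).getD i 0
              = l e.1 i := fun i => by rw [getD_map_range _ _ i.2, dif_pos i.2]
          simp only [this]
          exact h4
    exact key [] []
  · rintro ⟨p, χ, h1, h2⟩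
    generalize ([] : List ℕ) = φ at h1 h2
    generalize ([] : List (List ℕ)) = l at h1 h2
    induction p generalizing E φ l with
    | nil =>
      rw [pathEnd_nil] at h2
      exact Ranked.base _ (fun n => χ.getD n 0) h2
    | cons x p ih =>
      obtain ⟨h3, h4⟩ := isPath_cons.1 h1
      rw [pathEnd_cons] at h2
      refine Ranked.step E x.1 (fun n => x.2.1.getD n 0) (fun n i => (x.2.2.getD n []).getD i 0) ?_
        (ih x.1 x.2.1 x.2.2 h4 h2)
      intro e he
      obtain ⟨h5, h6⟩ := h3 e he
      refine ⟨fun i => h5 i i.2, ?_⟩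
      rw [← (rank_sum D _ e _ _).1, ← (rank_sum D _ e _ _).2] at h6
      exact h6

variable [Primcodable σ]

/-- `p` certifies that `g` does not accept. -/
def RejectWitness (g : Gen σ)
    (p : List (σ × List ℕ) × List (NodeEdge σ) × List (RankState σ) × List ℕ) : Prop :=
  Closed g p.1 p.2.1 ∧ IsPath (RankStep g.2.1) (p.2.1, [], []) p.2.2.1 ∧
    RankBase (pathEnd (p.2.1, [], []) p.2.2.1).1 p.2.2.2

theorem not_accepts_iff_witness (g : Gen σ) : ¬ g.Accepts ↔ ∃ p, RejectWitness g p := by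
  constructor
  · intro h
    obtain ⟨nodes, EG, h1, h2⟩ := exists_closed_of_not_accepts h
    obtain ⟨p, χ, h3, h4⟩ := (rankedNodes_iff _ _).1 h2
    exact ⟨(nodes, EG, p, χ), h1, h3, h4⟩
  · rintro ⟨⟨nodes, EG, p, χ⟩, h1, h2, h3⟩
    exact not_accepts_of_closed h1 ((rankedNodes_iff _ _).2 ⟨p, χ, h2, h3⟩)

variable {α : Type*} [Primcodable α]

@[fun_prop] theorem primrecPred_fires {D : α → ℕ} {e : α → GEdge σ} {l l' : α → List ℕ}
    (hD : Primrec D) (he : Primrec e) (hl : Primrec l) (hl' : Primrec l') :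
    PrimrecPred fun a => (e a).Fires (D a) (entries (l a)) (entries (l' a)) := by
  unfold GEdge.Fires entries GEdge.rst GEdge.pos GEdge.neg
  fun_prop

@[fun_prop] theorem primrecPred_codedStep {b : Bool} {g : α → Gen σ} {x x' : α → CodedConfig σ}
    (hg : Primrec g) (hx : Primrec x) (hx' : Primrec x') :
    PrimrecPred fun a => CodedStep b (g a) (x a) (x' a) := by
  unfold CodedStep GEdge.rst GEdge.flag GEdge.src GEdge.tgt
  fun_prop

theorem primrecPred_acceptWitness :
    PrimrecPred fun q : Gen σ × (List (CodedConfig σ) × List (CodedConfig σ)) =>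
      AcceptWitness q.1 q.2 := by
  unfold AcceptWitness entries
  fun_prop

theorem primrecPred_rejectWitness : PrimrecPred fun q : Gen σ ×
    (List (σ × List ℕ) × List (NodeEdge σ) × List (RankState σ) × List ℕ) =>
      RejectWitness q.1 q.2 := by
  unfold RejectWitness RankBase RankStep Closed Enabled Covers entries nodeNum GEdge.rst GEdge.flag
    GEdge.src GEdge.tgt GEdge.pos GEdge.neg
  fun_prop

/-- Acceptance and its negation both have primitive recursive witnesses, so Post's theorem applies.
-/
theorem exists_computable_accepts :
    ∃ f : Gen σ → Bool, Computable f ∧ ∀ g, f g = true ↔ g.Accepts := by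
  have h : ComputablePred fun g : Gen σ => g.Accepts := by
    rw [ComputablePred.computable_iff_re_compl_re']
    exact ⟨(rePred_exists primrecPred_acceptWitness).of_eq fun g => (accepts_iff_witness g).symm,
      (rePred_exists primrecPred_rejectWitness).of_eq fun g => (not_accepts_iff_witness g).symm⟩
  obtain ⟨f, hf, hfg⟩ := ComputablePred.computable_iff.1 h
  exact ⟨f, hf, fun g => by rw [show g.Accepts = (f g = true) from congrFun hfg g]⟩

end Decide

/-! ## Infinite concatenations -/

section Concat

variable {α : Type}

theorem range_flatMap_succ (u : ℕ → List α) (n : ℕ) :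
    (List.range (n + 1)).flatMap u = (List.range n).flatMap u ++ u n := by
  rw [List.range_succ, List.flatMap_append]; simp

theorem range_flatMap_prefix (u : ℕ → List α) {m n : ℕ} (h : m ≤ n) :
    (List.range m).flatMap u <+: (List.range n).flatMap u := by
  induction n, h using Nat.le_induction with
  | base => exact List.prefix_rfl
  | succ n _ ih => exact ih.trans (by rw [range_flatMap_succ]; exact List.prefix_append _ _)

theorem eq_map_range_iff {l : List α} {w : ℕ → α} :
    l = (List.range l.length).map w ↔ ∀ k (h : k < l.length), l[k] = w k := by
  constructor
  · intro h k hk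
    have := List.getElem_map w (l := List.range l.length) (i := k) (h := by simpa using hk)
    rw [List.getElem_range] at this
    rw [← this]
    congr 1
  · intro h
    refine List.ext_getElem (by simp) fun k h1 h2 => ?_
    rw [h k h1]; simp

theorem eq_map_range_of_prefix {l l' : List α} {w : ℕ → α} (h : l <+: l')
    (h' : l' = (List.range l'.length).map w) : l = (List.range l.length).map w := by
  rw [eq_map_range_iff] at h' ⊢
  obtain ⟨t, rfl⟩ := h
  intro k hk
  rw [← h' k (by simp; omega), List.getElem_append_left hk]

theorem exists_infiniteConcat (u : ℕ → List α)
    (h : ∀ N, ∃ n, N ≤ ((List.range n).flatMap u).length) : ∃ w, IsInfiniteConcat u w := by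
  choose f hf using fun k => h (k + 1)
  refine ⟨fun k => ((List.range (f k)).flatMap u)[k]'(hf k), fun n => ?_, h⟩
  rw [eq_map_range_iff]
  intro k hk
  rcases le_total n (f k) with h | h
  · exact (range_flatMap_prefix u h).getElem hk
  · exact ((range_flatMap_prefix u h).getElem (hf k)).symm

theorem IsInfiniteConcat.eq_of_common {u v : ℕ → List α} {w w' : ℕ → α}
    (hu : IsInfiniteConcat u w) (hv : IsInfiniteConcat v w')
    (h : ∀ N, ∃ l : List α, N ≤ l.length ∧ (∃ n, l <+: (List.range n).flatMap u) ∧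
      ∃ n, l <+: (List.range n).flatMap v) : w = w' := by
  funext k
  obtain ⟨l, hl, ⟨n, hn⟩, n', hn'⟩ := h (k + 1)
  have h1 := eq_map_range_iff.1 (eq_map_range_of_prefix hn (hu.1 n)) k hl
  have h2 := eq_map_range_iff.1 (eq_map_range_of_prefix hn' (hv.1 n')) k hl
  rw [← h1, h2]

end Concat

/-! ### Finite labelled runs and their concatenation -/

section SPath

variable {A : Type} {S : BuchiTS A}

/-- A finite run, given by the list of the sources and the labels of its steps. -/
def SPath (S : BuchiTS A) : S.State → List (S.State × List A) → S.State → Prop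
  | c, [], c' => c = c'
  | c, x :: l, c' => x.1 = c ∧ ∃ d, S.step c x.2 d ∧ SPath S d l c'

theorem spath_append {c c' : S.State} {l₁ l₂ : List (S.State × List A)} :
    SPath S c (l₁ ++ l₂) c' ↔ ∃ d, SPath S c l₁ d ∧ SPath S d l₂ c' := by
  induction l₁ generalizing c with
  | nil => simp [SPath]
  | cons x l ih =>
    simp only [List.cons_append, SPath, ih]
    constructor
    · rintro ⟨h1, d, h2, e, h3, h4⟩; exact ⟨e, ⟨h1, d, h2, h3⟩, h4⟩
    · rintro ⟨e, ⟨h1, d, h2, h3⟩, h4⟩; exact ⟨h1, d, h2, e, h3, h4⟩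

theorem SPath.step {c c' : S.State} {l : List (S.State × List A)} (h : SPath S c l c') (i : ℕ)
    (hi : i + 1 < l.length) : S.step l[i].1 l[i].2 l[i + 1].1 := by
  induction l generalizing c i with
  | nil => simp at hi
  | cons x l ih =>
    obtain ⟨rfl, d, h1, h2⟩ := h
    cases i with
    | zero =>
      cases l with
      | nil => simp at hi
      | cons y l => obtain ⟨rfl, -⟩ := h2; exact h1
    | succ i => exact ih h2 i (by simpa using hi)

/-- An infinite sequence of finite runs, each of which visits a final state, is an accepting run. -/
theorem mem_language_of_segments {d : ℕ → S.State} {l : ℕ → List (S.State × List A)} {w : ℕ → A}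
    (h0 : d 0 = S.start) (hl : ∀ n, SPath S (d n) (l n) (d (n + 1)))
    (hf : ∀ n, ∃ x ∈ l n, x.1 ∈ S.final)
    (hw : IsInfiniteConcat (fun n => (l n).flatMap Prod.snd) w) : w ∈ S.language := by
  have hlen : ∀ n, n ≤ ((List.range n).flatMap l).length := by
    intro n
    induction n with
    | zero => simp
    | succ n ih =>
      obtain ⟨x, hx, -⟩ := hf n
      have := List.length_pos_of_mem hx
      rw [range_flatMap_succ, List.length_append]; omega
  -- The segments are nonempty, so their infinite concatenation is the sequence of all steps of the
  -- run.
  obtain ⟨I, hI, -⟩ := exists_infiniteConcat l fun N => ⟨N, hlen N⟩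
  have hI' := fun n => eq_map_range_iff.1 (hI n)
  have hpath : ∀ n, SPath S (d 0) ((List.range n).flatMap l) (d n) := by
    intro n
    induction n with
    | zero => rfl
    | succ n ih => rw [range_flatMap_succ]; exact spath_append.2 ⟨_, ih, hl n⟩
  have hlab : ∀ n, ((List.range n).flatMap l).flatMap Prod.snd =
      (List.range n).flatMap fun n => (l n).flatMap Prod.snd := by
    intro n; rw [List.flatMap_assoc]
  refine ⟨fun i => (I i).1, fun i => (I i).2, ?_, fun i => ?_, ?_, fun n => ?_, fun N => ?_⟩
  · have h1 : 0 < ((List.range 1).flatMap l).length := hlen 1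
    beta_reduce
    rw [← hI' 1 0 h1, ← h0]
    have h2 := hpath 1
    revert h1 h2
    generalize (List.range 1).flatMap l = L
    intro h1 h2
    cases L with
    | nil => simp at h1
    | cons x L => exact h2.1
  · have h1 := hlen (i + 2)
    have := (hpath (i + 2)).step i (by omega)
    rwa [hI' (i + 2) i (by omega), hI' (i + 2) (i + 1) (by omega)] at this
  · rw [frequently_atTop]
    intro N
    obtain ⟨x, hx, hxf⟩ := hf N
    obtain ⟨k, hk, rfl⟩ := List.getElem_of_mem hx
    have h1 := hlen N
    have h2 : ((List.range N).flatMap l).length + k < ((List.range (N + 1)).flatMap l).length := by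
      rw [range_flatMap_succ, List.length_append]; omega
    refine ⟨((List.range N).flatMap l).length + k, by omega, ?_⟩
    beta_reduce
    rw [← hI' (N + 1) _ h2]
    simpa [range_flatMap_succ] using hxf
  · refine eq_map_range_of_prefix ?_ (hw.1 n)
    rw [← hlab]
    have h1 : (List.range n).map I <+: (List.range n).flatMap l := by
      rw [hI n]
      obtain ⟨k, hk⟩ := Nat.exists_eq_add_of_le (hlen n)
      rw [hk, List.range_add, List.map_append]
      exact List.prefix_append _ _
    obtain ⟨t, ht⟩ := h1
    rw [← ht, List.flatMap_append, List.flatMap_map]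
    exact List.prefix_append _ _
  · obtain ⟨n, hn⟩ := hw.2 N
    refine ⟨((List.range n).flatMap l).length, ?_⟩
    have : (List.range ((List.range n).flatMap l).length).flatMap (fun i => (I i).2) =
        ((List.range n).flatMap l).flatMap Prod.snd := by
      conv_rhs => rw [hI n]
      rw [List.flatMap_map]
    rw [this, hlab]; exact hn

end SPath

/-! ## The synchronized product of two Büchi reset VASS -/

section Product

variable {A : Type}

/-- A state together with the letters of the last label that have not been emitted yet, for both
components. -/
abbrev PState (A : Type) : Type := (ℕ × List A) × (ℕ × List A)

/-- The states of a component of the product. -/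
def bufferStates (C : VASSCode A) : List (ℕ × List A) :=
  -- A buffer is a suffix of the label of the last transition, which leaves finitely many states.
  (C.2.2.1, []) :: C.2.2.2.1.flatMap fun t =>
    (List.range (t.2.2.1.length + 1)).map fun k => (t.2.2.2, t.2.2.1.drop k)

/-- An operation, moved to the counters from `off` on. -/
def opGen (off : ℕ) (op : List (ℕ × ℕ) ⊕ ℕ) : List (ℕ × ℕ) × ℕ :=
  Sum.elim (fun l => ((List.range off).map (fun _ => (0, 0)) ++ l, 0)) (fun r => ([], off + r + 1)) op

/-- A component with empty buffer fires a transition; the other component is in state `s`. -/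
def fireEdge (mk : ℕ × List A → ℕ × List A → PState A) (off : ℕ) (F : List ℕ) (f : ℕ)
    (t : TransitionCode A) (s : ℕ × List A) : GEdge (PState A) :=
  -- The flag `3` carries no information: acceptance asks for the flags `0`, `1` and `2` only.
  (mk (t.1, []) s, opGen off t.2.1, if t.1 ∈ F then f else 3, mk (t.2.2.2, t.2.2.1) s)

/-- Both components emit a letter. -/
def popEdge (s₁ s₂ : ℕ × List A) : GEdge (PState A) :=
  ((s₁, s₂), ([], 0), 2, ((s₁.1, s₁.2.tail), (s₂.1, s₂.2.tail)))

open Classical in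
/-- The edges of the product. -/
noncomputable def productEdges (C₁ C₂ : VASSCode A) : List (GEdge (PState A)) :=
  (C₁.2.2.2.1.flatMap fun t =>
    (bufferStates C₂).map (fireEdge (fun a b => (a, b)) 0 C₁.2.2.2.2 0 t)) ++
  (C₂.2.2.2.1.flatMap fun t =>
    (bufferStates C₁).map (fireEdge (fun a b => (b, a)) C₁.2.1 C₂.2.2.2.2 1 t)) ++
  (bufferStates C₁).flatMap fun s₁ => (bufferStates C₂).flatMap fun s₂ =>
    if s₁.2 ≠ [] ∧ s₁.2.head? = s₂.2.head? then [popEdge s₁ s₂] else []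

/-- The product. -/
noncomputable def product (C₁ C₂ : VASSCode A) : Gen (PState A) :=
  (((C₁.2.2.1, []), (C₂.2.2.1, [])), C₁.2.1 + C₂.2.1, productEdges C₁ C₂)

/-! ### The product is primitive recursive -/

section

variable {α : Type*} [Primcodable α] [Primcodable A]

@[fun_prop] theorem primrec_bufferStates {C : α → VASSCode A} (hC : Primrec C) :
    Primrec fun a => bufferStates (C a) := by
  unfold bufferStates; fun_prop

@[fun_prop] theorem primrec_opGen {off : α → ℕ} {op : α → List (ℕ × ℕ) ⊕ ℕ} (hoff : Primrec off)
    (hop : Primrec op) : Primrec fun a => opGen (off a) (op a) := by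
  refine (Primrec.sumCasesOn (f := op)
    (g := fun a l => ((List.range (off a)).map (fun _ => (0, 0)) ++ l, 0))
    (h := fun a r => ([], off a + r + 1)) hop ?_ ?_).of_eq ?_
  · show Primrec fun p : α × List (ℕ × ℕ) =>
      ((List.range (off p.1)).map (fun _ => (0, 0)) ++ p.2, 0)
    fun_prop
  · show Primrec fun p : α × ℕ => (([] : List (ℕ × ℕ)), off p.1 + p.2 + 1)
    fun_prop
  · intro a; cases h : op a <;> simp [opGen]

@[fun_prop] theorem primrec_head? {f : α → List A} (hf : Primrec f) :
    Primrec fun a => (f a).head? := Primrec.list_head?.comp hf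

theorem primrec_product : Primrec fun p : VASSCode A × VASSCode A => product p.1 p.2 := by
  unfold product productEdges fireEdge popEdge
  fun_prop

end

/-! ### From accepting runs of the product to words in the intersection -/

/-- The counters from `off` to `off + d - 1`. -/
def block (off d : ℕ) (m : ℕ → ℕ) : Fin d → ℕ := fun i => m (off + i)

theorem getD_shift (off k : ℕ) (l : List (ℕ × ℕ)) :
    ((List.range off).map (fun _ => (0, 0)) ++ l).getD k (0, 0) =
      if k < off then (0, 0) else l.getD (k - off) (0, 0) := by
  split_ifs with h
  · rw [List.getD_append _ _ _ _ (by simpa using h)]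
    simp [List.getD_eq_getElem?_getD, h]
  · rw [List.getD_append_right _ _ _ _ (by simpa using h)]
    simp

theorem fires_opGen {σ : Type} {d off D : ℕ} (hD : off + d ≤ D) (op : (Fin d → ℤ) ⊕ Fin d)
    (e : GEdge σ) (he : e.2.1 = opGen off (opCode op)) (m m' : ℕ → ℕ) :
    e.Fires D m m' ↔ Fires op (block off d m) (block off d m') ∧
      ∀ k < D, (k < off ∨ off + d ≤ k) → m' k = m k := by
  cases op with
  | inl δ =>
    have hr : e.rst = 0 := by rw [GEdge.rst, he]; rfl
    have hv : ∀ k, e.2.1.1.getD k (0, 0) = if k < off then (0, 0) else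
        (List.ofFn fun i => ((δ i).toNat, (-δ i).toNat)).getD (k - off) (0, 0) := by
      intro k; rw [he]; exact getD_shift _ _ _
    have hin : ∀ i : Fin d, e.2.1.1.getD (off + i) (0, 0) = ((δ i).toNat, (-δ i).toNat) := by
      intro i
      rw [hv, if_neg (by omega)]
      simp [List.getD_eq_getElem?_getD]
    have hout : ∀ k, (k < off ∨ off + d ≤ k) → e.2.1.1.getD k (0, 0) = (0, 0) := by
      rintro k (h | h)
      · rw [hv, if_pos h]
      · rw [hv, if_neg (by omega), List.getD_eq_default _ _ (by simp; omega)]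
    simp only [GEdge.Fires, hr, GEdge.pos, GEdge.neg, Fires, block]
    constructor
    · intro h
      refine ⟨fun i => ?_, fun k hk hk' => ?_⟩
      · have := (h (off + i) (by omega)).2 (by omega)
        rw [hin i] at this
        simp only at this
        omega
      · have := (h k hk).2 (by omega)
        rw [hout k hk'] at this
        simpa using this
    · rintro ⟨h1, h2⟩ k hk
      refine ⟨fun h => by omega, fun _ => ?_⟩
      by_cases hk' : k < off ∨ off + d ≤ k
      · rw [hout k hk', h2 k hk hk']
      · have h3 := h1 ⟨k - off, by omega⟩
        have h4 := hin ⟨k - off, by omega⟩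
        simp only [show off + (k - off) = k by omega] at h3 h4
        rw [h4]
        simp only
        omega
  | inr r =>
    have hr : e.rst = off + r + 1 := by rw [GEdge.rst, he]; rfl
    have hv : ∀ k, e.2.1.1.getD k (0, 0) = (0, 0) := by
      intro k; rw [he]; simp [opGen, opCode]
    simp only [GEdge.Fires, hr, GEdge.pos, GEdge.neg, Fires, hv]
    constructor
    · intro h
      refine ⟨?_, fun k hk hk' => ?_⟩
      · funext i
        have := h (off + i) (by omega)
        by_cases hi : i = r
        · subst hi
          rw [Function.update_self]
          exact this.1 rfl
        · rw [Function.update_of_ne hi]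
          have h2 : (r : ℕ) ≠ i := fun h => hi (Fin.ext h.symm)
          exact this.2 (by omega)
      · simpa using (h k hk).2 (by omega)
    · rintro ⟨h1, h2⟩ k hk
      by_cases hk' : k < off ∨ off + d ≤ k
      · exact ⟨fun h => by omega, fun _ => by simp [h2 k hk hk']⟩
      · have h3 := congrFun h1 ⟨k - off, by omega⟩
        simp only [block, show off + (k - off) = k by omega, Function.update_apply, Fin.ext_iff] at h3
        constructor
        · intro h
          rw [if_pos (by omega)] at h3; exact h3
        · intro h
          rw [if_neg (by omega)] at h3; simpa using h3

/-- The letter that is emitted along an edge. -/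
def emit (e : GEdge (PState A)) : List A := if e.flag = 2 then e.src.1.2.head?.toList else []

/-- Seen through the projection `pr` of states and through a block of counters, every edge in `E`
is a transition of `V`, or does nothing, or emits a letter. -/
def IsView (V : BuchiResetVASS A) (D off f : ℕ) (pr : PState A → ℕ × List A)
    (E : List (GEdge (PState A))) : Prop :=
  ∀ e ∈ E,
    (emit e = [] ∧ ∃ t ∈ V.transitions, pr e.src = (t.src.1, []) ∧ pr e.tgt = (t.tgt.1, t.label) ∧
      (∀ m m', e.Fires D m m' → Fires t.op (block off V.dim m) (block off V.dim m')) ∧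
      (e.flag = f → t.src ∈ V.finals)) ∨
    (e.flag ≠ f ∧ pr e.src = ((pr e.tgt).1, emit e ++ (pr e.tgt).2) ∧
      ∀ m m', e.Fires D m m' → block off V.dim m' = block off V.dim m)

/-- Dropping the edges that are not transitions of `V` leaves a run of `V`. The equation of words is
the balance of the buffer: what was in it and what was read equals what was emitted and what
remains. -/
theorem IsView.exists_spath {V : BuchiResetVASS A} {D off f : ℕ} {pr : PState A → ℕ × List A}
    {E : List (GEdge (PState A))} (h : IsView V D off f pr E) {w : List (GEdge (PState A))}
    (hw : ∀ e ∈ w, e ∈ E) {c c' : PState A × (ℕ → ℕ)} (hrun : Runs D c w c')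
    {q : Fin V.numStates} {v : List A} (hc : pr c.1 = (q.1, v)) :
    ∃ (q' : Fin V.numStates) (v' : List A) (l : List (V.Config × List A)),
      pr c'.1 = (q'.1, v') ∧
      SPath V.toTS (q, block off V.dim c.2) l (q', block off V.dim c'.2) ∧
      v ++ l.flatMap Prod.snd = w.flatMap emit ++ v' ∧
      ((∃ e ∈ w, e.flag = f) → ∃ x ∈ l, x.1 ∈ V.toTS.final) := by
  induction w generalizing c q v with
  | nil => cases hrun; exact ⟨q, v, [], hc, rfl, by simp, by simp⟩
  | cons e w ih =>
    obtain ⟨d, h1, h2, h3, h4⟩ := hrun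
    rcases h e (hw e (by simp)) with ⟨k0, t, ht, k1, k2, k3, k4⟩ | ⟨k1, k2, k3⟩
    · rw [h1, hc, Prod.mk.injEq] at k1
      obtain ⟨hq, rfl⟩ := k1
      obtain rfl : q = t.src := Fin.ext hq
      obtain ⟨q', v', l, l1, l2, l3, l4⟩ := ih (fun e he => hw e (by simp [he])) h4
        (q := t.tgt) (v := t.label) (by rw [← h2]; exact k2)
      refine ⟨q', v', ((t.src, block off V.dim c.2), t.label) :: l, l1, ⟨rfl, _,
        ⟨t, ht, rfl, rfl, rfl, k3 _ _ h3⟩, l2⟩, ?_, ?_⟩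
      · simp only [List.flatMap_cons, List.nil_append, k0]; exact l3
      · rintro ⟨e', he', hf⟩
        rcases List.mem_cons.1 he' with rfl | he'
        · exact ⟨_, List.mem_cons_self, k4 hf⟩
        · obtain ⟨x, hx, h⟩ := l4 ⟨e', he', hf⟩
          exact ⟨x, List.mem_cons_of_mem _ hx, h⟩
    · rw [h1, hc, h2, Prod.mk.injEq] at k2
      obtain ⟨hq, rfl⟩ := k2
      obtain ⟨q', v', l, l1, l2, l3, l4⟩ := ih (fun e he => hw e (by simp [he])) h4
        (q := q) (v := (pr d.1).2) (Prod.ext hq.symm rfl)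
      rw [k3 _ _ h3] at l2
      refine ⟨q', v', l, l1, l2, ?_, ?_⟩
      · rw [List.append_assoc, l3, List.flatMap_cons, List.append_assoc]
      · rintro ⟨e', he', hf⟩
        rcases List.mem_cons.1 he' with rfl | he'
        · exact absurd hf k1
        · exact l4 ⟨e', he', hf⟩

theorem mem_productEdges {C₁ C₂ : VASSCode A} {e : GEdge (PState A)} :
    e ∈ productEdges C₁ C₂ ↔
      (∃ t ∈ C₁.2.2.2.1, ∃ s ∈ bufferStates C₂,
        fireEdge (fun a b => (a, b)) 0 C₁.2.2.2.2 0 t s = e) ∨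
      (∃ t ∈ C₂.2.2.2.1, ∃ s ∈ bufferStates C₁,
        fireEdge (fun a b => (b, a)) C₁.2.1 C₂.2.2.2.2 1 t s = e) ∨
      ∃ s₁ ∈ bufferStates C₁, ∃ s₂ ∈ bufferStates C₂,
        (s₁.2 ≠ [] ∧ s₁.2.head? = s₂.2.head?) ∧ popEdge s₁ s₂ = e := by
  simp only [productEdges, List.mem_append, List.mem_flatMap, List.mem_map, or_assoc]
  refine or_congr Iff.rfl (or_congr Iff.rfl ?_)
  refine exists_congr fun s₁ => and_congr_right fun _ => exists_congr fun s₂ => and_congr_right fun _ => ?_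
  split_ifs with h
  · simp [h, eq_comm]
  · simp [h]

theorem flag_fireEdge {mk : ℕ × List A → ℕ × List A → PState A} {off f : ℕ} {F : List ℕ}
    {t : TransitionCode A} {s : ℕ × List A} {k : ℕ} (hf : f ≠ k) (hk : k ≠ 3) :
    (fireEdge mk off F f t s).flag ≠ k := by
  change (if t.1 ∈ F then f else 3) ≠ k
  split_ifs
  exacts [hf, hk.symm]

theorem emit_fireEdge {mk : ℕ × List A → ℕ × List A → PState A} {off f : ℕ} {F : List ℕ}
    {t : TransitionCode A} {s : ℕ × List A} (hf : f ≠ 2) : emit (fireEdge mk off F f t s) = [] :=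
  if_neg (flag_fireEdge hf (by simp))

theorem mem_code_finals {V : BuchiResetVASS A} {q : Fin V.numStates} :
    q.1 ∈ V.code.2.2.2.2 ↔ q ∈ V.finals := by
  simp only [BuchiResetVASS.code, List.mem_map]
  constructor
  · rintro ⟨a, ha, h⟩; rwa [← Fin.ext h]
  · intro h; exact ⟨q, h, rfl⟩

theorem head_append_tail {v : List A} (h : v ≠ []) : v.head?.toList ++ v.tail = v := by
  cases v with
  | nil => exact absurd rfl h
  | cons a v => rfl

theorem block_eq_of {d off D : ℕ} (hD : off + d ≤ D) {m m' : ℕ → ℕ}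
    (h : ∀ k < D, off ≤ k → k < off + d → m' k = m k) : block off d m' = block off d m := by
  funext i
  exact h _ (by omega) (by omega) (by omega)

theorem fires_popEdge {D : ℕ} {s₁ s₂ : ℕ × List A} {m m' : ℕ → ℕ} :
    (popEdge s₁ s₂).Fires D m m' ↔ ∀ k < D, m' k = m k := by
  simp [GEdge.Fires, popEdge, GEdge.pos, GEdge.neg, GEdge.rst]

variable (V₁ V₂ : BuchiResetVASS A)

theorem isView_left : IsView V₁ (V₁.dim + V₂.dim) 0 0 Prod.fst (productEdges V₁.code V₂.code) := by
  intro e he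
  rcases mem_productEdges.1 he with ⟨t, ht, s, -, rfl⟩ | ⟨t, ht, s, -, rfl⟩ | ⟨s₁, -, s₂, -, h, rfl⟩
  · obtain ⟨t, ht', rfl⟩ := List.mem_map.1 ht
    refine Or.inl ⟨emit_fireEdge (by simp), t, ht', rfl, rfl, fun m m' h => ?_, fun h => ?_⟩
    · exact ((fires_opGen (by omega) t.op _ rfl m m').1 h).1
    · by_contra hc
      change (if t.src.1 ∈ V₁.code.2.2.2.2 then 0 else 3) = 0 at h
      rw [if_neg fun h => hc (mem_code_finals.1 h)] at h
      omega
  · obtain ⟨t, ht', rfl⟩ := List.mem_map.1 ht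
    refine Or.inr ⟨flag_fireEdge (by simp) (by simp), by rw [emit_fireEdge (by simp)]; rfl,
      fun m m' h => ?_⟩
    have := ((fires_opGen (D := V₁.dim + V₂.dim) (off := V₁.dim) le_rfl t.op _ rfl m m').1 h).2
    exact block_eq_of (by omega) fun k hk _ h2 => this k hk (Or.inl (by omega))
  · refine Or.inr ⟨by simp [popEdge], ?_, fun m m' hf => ?_⟩
    · simp only [emit, popEdge, if_true]
      rw [head_append_tail h.1]
    · exact block_eq_of (by omega) fun k hk _ _ => fires_popEdge.1 hf k hk

theorem isView_right :
    IsView V₂ (V₁.dim + V₂.dim) V₁.dim 1 Prod.snd (productEdges V₁.code V₂.code) := by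
  intro e he
  rcases mem_productEdges.1 he with ⟨t, ht, s, -, rfl⟩ | ⟨t, ht, s, -, rfl⟩ | ⟨s₁, -, s₂, -, h, rfl⟩
  · obtain ⟨t, ht', rfl⟩ := List.mem_map.1 ht
    refine Or.inr ⟨flag_fireEdge (by simp) (by simp), by rw [emit_fireEdge (by simp)]; rfl,
      fun m m' h => ?_⟩
    have := ((fires_opGen (D := V₁.dim + V₂.dim) (off := 0) (by omega) t.op _ rfl m m').1 h).2
    exact block_eq_of (by omega) fun k hk h1 h2 => this k hk (Or.inr (by omega))
  · obtain ⟨t, ht', rfl⟩ := List.mem_map.1 ht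
    refine Or.inl ⟨emit_fireEdge (by simp), t, ht', rfl, rfl, fun m m' h => ?_, fun h => ?_⟩
    · exact ((fires_opGen (D := V₁.dim + V₂.dim) (off := V₁.dim) le_rfl t.op _ rfl m m').1 h).1
    · by_contra hc
      change (if t.src.1 ∈ V₂.code.2.2.2.2 then 1 else 3) = 1 at h
      rw [if_neg fun h => hc (mem_code_finals.1 h)] at h
      omega
  · refine Or.inr ⟨by simp [popEdge], ?_, fun m m' hf => ?_⟩
    · simp only [emit, popEdge, if_true]
      -- The emitted letter is taken from the first buffer; the guard of the edge says that it is
      -- also the head of the second.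
      rw [h.2, head_append_tail]
      intro h0
      have := h.2
      rw [h0, List.head?_nil, List.head?_eq_none_iff] at this
      exact h.1 this
    · exact block_eq_of (by omega) fun k hk _ _ => fires_popEdge.1 hf k hk

/-- The configurations of an iterated self-covering run. -/
theorem SelfCovers.exists_iterate {σ : Type} {D : ℕ} {c c' : σ × (ℕ → ℕ)} {w : List (GEdge σ)}
    (h : Runs D c w c') (hs : c.1 = c'.1) (hle : ∀ i < D, c.2 i ≤ c'.2 i) :
    ∃ d : ℕ → σ × (ℕ → ℕ), d 0 = c ∧ ∀ n, (d n).1 = c.1 ∧ Runs D (d n) w (d (n + 1)) := by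
  have : ∀ x : {x : σ × (ℕ → ℕ) // c.1 = x.1 ∧ ∀ i < D, c.2 i ≤ x.2 i},
      ∃ y : {x : σ × (ℕ → ℕ) // c.1 = x.1 ∧ ∀ i < D, c.2 i ≤ x.2 i}, Runs D x.1 w y.1 := by
    rintro ⟨x, h1, h2⟩
    obtain ⟨y, k1, k2, k3⟩ := h.mono h1 h2
    exact ⟨⟨y, hs.trans k2, fun i hi => (hle i hi).trans (k3 i hi)⟩, k1⟩
  choose f hf using this
  refine ⟨fun n => (f^[n] ⟨c, rfl, fun _ _ => le_rfl⟩).1, rfl,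
    fun n => ⟨(f^[n] ⟨c, rfl, fun _ _ => le_rfl⟩).2.1.symm, ?_⟩⟩
  simp only [Function.iterate_succ_apply']
  exact hf _

/-- Iterating the loop of an accepting run yields an accepting run of every view. -/
theorem IsView.exists_word {V : BuchiResetVASS A} {D off f : ℕ} {pr : PState A → ℕ × List A}
    {E : List (GEdge (PState A))} (h : IsView V D off f pr E) {w₀ w : List (GEdge (PState A))}
    (hw₀ : ∀ e ∈ w₀, e ∈ E) (hw : ∀ e ∈ w, e ∈ E) {c₀ : PState A × (ℕ → ℕ)}
    {d : ℕ → PState A × (ℕ → ℕ)} (hrun₀ : Runs D c₀ w₀ (d 0))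
    (hd : ∀ n, (d n).1 = (d 0).1 ∧ Runs D (d n) w (d (n + 1)))
    (hc₀ : pr c₀.1 = (V.start.1, [])) (hm₀ : block off V.dim c₀.2 = fun _ => 0)
    (hf : ∃ e ∈ w, e.flag = f) (hne : w.flatMap emit ≠ []) :
    ∃ (u : ℕ → List A) (x : ℕ → A), IsInfiniteConcat u x ∧ x ∈ V.language ∧
      ∀ n, w₀.flatMap emit ++ (List.range (n + 1)).flatMap (fun _ => w.flatMap emit) <+:
        (List.range (n + 1)).flatMap u := by
  obtain ⟨q, v, l₀, h1, h2, h3, -⟩ := h.exists_spath hw₀ hrun₀ hc₀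
  have hseg : ∀ n, ∃ l : List (V.Config × List A),
      SPath V.toTS (q, block off V.dim (d n).2) l (q, block off V.dim (d (n + 1)).2) ∧
      v ++ l.flatMap Prod.snd = w.flatMap emit ++ v ∧ ∃ x ∈ l, x.1 ∈ V.toTS.final := by
    intro n
    obtain ⟨q', v', l, k1, k2, k3, k4⟩ := h.exists_spath hw (hd n).2 (q := q) (v := v)
      (by rw [(hd n).1]; exact h1)
    rw [(hd (n + 1)).1, h1, Prod.mk.injEq] at k1
    obtain ⟨hq, rfl⟩ := k1
    obtain rfl := Fin.ext hq
    exact ⟨l, k2, k3, k4 hf⟩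
  choose l hl1 hl2 hl3 using hseg
  -- The initial part need not visit a final state, so it is joined with the first round of the
  -- loop.
  let L : ℕ → List (V.Config × List A) := fun n => if n = 0 then l₀ ++ l 0 else l n
  let c : ℕ → V.Config := fun n => if n = 0 then (V.start, fun _ => 0) else (q, block off V.dim (d n).2)
  have hflat : ∀ n, (List.range (n + 1)).flatMap (fun n => (L n).flatMap Prod.snd) =
      w₀.flatMap emit ++ (List.range (n + 1)).flatMap (fun _ => w.flatMap emit) ++ v := by
    intro n
    induction n with
    | zero =>
      simp only [zero_add, List.range_one, List.flatMap_cons, List.flatMap_nil, List.append_nil, L,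
        if_true, List.flatMap_append]
      rw [List.append_assoc, ← hl2 0, ← List.append_assoc, ← h3, List.nil_append]
    | succ n ih =>
      rw [range_flatMap_succ, ih, range_flatMap_succ _ (n + 1)]
      simp only [L, Nat.succ_ne_zero, if_false, List.append_assoc]
      rw [hl2]
  have hlen : ∀ n, n ≤ ((List.range n).flatMap (fun _ => w.flatMap emit)).length := by
    intro n
    induction n with
    | zero => simp
    | succ n ih =>
      have := List.length_pos_iff.2 hne
      rw [range_flatMap_succ, List.length_append]; omega
  obtain ⟨x, hx⟩ := exists_infiniteConcat (fun n => (L n).flatMap Prod.snd) (fun N => ⟨N + 1, by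
    rw [hflat]
    have := hlen (N + 1)
    simp only [List.length_append]; omega⟩)
  refine ⟨_, x, hx, ?_, fun n => ?_⟩
  · refine mem_language_of_segments (S := V.toTS) (d := c) (l := L) ?_ (fun n => ?_) (fun n => ?_) hx
    · simp [c, BuchiResetVASS.toTS]
    · by_cases hn : n = 0
      · subst hn
        simp only [c, L, if_true, zero_add, one_ne_zero, if_false]
        refine spath_append.2 ⟨_, ?_, hl1 0⟩
        rwa [hm₀] at h2
      · simp only [c, L, if_neg hn, Nat.succ_ne_zero, if_false]
        exact hl1 n
    · obtain ⟨y, hy, hyf⟩ := hl3 n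
      refine ⟨y, ?_, hyf⟩
      simp only [L]
      split_ifs with hn
      · subst hn; exact List.mem_append_right _ hy
      · exact hy
  · rw [hflat]
    exact List.prefix_append _ _

/-- The loop is repeated forever. The flags `0` and `1` give final states of the components in every
round, and the flag `2` gives a nonempty emitted word. Both component words have the emitted
prefixes in common, so they are equal. -/
theorem inter_nonempty_of_accepts (h : (product V₁.code V₂.code).Accepts) :
    (V₁.language ∩ V₂.language).Nonempty := by
  obtain ⟨w₀, c, hw₀, hrun₀, w, c', hw, hrun, hcc, hle, hflag⟩ := h
  obtain ⟨d, hd0, hd⟩ := SelfCovers.exists_iterate hrun hcc hle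
  rw [← hd0] at hrun₀
  have hd' : ∀ n, (d n).1 = (d 0).1 ∧ Runs (V₁.dim + V₂.dim) (d n) w (d (n + 1)) := fun n => by
    rw [hd0]; exact hd n
  have hne : w.flatMap emit ≠ [] := by
    obtain ⟨e, he, hef⟩ := hflag 2 (by simp)
    intro h0
    rw [List.flatMap_eq_nil_iff] at h0
    have h1 := h0 e he
    rcases mem_productEdges.1 (hw e he).1 with ⟨t, -, s, -, rfl⟩ | ⟨t, -, s, -, rfl⟩ | ⟨s₁, -, s₂, -, h, rfl⟩
    · exact absurd hef (flag_fireEdge (by simp) (by simp))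
    · exact absurd hef (flag_fireEdge (by simp) (by simp))
    · simp only [emit, popEdge, if_true] at h1
      have := head_append_tail h.1
      rw [h1] at this
      have h2 := congrArg List.length this
      have h3 := List.length_pos_iff.2 h.1
      simp at h2
      omega
  obtain ⟨u₁, x₁, h1, h2, h3⟩ := (isView_left V₁ V₂).exists_word hw₀ (fun e he => (hw e he).1)
    hrun₀ hd' rfl rfl (hflag 0 (by simp)) hne
  obtain ⟨u₂, x₂, k1, k2, k3⟩ := (isView_right V₁ V₂).exists_word hw₀ (fun e he => (hw e he).1)
    hrun₀ hd' rfl rfl (hflag 1 (by simp)) hne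
  obtain rfl : x₁ = x₂ := by
    refine h1.eq_of_common k1 fun N => ⟨_, ?_, ⟨_, h3 N⟩, ⟨_, k3 N⟩⟩
    have : ∀ n, n ≤ ((List.range n).flatMap (fun _ => w.flatMap emit)).length := by
      intro n
      induction n with
      | zero => simp
      | succ n ih =>
        have := List.length_pos_iff.2 hne
        rw [range_flatMap_succ, List.length_append]; omega
    have := this (N + 1)
    rw [List.length_append]; omega
  exact ⟨x₁, h2, k2⟩

end Product

/-! ### From words in the intersection to accepting runs of the product -/

section Product

variable {A : Type}

/-- The number of steps that the run with labels `u` needs to read `p` letters. -/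
noncomputable def stepsFor (u : ℕ → List A) (p : ℕ) : ℕ :=
  sInf {i | p ≤ ((List.range i).flatMap u).length}

theorem length_flatMap_mono (u : ℕ → List A) {i j : ℕ} (h : i ≤ j) :
    ((List.range i).flatMap u).length ≤ ((List.range j).flatMap u).length :=
  (range_flatMap_prefix u h).length_le

section

variable {u : ℕ → List A} {w : ℕ → A} (hw : IsInfiniteConcat u w)
include hw

theorem le_length_stepsFor (p : ℕ) : p ≤ ((List.range (stepsFor u p)).flatMap u).length :=
  Nat.sInf_mem (s := {i | p ≤ ((List.range i).flatMap u).length}) (hw.2 p)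

theorem lt_stepsFor {i p : ℕ} : i < stepsFor u p ↔ ((List.range i).flatMap u).length < p := by
  constructor
  · intro h
    by_contra hc
    exact Nat.notMem_of_lt_sInf h (not_lt.1 hc)
  · intro h
    by_contra hc
    have := length_flatMap_mono u (not_lt.1 hc)
    have := le_length_stepsFor hw p
    omega

theorem stepsFor_mono {p p' : ℕ} (h : p ≤ p') : stepsFor u p ≤ stepsFor u p' := by
  by_contra hc
  have h1 := (lt_stepsFor hw).1 (not_le.1 hc)
  have := le_length_stepsFor hw p'
  omega

theorem drop_stepsFor {i p : ℕ} (h : stepsFor u (p + 1) ≤ i) :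
    ((List.range i).flatMap u).drop p = w p :: ((List.range i).flatMap u).drop (p + 1) := by
  have h1 : p < ((List.range i).flatMap u).length := by
    have := length_flatMap_mono u h
    have := le_length_stepsFor hw (p + 1)
    omega
  rw [List.drop_eq_getElem_cons h1, eq_map_range_iff.1 (hw.1 i) p h1]

end

/-- The buffered state after `i` steps, when `p` letters have been emitted. -/
def bufState {V : BuchiResetVASS A} (c : ℕ → V.Config) (u : ℕ → List A) (i p : ℕ) : ℕ × List A :=
  ((c i).1.1, ((List.range i).flatMap u).drop p)

/-- An infinite run of `V` labelled with the pieces of `w`. -/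
structure IsRunOn (V : BuchiResetVASS A) (c : ℕ → V.Config) (u : ℕ → List A) (w : ℕ → A) :
    Prop where
  zero : c 0 = (V.start, fun _ => 0)
  step : ∀ i, V.Step (c i) (u i) (c (i + 1))
  final : ∃ᶠ i in atTop, (c i).1 ∈ V.finals
  concat : IsInfiniteConcat u w

namespace IsRunOn

variable {V : BuchiResetVASS A} {c : ℕ → V.Config} {u : ℕ → List A} {w : ℕ → A}

/-- The last of the `i` steps was made when at most `p` letters had been read, so all earlier labels
are emitted and the buffer is a suffix of the last one. -/
theorem bufState_mem (h : IsRunOn V c u w) {i p : ℕ} (h1 : stepsFor u p ≤ i)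
    (h2 : i ≤ stepsFor u (p + 1)) : bufState c u i p ∈ bufferStates V.code := by
  cases i with
  | zero =>
    have := le_length_stepsFor h.concat p
    have h0 : stepsFor u p = 0 := by omega
    rw [h0] at this
    simp [bufState, bufferStates, h.zero, BuchiResetVASS.code]
  | succ k =>
    have h3 := (lt_stepsFor h.concat).1 (show k < stepsFor u (p + 1) by omega)
    have h4 := length_flatMap_mono u h1
    have h5 := le_length_stepsFor h.concat p
    obtain ⟨t, ht, ht1, ht2, ht3, -⟩ := h.step k
    rw [range_flatMap_succ, List.length_append] at h4
    refine List.mem_cons_of_mem _ (List.mem_flatMap.2 ⟨t.code, List.mem_map.2 ⟨t, ht, rfl⟩,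
      List.mem_map.2 ⟨p - ((List.range k).flatMap u).length, ?_, ?_⟩⟩)
    · simp only [Transition.code, ht3, List.mem_range]; omega
    · simp only [Transition.code, ht3, bufState, ht2, range_flatMap_succ]
      rw [List.drop_append, List.drop_eq_nil_of_le (by omega : ((List.range k).flatMap u).length ≤ p),
        List.nil_append]

theorem bufState_step (h : IsRunOn V c u w) {i p : ℕ} (h1 : stepsFor u p ≤ i)
    (h2 : i < stepsFor u (p + 1)) : bufState c u i p = ((c i).1.1, []) ∧
      bufState c u (i + 1) p = ((c (i + 1)).1.1, u i) := by
  have h3 := (lt_stepsFor h.concat).1 h2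
  have h4 := length_flatMap_mono u h1
  have h5 := le_length_stepsFor h.concat p
  have h6 : ((List.range i).flatMap u).length = p := by omega
  constructor
  · simp [bufState, ← h6]
  · simp [bufState, range_flatMap_succ, ← h6]

theorem edge_of_le (h : IsRunOn V c u w) {i j : ℕ} (hij : i ≤ j) :
    Relation.ReflTransGen V.Edge (c i).1 (c j).1 := by
  induction j, hij using Nat.le_induction with
  | base => rfl
  | succ j _ ih =>
    obtain ⟨t, ht, ht1, ht2, -⟩ := h.step j
    exact ih.tail ⟨t, ht, ht1, ht2⟩

/-- This is the use of weakness: after the first final state, a run makes no resets. -/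
theorem isLeft_of_final (h : IsRunOn V c u w) (hV : V.IsWeak) {i j : ℕ} (hij : i ≤ j)
    (hf : (c i).1 ∈ V.finals) {t : Transition V.numStates V.dim A} (ht : t ∈ V.transitions)
    (hs : t.src = (c j).1) : ∃ δ, t.op = Sum.inl δ := by
  cases hop : t.op with
  | inl δ => exact ⟨δ, rfl⟩
  | inr r =>
    exact absurd (hs ▸ h.edge_of_le hij) (hV _ hf t ht (by rw [hop]; rfl))

end IsRunOn

/-- Two valuations of `d₁` and of `d₂` counters as one valuation. -/
def combine {d₁ d₂ : ℕ} (x : Fin d₁ → ℕ) (y : Fin d₂ → ℕ) (k : ℕ) : ℕ :=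
  if h : k < d₁ then x ⟨k, h⟩ else if h : k - d₁ < d₂ then y ⟨k - d₁, h⟩ else 0

theorem block_combine_left {d₁ d₂ : ℕ} (x : Fin d₁ → ℕ) (y : Fin d₂ → ℕ) :
    block 0 d₁ (combine x y) = x := by
  funext i; simp [block, combine]

theorem block_combine_right {d₁ d₂ : ℕ} (x : Fin d₁ → ℕ) (y : Fin d₂ → ℕ) :
    block d₁ d₂ (combine x y) = y := by
  funext i; simp [block, combine]

theorem exists_runs_of_steps {σ : Type} {D f : ℕ} {E : List (GEdge σ)} {cfg : ℕ → σ × (ℕ → ℕ)}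
    {P : Prop} {fin : ℕ → Prop} {i j : ℕ} (hij : i ≤ j)
    (h : ∀ k, i ≤ k → k < j → ∃ e ∈ E, e.src = (cfg k).1 ∧ e.tgt = (cfg (k + 1)).1 ∧
      e.Fires D (cfg k).2 (cfg (k + 1)).2 ∧ (P → e.rst = 0) ∧ (fin k → e.flag = f)) :
    ∃ w, (∀ e ∈ w, e ∈ E ∧ (P → e.rst = 0)) ∧ Runs D (cfg i) w (cfg j) ∧
      ∀ k, i ≤ k → k < j → fin k → ∃ e ∈ w, e.flag = f := by
  induction j, hij using Nat.le_induction with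
  | base => exact ⟨[], by simp, rfl, fun k h1 h2 => by omega⟩
  | succ j hj ih =>
    obtain ⟨w, h1, h2, h3⟩ := ih fun k hk hk' => h k hk (by omega)
    obtain ⟨e, k1, k2, k3, k4, k5, k6⟩ := h j hj (by omega)
    refine ⟨w ++ [e], fun x hx => ?_, runs_append.2 ⟨_, h2, _, k2, k3, k4, rfl⟩, fun k hk hk' hf => ?_⟩
    · rcases List.mem_append.1 hx with hx | hx
      · exact h1 x hx
      · rw [List.mem_singleton.1 hx]; exact ⟨k1, k5⟩
    · by_cases hkj : k = j
      · subst hkj; exact ⟨e, by simp, k6 hf⟩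
      · obtain ⟨x, hx, hxf⟩ := h3 k hk (by omega) hf
        exact ⟨x, by simp [hx], hxf⟩

section Stages

variable {V₁ V₂ : BuchiResetVASS A} {c₁ : ℕ → V₁.Config} {c₂ : ℕ → V₂.Config}
  {u₁ u₂ : ℕ → List A} {w : ℕ → A}

/-- The configuration of the product after `i` steps of the first component and `j` steps of the
second component, when `p` letters have been emitted. -/
def prodConfig (c₁ : ℕ → V₁.Config) (c₂ : ℕ → V₂.Config) (u₁ u₂ : ℕ → List A) (i j p : ℕ) :
    PState A × (ℕ → ℕ) :=
  ((bufState c₁ u₁ i p, bufState c₂ u₂ j p), combine (c₁ i).2 (c₂ j).2)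

/-- The configuration of the product when `p` letters have been emitted. -/
noncomputable def stage (c₁ : ℕ → V₁.Config) (c₂ : ℕ → V₂.Config) (u₁ u₂ : ℕ → List A) (p : ℕ) :
    PState A × (ℕ → ℕ) := prodConfig c₁ c₂ u₁ u₂ (stepsFor u₁ p) (stepsFor u₂ p) p

/-- To emit letter `p`, the first component runs until it has read it, then the second one does, and
then both drop it from their buffers. If both have already passed final states, no reset occurs. -/
theorem exists_stage_step (h₁ : IsRunOn V₁ c₁ u₁ w) (h₂ : IsRunOn V₂ c₂ u₂ w)
    (hV₁ : V₁.IsWeak) (hV₂ : V₂.IsWeak) {i₁ i₂ : ℕ} (hf₁ : (c₁ i₁).1 ∈ V₁.finals)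
    (hf₂ : (c₂ i₂).1 ∈ V₂.finals) (p : ℕ) :
    ∃ l, (∀ e ∈ l, e ∈ productEdges V₁.code V₂.code ∧
        (i₁ ≤ stepsFor u₁ p ∧ i₂ ≤ stepsFor u₂ p → e.rst = 0)) ∧
      Runs (V₁.dim + V₂.dim) (stage c₁ c₂ u₁ u₂ p) l (stage c₁ c₂ u₁ u₂ (p + 1)) ∧
      (∀ k, stepsFor u₁ p ≤ k → k < stepsFor u₁ (p + 1) → (c₁ k).1 ∈ V₁.finals →
        ∃ e ∈ l, e.flag = 0) ∧
      (∀ k, stepsFor u₂ p ≤ k → k < stepsFor u₂ (p + 1) → (c₂ k).1 ∈ V₂.finals →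
        ∃ e ∈ l, e.flag = 1) ∧ ∃ e ∈ l, e.flag = 2 := by
  have hm₁ := stepsFor_mono h₁.concat (Nat.le_succ p)
  have hm₂ := stepsFor_mono h₂.concat (Nat.le_succ p)
  obtain ⟨l₁, k1, k2, k3⟩ := exists_runs_of_steps (D := V₁.dim + V₂.dim) (f := 0)
    (E := productEdges V₁.code V₂.code) (P := i₁ ≤ stepsFor u₁ p ∧ i₂ ≤ stepsFor u₂ p)
    (cfg := fun i => prodConfig c₁ c₂ u₁ u₂ i (stepsFor u₂ p) p)
    (fin := fun k => (c₁ k).1 ∈ V₁.finals) hm₁ (by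
      intro k hk hk'
      obtain ⟨t, ht, t1, t2, t3, t4⟩ := h₁.step k
      obtain ⟨b1, b2⟩ := h₁.bufState_step hk hk'
      refine ⟨fireEdge (fun a b => (a, b)) 0 V₁.code.2.2.2.2 0 t.code (bufState c₂ u₂ (stepsFor u₂ p) p),
        mem_productEdges.2 (Or.inl ⟨_, List.mem_map.2 ⟨t, ht, rfl⟩, _,
          h₂.bufState_mem le_rfl hm₂, rfl⟩), ?_, ?_, ?_, ?_, ?_⟩
      · simp only [prodConfig, b1, ← t1]; rfl
      · simp only [prodConfig, b2, ← t2, ← t3]; rfl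
      · refine (fires_opGen (by omega) t.op _ rfl _ _).2 ⟨?_, fun k hk hk' => ?_⟩
        · simp only [prodConfig, block_combine_left]; exact t4
        · have h0 : ¬ k < V₁.dim := by omega
          simp only [prodConfig, combine, dif_neg h0]
      · rintro ⟨hP, -⟩
        obtain ⟨δ, hδ⟩ := h₁.isLeft_of_final hV₁ (hP.trans hk) hf₁ ht t1
        simp [fireEdge, Transition.code, hδ, opCode, opGen]
      · intro hf
        exact if_pos (mem_code_finals.2 (t1 ▸ hf)))
  obtain ⟨l₂, m1, m2, m3⟩ := exists_runs_of_steps (D := V₁.dim + V₂.dim) (f := 1)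
    (E := productEdges V₁.code V₂.code) (P := i₁ ≤ stepsFor u₁ p ∧ i₂ ≤ stepsFor u₂ p)
    (cfg := fun j => prodConfig c₁ c₂ u₁ u₂ (stepsFor u₁ (p + 1)) j p)
    (fin := fun k => (c₂ k).1 ∈ V₂.finals) hm₂ (by
      intro k hk hk'
      obtain ⟨t, ht, t1, t2, t3, t4⟩ := h₂.step k
      obtain ⟨b1, b2⟩ := h₂.bufState_step hk hk'
      refine ⟨fireEdge (fun a b => (b, a)) V₁.code.2.1 V₂.code.2.2.2.2 1 t.code
          (bufState c₁ u₁ (stepsFor u₁ (p + 1)) p),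
        mem_productEdges.2 (Or.inr (Or.inl ⟨_, List.mem_map.2 ⟨t, ht, rfl⟩, _,
          h₁.bufState_mem hm₁ le_rfl, rfl⟩)), ?_, ?_, ?_, ?_, ?_⟩
      · simp only [prodConfig, b1, ← t1]; rfl
      · simp only [prodConfig, b2, ← t2, ← t3]; rfl
      · refine (fires_opGen (off := V₁.dim) le_rfl t.op _ rfl _ _).2 ⟨?_, fun k hk hk' => ?_⟩
        · simp only [prodConfig, block_combine_right]; exact t4
        · have h0 : k < V₁.dim := by omega
          simp only [prodConfig, combine, dif_pos h0]
      · rintro ⟨-, hP⟩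
        obtain ⟨δ, hδ⟩ := h₂.isLeft_of_final hV₂ (hP.trans hk) hf₂ ht t1
        simp [fireEdge, Transition.code, hδ, opCode, opGen]
      · intro hf
        exact if_pos (mem_code_finals.2 (t1 ▸ hf)))
  have d1 := drop_stepsFor h₁.concat (le_refl (stepsFor u₁ (p + 1)))
  have d2 := drop_stepsFor h₂.concat (le_refl (stepsFor u₂ (p + 1)))
  have hpop : popEdge (bufState c₁ u₁ (stepsFor u₁ (p + 1)) p) (bufState c₂ u₂ (stepsFor u₂ (p + 1)) p)
      ∈ productEdges V₁.code V₂.code := by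
    refine mem_productEdges.2 (Or.inr (Or.inr ⟨_, h₁.bufState_mem hm₁ le_rfl, _,
      h₂.bufState_mem hm₂ le_rfl, ⟨?_, ?_⟩, rfl⟩))
    · simp only [bufState, d1]; simp
    · simp only [bufState, d1, d2]; simp
  let x₁ := bufState c₁ u₁ (stepsFor u₁ (p + 1)) p
  let x₂ := bufState c₂ u₂ (stepsFor u₂ (p + 1)) p
  refine ⟨l₁ ++ (l₂ ++ [popEdge x₁ x₂]), fun e he => ?_,
    runs_append.2 ⟨_, k2, runs_append.2 ⟨_, m2, ?_⟩⟩, fun k hk hk' hf => ?_, fun k hk hk' hf => ?_,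
    popEdge x₁ x₂, by simp, rfl⟩
  · rcases List.mem_append.1 he with he | he
    · exact k1 e he
    rcases List.mem_append.1 he with he | he
    · exact m1 e he
    · rw [List.mem_singleton.1 he]; exact ⟨hpop, fun _ => rfl⟩
  · refine ⟨stage c₁ c₂ u₁ u₂ (p + 1), rfl, ?_, fires_popEdge.2 fun k _ => rfl, rfl⟩
    simp only [x₁, x₂, popEdge, stage, prodConfig, bufState, d1, d2, List.tail_cons]
  · obtain ⟨e, he, hef⟩ := k3 k hk hk' hf
    exact ⟨e, by simp [he], hef⟩
  · obtain ⟨e, he, hef⟩ := m3 k hk hk' hf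
    exact ⟨e, by simp [he], hef⟩

theorem exists_stage_runs (h₁ : IsRunOn V₁ c₁ u₁ w) (h₂ : IsRunOn V₂ c₂ u₂ w)
    (hV₁ : V₁.IsWeak) (hV₂ : V₂.IsWeak) {i₁ i₂ : ℕ} (hf₁ : (c₁ i₁).1 ∈ V₁.finals)
    (hf₂ : (c₂ i₂).1 ∈ V₂.finals) {p p' : ℕ} (hp : p ≤ p') :
    ∃ l, (∀ e ∈ l, e ∈ productEdges V₁.code V₂.code ∧
        (i₁ ≤ stepsFor u₁ p ∧ i₂ ≤ stepsFor u₂ p → e.rst = 0)) ∧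
      Runs (V₁.dim + V₂.dim) (stage c₁ c₂ u₁ u₂ p) l (stage c₁ c₂ u₁ u₂ p') ∧
      (∀ k, stepsFor u₁ p ≤ k → k < stepsFor u₁ p' → (c₁ k).1 ∈ V₁.finals →
        ∃ e ∈ l, e.flag = 0) ∧
      (∀ k, stepsFor u₂ p ≤ k → k < stepsFor u₂ p' → (c₂ k).1 ∈ V₂.finals →
        ∃ e ∈ l, e.flag = 1) ∧ (p < p' → ∃ e ∈ l, e.flag = 2) := by
  induction p', hp using Nat.le_induction with
  | base => exact ⟨[], by simp, rfl, fun k _ _ => by omega, fun k _ _ => by omega, by simp⟩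
  | succ p' hp ih =>
    obtain ⟨l, k1, k2, k3, k4, -⟩ := ih
    obtain ⟨l', m1, m2, m3, m4, e, he, hef⟩ := exists_stage_step h₁ h₂ hV₁ hV₂ hf₁ hf₂ p'
    refine ⟨l ++ l', fun x hx => ?_, runs_append.2 ⟨_, k2, m2⟩, fun k hk hk' hf => ?_,
      fun k hk hk' hf => ?_, fun _ => ⟨e, by simp [he], hef⟩⟩
    · rcases List.mem_append.1 hx with hx | hx
      · exact k1 x hx
      · exact ⟨(m1 x hx).1, fun h => (m1 x hx).2 ⟨h.1.trans (stepsFor_mono h₁.concat hp),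
          h.2.trans (stepsFor_mono h₂.concat hp)⟩⟩
    · by_cases h : k < stepsFor u₁ p'
      · obtain ⟨x, hx, hxf⟩ := k3 k hk h hf
        exact ⟨x, by simp [hx], hxf⟩
      · obtain ⟨x, hx, hxf⟩ := m3 k (by omega) hk' hf
        exact ⟨x, by simp [hx], hxf⟩
    · by_cases h : k < stepsFor u₂ p'
      · obtain ⟨x, hx, hxf⟩ := k4 k hk h hf
        exact ⟨x, by simp [hx], hxf⟩
      · obtain ⟨x, hx, hxf⟩ := m4 k (by omega) hk' hf
        exact ⟨x, by simp [hx], hxf⟩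

/-- Stages are chosen such that both components visit final states between any two of them. By
Dickson's lemma, one stage is covered by a later one in the same state. -/
theorem accepts_of_isRunOn (h₁ : IsRunOn V₁ c₁ u₁ w) (h₂ : IsRunOn V₂ c₂ u₂ w)
    (hV₁ : V₁.IsWeak) (hV₂ : V₂.IsWeak) : (product V₁.code V₂.code).Accepts := by
  obtain ⟨i₁, hf₁⟩ := h₁.final.exists
  obtain ⟨i₂, hf₂⟩ := h₂.final.exists
  have hpast : ∀ {V : BuchiResetVASS A} {c : ℕ → V.Config} {u : ℕ → List A}, IsRunOn V c u w →
      ∀ k, k < stepsFor u (((List.range k).flatMap u).length + 1) :=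
    fun h k => (lt_stepsFor h.concat).2 (Nat.lt_succ_self _)
  have hnext : ∀ p, ∃ p', p < p' ∧
      (∃ k, stepsFor u₁ p ≤ k ∧ k < stepsFor u₁ p' ∧ (c₁ k).1 ∈ V₁.finals) ∧
      ∃ k, stepsFor u₂ p ≤ k ∧ k < stepsFor u₂ p' ∧ (c₂ k).1 ∈ V₂.finals := by
    intro p
    obtain ⟨k₁, hk₁, hfk₁⟩ := (frequently_atTop.1 h₁.final) (stepsFor u₁ p)
    obtain ⟨k₂, hk₂, hfk₂⟩ := (frequently_atTop.1 h₂.final) (stepsFor u₂ p)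
    refine ⟨p + 1 + ((List.range k₁).flatMap u₁).length + ((List.range k₂).flatMap u₂).length,
      by omega, ⟨k₁, hk₁, ?_, hfk₁⟩, ⟨k₂, hk₂, ?_, hfk₂⟩⟩
    · exact (hpast h₁ k₁).trans_le (stepsFor_mono h₁.concat (by omega))
    · exact (hpast h₂ k₂).trans_le (stepsFor_mono h₂.concat (by omega))
  choose next hn1 hn2 hn3 using hnext
  -- From this stage on, both components have passed the final states at `i₁` and `i₂`, so the loop
  -- is free of resets.
  let p₀ := ((List.range i₁).flatMap u₁).length + ((List.range i₂).flatMap u₂).length + 1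
  let s : ℕ → ℕ := fun n => next^[n] p₀
  have hs1 : ∀ n, s (n + 1) = next (s n) := fun n => Function.iterate_succ_apply' _ _ _
  have hsm : StrictMono s := strictMono_nat_of_lt_succ fun n => by rw [hs1]; exact hn1 _
  have hs0 : ∀ n, p₀ ≤ s n := fun n => hsm.monotone (Nat.zero_le n)
  let S := {x // x ∈ bufferStates V₁.code} × {x // x ∈ bufferStates V₂.code}
  have hS : Finite S := by
    have h1 : Finite {x // x ∈ bufferStates V₁.code} := (bufferStates V₁.code).finite_toSet
    have h2 : Finite {x // x ∈ bufferStates V₂.code} := (bufferStates V₂.code).finite_toSet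
    exact inferInstanceAs (Finite (_ × _))
  let F : ℕ → S × (Fin (V₁.dim + V₂.dim) → ℕ) := fun n =>
    ((⟨_, h₁.bufState_mem le_rfl (stepsFor_mono h₁.concat (Nat.le_succ (s n)))⟩,
      ⟨_, h₂.bufState_mem le_rfl (stepsFor_mono h₂.concat (Nat.le_succ (s n)))⟩),
      fun i => (stage c₁ c₂ u₁ u₂ (s n)).2 i)
  have hwqo : WellQuasiOrdered fun x y : S × (Fin (V₁.dim + V₂.dim) → ℕ) =>
      x.1 = y.1 ∧ x.2 ≤ y.2 :=
    WellQuasiOrdered.prod (Finite.wellQuasiOrdered _) wellQuasiOrdered_le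
  obtain ⟨m, n, hmn, hst, hle⟩ := hwqo F
  obtain ⟨l₀, a1, a2, -⟩ := exists_stage_runs h₁ h₂ hV₁ hV₂ hf₁ hf₂ (Nat.zero_le (s m))
  obtain ⟨l, b1, b2, b3, b4, b5⟩ := exists_stage_runs h₁ h₂ hV₁ hV₂ hf₁ hf₂ (hsm hmn).le
  have hstart : stage c₁ c₂ u₁ u₂ 0 = ((product V₁.code V₂.code).1, fun _ => 0) := by
    have z1 : stepsFor u₁ 0 = 0 := by simp [stepsFor]
    have z2 : stepsFor u₂ 0 = 0 := by simp [stepsFor]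
    simp only [stage, prodConfig, bufState, z1, z2, h₁.zero, h₂.zero, product]
    refine Prod.ext (by simp [BuchiResetVASS.code]) ?_
    funext k
    simp [combine]
  rw [hstart] at a2
  have hbefore : next (s m) ≤ s n := by
    rw [← hs1]; exact hsm.monotone hmn
  refine ⟨l₀, _, fun e he => (a1 e he).1, a2, l, _, fun e he => ⟨(b1 e he).1, (b1 e he).2 ⟨?_, ?_⟩⟩,
    b2, ?_, fun i hi => hle ⟨i, hi⟩, fun f hf => ?_⟩
  · exact (hpast h₁ i₁).le.trans (stepsFor_mono h₁.concat (le_trans (by simp only [p₀]; omega) (hs0 m)))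
  · exact (hpast h₂ i₂).le.trans (stepsFor_mono h₂.concat (le_trans (by simp only [p₀]; omega) (hs0 m)))
  · have h1 := congrArg (fun x : S => (x.1.1, x.2.1)) hst
    exact h1
  · interval_cases f
    · obtain ⟨k, hk, hk', hfk⟩ := hn2 (s m)
      exact b3 k hk (hk'.trans_le (stepsFor_mono h₁.concat hbefore)) hfk
    · obtain ⟨k, hk, hk', hfk⟩ := hn3 (s m)
      exact b4 k hk (hk'.trans_le (stepsFor_mono h₂.concat hbefore)) hfk
    · exact b5 (hsm hmn)

end Stages

theorem accepts_product_iff {V₁ V₂ : BuchiResetVASS A} (hV₁ : V₁.IsWeak) (hV₂ : V₂.IsWeak) :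
    (product V₁.code V₂.code).Accepts ↔ (V₁.language ∩ V₂.language).Nonempty := by
  refine ⟨inter_nonempty_of_accepts V₁ V₂, ?_⟩
  rintro ⟨w, ⟨c₁, u₁, h1, h2, h3, h4⟩, c₂, u₂, k1, k2, k3, k4⟩
  exact accepts_of_isRunOn ⟨h1, h2, h3, h4⟩ ⟨k1, k2, k3, k4⟩ hV₁ hV₂

theorem decidable_inter_empty (A : Type) [Primcodable A] :
    DecidableProblem (fun V : WeakBRVASS A × WeakBRVASS A => (V.1.1.code, V.2.1.code))
      (fun V => V.1.1.language ∩ V.2.1.language = ∅) := by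
  obtain ⟨f, hf, hfa⟩ := exists_computable_accepts (σ := PState A)
  refine ⟨fun p => !f (product p.1 p.2),
    Primrec.not.to_comp.comp (hf.comp primrec_product.to_comp), fun V => ?_⟩
  rw [Bool.not_eq_true', ← Bool.not_eq_true, hfa, accepts_product_iff V.1.2 V.2.2,
    Set.not_nonempty_iff_eq_empty]

theorem decidable_empty (A : Type) [Primcodable A] :
    DecidableProblem (fun V : WeakBRVASS A => V.1.code) (fun V => V.1.language = ∅) := by
  obtain ⟨f, hf, hfa⟩ := decidable_inter_empty A
  refine ⟨fun c => f (c, c), hf.comp (Computable.pair Computable.id Computable.id), fun V => ?_⟩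
  exact (hfa (V, V)).trans (by simp only [Set.inter_self])

end Product

/-! ## Weak Büchi reset VASS are well-structured -/

theorem isWSTS_configLE {A : Type} (V : BuchiResetVASS A) : V.toTS.IsWSTS V.configLE where
  refl c := ⟨rfl, fun _ => le_rfl⟩
  trans c₁ c₂ c₃ h h' := ⟨h.1.trans h'.1, fun i => (h.2 i).trans (h'.2 i)⟩
  wqo := WellQuasiOrdered.prod (r := (· = ·)) (s := (· ≤ ·)) (Finite.wellQuasiOrdered _)
    wellQuasiOrdered_le
  compat := by
    rintro ⟨q₁, m₁⟩ w ⟨q₁', m₁'⟩ ⟨q₂, m₂⟩ ⟨t, ht, h1, h2, h3, h4⟩ ⟨hq, hm⟩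
    obtain rfl : q₁ = q₂ := hq
    obtain ⟨m₂', h5, h6⟩ : ∃ m₂', Fires t.op m₂ m₂' ∧ ∀ i, m₁' i ≤ m₂' i := by
      revert h4
      cases t.op with
      | inl δ =>
        intro h4
        -- The surplus over the smaller configuration is kept.
        refine ⟨fun i => m₁' i + (m₂ i - m₁ i), fun i => ?_, fun i => Nat.le_add_right _ _⟩
        have := h4 i
        have := hm i
        simp only at *
        push_cast [Nat.cast_sub (hm i)]
        linarith
      | inr r =>
        rintro rfl
        refine ⟨_, rfl, fun i => ?_⟩
        by_cases hi : i = r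
        · subst hi; simp
        · simpa [Function.update_of_ne hi] using hm i
    exact ⟨(q₁', m₂'), ⟨t, ht, h1, h2, h3, h5⟩, rfl, h6⟩
  final_up := by
    rintro ⟨q₁, m₁⟩ ⟨q₂, m₂⟩ h ⟨hq, -⟩
    obtain rfl : q₁ = q₂ := hq
    exact h

/-! ## Words over one pair of letters -/

section Words

/-- The opening letter. -/
abbrev opn : Letter 1 := (0, true)

/-- The closing letter. -/
abbrev cls : Letter 1 := (0, false)

theorem letter_cases (x : Letter 1) : x = opn ∨ x = cls := by
  obtain ⟨i, b⟩ := x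
  have := Subsingleton.elim i 0
  subst this
  cases b <;> simp

theorem count_opn_add_count_cls (v : List (Letter 1)) :
    v.count opn + v.count cls = v.length := by
  induction v with
  | nil => rfl
  | cons x v ih =>
    rcases letter_cases x with rfl | rfl <;> simp <;> omega

theorem balance_append (i : Fin 1) (v v' : List (Letter 1)) :
    balance i (v ++ v') = balance i v + balance i v' := by
  simp only [balance, List.count_append]; push_cast; ring

theorem balance_zero_eq (v : List (Letter 1)) :
    balance 0 v = (v.count opn : ℤ) - v.count cls := rfl

/-- All prefixes have nonnegative balance. -/
def IsGood (v : List (Letter 1)) : Prop := ∀ v', v' <+: v → 0 ≤ balance 0 v'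

theorem prefix_append_cases {α : Type} {x l₁ l₂ : List α} (h : x <+: l₁ ++ l₂) :
    x <+: l₁ ∨ ∃ y, x = l₁ ++ y ∧ y <+: l₂ := by
  obtain ⟨t, ht⟩ := h
  rcases List.append_eq_append_iff.1 ht with ⟨a, h1, -⟩ | ⟨a, h1, h2⟩
  · exact Or.inl ⟨a, h1.symm⟩
  · exact Or.inr ⟨a, h1, t, h2.symm⟩

theorem IsGood.append {v v' : List (Letter 1)} (h : IsGood v) (h' : IsGood v') :
    IsGood (v ++ v') := by
  intro x hx
  rcases prefix_append_cases hx with hx | ⟨y, rfl, hy⟩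
  · exact h _ hx
  · rw [balance_append]; exact add_nonneg (h _ List.prefix_rfl) (h' _ hy)

theorem isGood_replicate (k : ℕ) : IsGood (List.replicate k opn) := by
  intro x hx
  rw [(List.prefix_replicate_iff.1 hx).2]
  simp [balance_zero_eq, List.count_replicate]

/-- The opening letters in front pay for all of `z`, whatever it consists of. -/
theorem isGood_replicate_append {k : ℕ} {z : List (Letter 1)} (h : z.length ≤ k) :
    IsGood (List.replicate k opn ++ z) := by
  intro x hx
  rcases prefix_append_cases hx with hx | ⟨y, rfl, hy⟩
  · exact isGood_replicate k _ hx
  · have h1 := hy.length_le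
    have h2 := count_opn_add_count_cls y
    simp only [balance_zero_eq, List.count_append, List.count_replicate]
    simp
    omega

theorem mem_dyck_of_isGood {u : ℕ → List (Letter 1)} {w : ℕ → Letter 1}
    (hw : IsInfiniteConcat u w) (hu : ∀ n, IsGood (u n)) : w ∈ Dyck 1 := by
  have hg : ∀ n, IsGood ((List.range n).flatMap u) := by
    intro n
    induction n with
    | zero => exact isGood_replicate 0
    | succ n ih => rw [range_flatMap_succ]; exact ih.append (hu n)
  intro k i
  rw [Subsingleton.elim i 0]
  obtain ⟨n, hn⟩ := hw.2 k
  refine hg n _ ?_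
  rw [hw.1 n]
  obtain ⟨j, hj⟩ := Nat.exists_eq_add_of_le hn
  rw [hj, List.range_add, List.map_append]
  exact List.prefix_append _ _

end Words

/-! ## Pumping blocks of opening letters -/

section Pump

variable {A : Type} {S : BuchiTS A}

/-- The part between `i` and `j` of a run. -/
def runSegment (c : ℕ → S.State) (u : ℕ → List A) (i j : ℕ) : List (S.State × List A) :=
  (List.range' i (j - i)).map fun k => (c k, u k)

theorem spath_runSegment {c : ℕ → S.State} {u : ℕ → List A}
    (hs : ∀ i, S.step (c i) (u i) (c (i + 1))) {i j : ℕ} (hij : i ≤ j) :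
    SPath S (c i) (runSegment c u i j) (c j) := by
  induction j, hij using Nat.le_induction with
  | base => simp [runSegment, SPath]
  | succ j hj ih =>
    have : runSegment c u i (j + 1) = runSegment c u i j ++ [(c j, u j)] := by
      simp [runSegment, Nat.succ_sub hj, List.range'_concat, Nat.add_sub_cancel' hj]
    rw [this]
    exact spath_append.2 ⟨_, ih, rfl, _, hs j, rfl⟩

theorem flatMap_runSegment (c : ℕ → S.State) (u : ℕ → List A) {i j : ℕ} (hij : i ≤ j) :
    (List.range i).flatMap u ++ (runSegment c u i j).flatMap Prod.snd =
      (List.range j).flatMap u := by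
  obtain ⟨k, rfl⟩ := Nat.exists_eq_add_of_le hij
  simp [runSegment, List.flatMap_map, List.range_add, List.flatMap_append, List.range'_eq_map_range]

theorem flatMap_runSegment_eq_replicate {c : ℕ → S.State} {u : ℕ → List A} {w : ℕ → A} {a : A}
    (hw : IsInfiniteConcat u w) {i j : ℕ} (hij : i ≤ j)
    (ha : ∀ p, ((List.range i).flatMap u).length ≤ p → p < ((List.range j).flatMap u).length →
      w p = a) :
    (runSegment c u i j).flatMap Prod.snd = List.replicate
      (((List.range j).flatMap u).length - ((List.range i).flatMap u).length) a := by
  have h := flatMap_runSegment c u hij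
  have hl := congrArg List.length h
  rw [List.length_append] at hl
  refine List.eq_replicate_iff.2 ⟨by omega, fun x hx => ?_⟩
  obtain ⟨k, hk, rfl⟩ := List.getElem_of_mem hx
  have h1 := eq_map_range_iff.1 (hw.1 j) (((List.range i).flatMap u).length + k) (by omega)
  rw [ha _ (by omega) (by omega)] at h1
  rw [← h1]
  simp [← h]

/-- The `J`-fold repetition of a list. -/
def repeatList {α : Type} (J : ℕ) (l : List α) : List α := (List.replicate J l).flatten

theorem spath_repeatList {c : S.State} {l : List (S.State × List A)} (h : SPath S c l c) (J : ℕ) :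
    SPath S c (repeatList J l) c := by
  induction J with
  | zero => rfl
  | succ J ih =>
    simp only [repeatList, List.replicate_succ, List.flatten_cons]
    exact spath_append.2 ⟨_, h, ih⟩

theorem flatMap_repeatList {l : List (S.State × List A)} {a : A} {m : ℕ}
    (h : l.flatMap Prod.snd = List.replicate m a) (J : ℕ) :
    (repeatList J l).flatMap Prod.snd = List.replicate (J * m) a := by
  induction J with
  | zero => simp [repeatList]
  | succ J ih =>
    simp only [repeatList, List.replicate_succ, List.flatten_cons, List.flatMap_append, h] at ih ⊢
    rw [ih, ← List.replicate_add, Nat.succ_mul, Nat.add_comm]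

/-- A run over a long block of equal letters repeats a state inside of the block. -/
theorem exists_pump [Fintype S.State] {c : ℕ → S.State} {u : ℕ → List A} {w : ℕ → A} {ℓ : ℕ}
    (hw : IsInfiniteConcat u w) (hℓ : ∀ i, (u i).length ≤ ℓ) (p : ℕ) :
    ∃ i j, i < j ∧ c i = c j ∧ p ≤ ((List.range i).flatMap u).length ∧
      ((List.range i).flatMap u).length < ((List.range j).flatMap u).length ∧
      ((List.range j).flatMap u).length ≤ p + (Fintype.card S.State + 1) * (ℓ + 1) := by
  have hup : ∀ p, ((List.range (stepsFor u p)).flatMap u).length ≤ p + ℓ := by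
    intro p
    cases h : stepsFor u p with
    | zero => simp
    | succ k =>
      have h1 := (lt_stepsFor hw (i := k) (p := p)).1 (by omega)
      have h2 := hℓ k
      rw [range_flatMap_succ, List.length_append]; omega
  -- A step reads at most `ℓ` letters, so samples at distance `ℓ + 1` are separated by at least one
  -- letter. There are more samples than states.
  let f : Fin (Fintype.card S.State + 1) → S.State := fun r => c (stepsFor u (p + r * (ℓ + 1)))
  obtain ⟨r, s, hrs, hf⟩ := Fintype.exists_ne_map_eq_of_card_lt f (by simp)
  have key : ∀ r s : Fin (Fintype.card S.State + 1), r < s → f r = f s →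
      ∃ i j, i < j ∧ c i = c j ∧ p ≤ ((List.range i).flatMap u).length ∧
      ((List.range i).flatMap u).length < ((List.range j).flatMap u).length ∧
      ((List.range j).flatMap u).length ≤ p + (Fintype.card S.State + 1) * (ℓ + 1) := by
    intro r s hrs hf
    have h1 := hup (p + r * (ℓ + 1))
    have h2 := le_length_stepsFor hw (p + s * (ℓ + 1))
    have h3 := hup (p + s * (ℓ + 1))
    have h4 := le_length_stepsFor hw (p + r * (ℓ + 1))
    have h5 : (r.val + 1) * (ℓ + 1) ≤ s.val * (ℓ + 1) := Nat.mul_le_mul_right _ hrs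
    have h6 : (s.val + 1) * (ℓ + 1) ≤ (Fintype.card S.State + 1) * (ℓ + 1) :=
      Nat.mul_le_mul_right _ s.2
    rw [Nat.succ_mul] at h5 h6
    refine ⟨_, _, ?_, hf, by omega, by omega, by omega⟩
    by_contra hc
    have := length_flatMap_mono u (not_lt.1 hc)
    omega
  rcases lt_or_gt_of_ne hrs with h | h
  · exact key r s h hf
  · exact key s r h hf.symm

/-- A language of a finite transition system with a word that begins with a long block of opening
letters and has infinitely many of them meets the Dyck language. -/
theorem inter_dyck_nonempty {S : BuchiTS (Letter 1)} [Fintype S.State] {ℓ N : ℕ}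
    (hN : (Fintype.card S.State + 1) * (ℓ + 1) ≤ N)
    (hℓ : ∀ c v c', S.step c v c' → v.length ≤ ℓ) {w : ℕ → Letter 1} (hw : w ∈ S.language)
    (h0 : ∀ p < N, w p = opn) (hinf : ∀ M, ∃ p, M ≤ p ∧ ∀ k < N, w (p + k) = opn) :
    (S.language ∩ Dyck 1).Nonempty := by
  obtain ⟨c, u, hc, hs, hf, hu⟩ := hw
  have hℓ' : ∀ i, (u i).length ≤ ℓ := fun i => hℓ _ _ _ (hs i)
  have hpump : ∀ p, (∀ k < N, w (p + k) = opn) → ∃ i l m, SPath S (c i) l (c i) ∧ 0 < m ∧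
      l.flatMap Prod.snd = List.replicate m opn ∧ p ≤ ((List.range i).flatMap u).length ∧
      ((List.range i).flatMap u).length ≤ p + N := by
    intro p hp
    obtain ⟨i, j, hij, he, h1, h2, h3⟩ := exists_pump (c := c) hu hℓ' p
    refine ⟨i, runSegment c u i j, _, ?_, Nat.sub_pos_of_lt h2,
      flatMap_runSegment_eq_replicate hu hij.le fun q hq hq' => ?_, h1, by omega⟩
    · have := spath_runSegment hs hij.le
      rwa [← he] at this
    · obtain ⟨k, rfl⟩ := Nat.exists_eq_add_of_le (h1.trans hq)
      exact hp k (by omega)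
  obtain ⟨i₀, l₀, m₀, a1, a2, a3, -, a5⟩ := hpump 0 (by simpa using h0)
  have hnext : ∀ i : ℕ, ∃ j l m,
      ((List.range i).flatMap u).length < ((List.range j).flatMap u).length ∧
      SPath S (c j) l (c j) ∧ 0 < m ∧
      l.flatMap Prod.snd = List.replicate m opn := by
    intro i
    obtain ⟨p, hp, hp'⟩ := hinf (((List.range i).flatMap u).length + 1)
    obtain ⟨j, l, m, b1, b2, b3, b4, -⟩ := hpump p hp'
    exact ⟨j, l, m, by omega, b1, b2, b3⟩
  choose J l m j0 j2 j3 j4 using hnext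
  have j1 : ∀ i, i ≤ J i := fun i => by
    by_contra hcon
    have := length_flatMap_mono u (not_le.1 hcon).le
    have := j0 i
    omega
  -- Some state with a loop over opening letters recurs, and a final state is visited in between, so
  -- the run can be closed to a lasso through `q`.
  obtain ⟨q, hq⟩ : ∃ q, ∃ᶠ i in atTop, c (J i) = q := by
    by_contra hcon
    push Not at hcon
    have : ∀ᶠ i in atTop, ∀ q, c (J i) ≠ q := by
      rw [eventually_all]
      exact fun q => hcon q
    obtain ⟨i, hi⟩ := this.exists
    exact hi _ rfl
  rw [frequently_atTop] at hq hf
  obtain ⟨n₁, hn₁, hq₁⟩ := hq i₀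
  obtain ⟨f, hf1, hf2⟩ := hf (J n₁)
  obtain ⟨n₂, hn₂, hq₂⟩ := hq (f + 1)
  have e1 := j1 n₁
  have e2 := j1 n₂
  set x := runSegment c u i₀ (J n₁) with hx
  set y := runSegment c u (J n₁) (J n₂) with hy
  have hx' : SPath S (c i₀) x q := hq₁ ▸ spath_runSegment hs (by omega)
  have hy' : SPath S q y q := by
    have := spath_runSegment hs (i := J n₁) (j := J n₂) (by omega)
    rwa [hq₁, hq₂] at this
  have hfy : ∃ z ∈ y, z.1 ∈ S.final := by
    refine ⟨_, List.mem_map.2 ⟨f, ?_, rfl⟩, hf2⟩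
    rw [List.mem_range'_1]; omega
  have hc₀ : SPath S S.start (runSegment c u 0 i₀) (c i₀) := hc ▸ spath_runSegment hs (Nat.zero_le _)
  have hw₀ : (runSegment c u 0 i₀).flatMap Prod.snd =
      List.replicate (((List.range i₀).flatMap u).length - ((List.range 0).flatMap u).length) opn :=
    flatMap_runSegment_eq_replicate hu (Nat.zero_le _) fun p _ hp => h0 p (by omega)
  -- Each loop reads at least one opening letter. Repeating it as often as the following segment has
  -- letters makes all prefix balances nonnegative, both on the stem and on the cycle.
  let X := runSegment c u 0 i₀ ++ (repeatList (x.flatMap Prod.snd).length l₀ ++ x)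
  let Y := repeatList (y.flatMap Prod.snd).length (l n₁) ++ y
  have hX : SPath S S.start X q :=
    spath_append.2 ⟨_, hc₀, spath_append.2 ⟨_, spath_repeatList a1 _, hx'⟩⟩
  have hY : SPath S q Y q :=
    spath_append.2 ⟨_, spath_repeatList (hq₁ ▸ j2 n₁) _, hy'⟩
  have gX : IsGood (X.flatMap Prod.snd) := by
    simp only [X, List.flatMap_append, hw₀, flatMap_repeatList a3]
    exact (isGood_replicate _).append (isGood_replicate_append (Nat.le_mul_of_pos_right _ a2))
  have gY : IsGood (Y.flatMap Prod.snd) := by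
    simp only [Y, List.flatMap_append, flatMap_repeatList (j4 n₁)]
    exact isGood_replicate_append (Nat.le_mul_of_pos_right _ (j3 n₁))
  have hYlen : 0 < (Y.flatMap Prod.snd).length := by
    have h1 := congrArg List.length (flatMap_runSegment c u (i := J n₁) (j := J n₂) (by omega))
    have h2 := length_flatMap_mono u (show J n₁ ≤ n₂ by omega)
    have h3 := j0 n₂
    rw [List.length_append, ← hy] at h1
    simp only [Y, List.flatMap_append, List.length_append]
    omega
  let L : ℕ → List (S.State × List (Letter 1)) := fun n => if n = 0 then X ++ Y else Y
  have hLg : ∀ n, IsGood ((L n).flatMap Prod.snd) := fun n => by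
    simp only [L]
    split_ifs
    · rw [List.flatMap_append]; exact gX.append gY
    · exact gY
  have hLlen : ∀ n, 0 < ((L n).flatMap Prod.snd).length := fun n => by
    simp only [L]
    split_ifs
    · rw [List.flatMap_append, List.length_append]; omega
    · exact hYlen
  obtain ⟨w', hw'⟩ := exists_infiniteConcat (fun n => (L n).flatMap Prod.snd) fun n => by
    refine ⟨n, ?_⟩
    induction n with
    | zero => simp
    | succ n ih =>
      have := hLlen n
      rw [range_flatMap_succ, List.length_append]; omega
  obtain ⟨z, hz, hzf⟩ := hfy
  refine ⟨w', mem_language_of_segments (d := fun n => if n = 0 then S.start else q) (l := L) (if_pos rfl)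
    (fun n => ?_) (fun n => ⟨z, ?_, hzf⟩) hw', mem_dyck_of_isGood hw' hLg⟩
  · rcases n.eq_zero_or_pos with rfl | hn
    · simpa [L] using spath_append.2 ⟨_, hX, hY⟩
    · simpa [L, hn.ne'] using hY
  · simp only [L]
    split_ifs <;> simp [Y, hz]

end Pump

/-! ## Blocks of opening letters with a bounded weighted balance -/

section BlockWord

/-- The periodic word with `N` opening letters and then `2 * N` closing letters. -/
def blockWord (N p : ℕ) : Letter 1 := if p % (3 * N) < N then opn else cls

theorem map_range_succ_count (w : ℕ → Letter 1) (n : ℕ) (x : Letter 1) :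
    ((List.range (n + 1)).map w).count x = ((List.range n).map w).count x + if w n = x then 1 else 0 := by
  rw [List.range_succ, List.map_append, List.count_append]
  simp [List.count_singleton]

theorem blockWord_balance {N : ℕ} (hN : 0 < N) (n : ℕ) :
    2 * ((List.range n).map (blockWord N)).count opn ≤
      ((List.range n).map (blockWord N)).count cls + 2 * N := by
  -- The weighted balance rises by two up to `2 * N` within the opening block, and falls by one back
  -- to `0` within the closing block.
  have key : ∀ n, 2 * ((List.range n).map (blockWord N)).count opn =
      ((List.range n).map (blockWord N)).count cls +
        if n % (3 * N) < N then 2 * (n % (3 * N)) else 3 * N - n % (3 * N) := by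
    intro n
    induction n with
    | zero => simp
    | succ n ih =>
      have h1 := Nat.mod_lt n (show 0 < 3 * N by omega)
      have h2 : (n + 1) % (3 * N) = if n % (3 * N) + 1 = 3 * N then 0 else n % (3 * N) + 1 := by
        rw [Nat.add_mod_eq_ite, Nat.mod_eq_of_lt (show 1 < 3 * N by omega)]
        split_ifs <;> omega
      rw [map_range_succ_count, map_range_succ_count, h2]
      by_cases hr : n % (3 * N) < N
      · have hx : blockWord N n = opn := if_pos hr
        rw [if_pos hr] at ih
        rw [hx, if_pos rfl, if_neg (by simp)]
        split_ifs <;> omega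
      · have hx : blockWord N n = cls := if_neg hr
        rw [if_neg hr] at ih
        rw [hx, if_pos rfl, if_neg (by simp)]
        split_ifs <;> omega
  rw [key n]
  have h1 := Nat.mod_lt n (show 0 < 3 * N by omega)
  split_ifs <;> omega

theorem blockWord_block {N : ℕ} (hN : 0 < N) (b k : ℕ) (hk : k < N) :
    blockWord N (3 * N * b + k) = opn := by
  rw [blockWord, Nat.mul_add_mod, Nat.mod_eq_of_lt (by omega), if_pos hk]

end BlockWord

/-! ## From place boundedness to regular separability from the Dyck language -/

/-- An operation that adds `k` to the first counter. -/
def addFirst {d : ℕ} (k : ℤ) : (Fin d → ℤ) ⊕ Fin d := Sum.inl fun i => if i.val = 0 then k else 0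

/-- The transitions of `V` in a system with one more state. -/
def Transition.lift {n d : ℕ} {A : Type} (t : Transition n d A) : Transition (n + 1) d A :=
  ⟨t.src.castSucc, t.op, t.label, t.tgt.castSucc⟩

/-- The transitions of the system `V` with a new state, in which opening letters cost two units of
the first counter and closing letters give back one. -/
def spendingTransitions (V : BuchiResetVASS (Letter 1)) :
    List (Transition (V.numStates + 1) V.dim (Letter 1)) :=
  V.transitions.map Transition.lift ++
    ((List.finRange V.numStates).map (fun q => ⟨q.castSucc, addFirst 0, [], Fin.last _⟩) ++
    [⟨Fin.last _, addFirst (-2), [opn], Fin.last _⟩, ⟨Fin.last _, addFirst 1, [cls], Fin.last _⟩])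

/-- The system with the transitions `spendingTransitions V`; the new state is final. -/
abbrev BuchiResetVASS.withSpending (V : BuchiResetVASS (Letter 1)) : BuchiResetVASS (Letter 1) where
  numStates := V.numStates + 1
  dim := V.dim
  start := V.start.castSucc
  transitions := spendingTransitions V
  finals := [Fin.last _]

section Spending

open BuchiResetVASS

variable {V : BuchiResetVASS (Letter 1)}

theorem mem_spendingTransitions {t : Transition (V.numStates + 1) V.dim (Letter 1)} :
    t ∈ spendingTransitions V ↔ (∃ t' ∈ V.transitions, t'.lift = t) ∨
      (∃ q : Fin V.numStates, ⟨q.castSucc, addFirst 0, [], Fin.last _⟩ = t) ∨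
      t = ⟨Fin.last _, addFirst (-2), [opn], Fin.last _⟩ ∨
      t = ⟨Fin.last _, addFirst 1, [cls], Fin.last _⟩ := by
  simp [spendingTransitions]

theorem isWeak_withSpending : V.withSpending.IsWeak := by
  intro q hq t ht hr hp
  obtain rfl : q = Fin.last _ := List.mem_singleton.1 hq
  have hlast : ∀ q', Relation.ReflTransGen V.withSpending.Edge (Fin.last V.numStates) q' →
      q' = Fin.last V.numStates := by
    intro q' h
    induction h with
    | refl => rfl
    | tail _ h ih =>
      obtain ⟨t, ht, h1, rfl⟩ := h
      rw [ih] at h1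
      rcases mem_spendingTransitions.1 ht with ⟨t', -, rfl⟩ | ⟨q, rfl⟩ | rfl | rfl
      · exact absurd h1 (Fin.castSucc_ne_last _)
      · rfl
      · rfl
      · rfl
  have h1 := hlast _ hp
  rcases mem_spendingTransitions.1 ht with ⟨t', -, rfl⟩ | ⟨q, rfl⟩ | rfl | rfl
  · exact absurd h1 (Fin.castSucc_ne_last _)
  · exact absurd h1 (Fin.castSucc_ne_last _)
  · cases hr
  · cases hr

theorem fires_addFirst {d : ℕ} (hd : 0 < d) {k : ℤ} {m m' : Fin d → ℕ}
    (h : Fires (addFirst k) m m') : (m' ⟨0, hd⟩ : ℤ) = m ⟨0, hd⟩ + k := by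
  have := h ⟨0, hd⟩
  simpa using this

theorem withSpending_step_cases (hV : V.IsResetVASS) (hd : 0 < V.dim)
    {c c' : V.withSpending.Config} {v : List (Letter 1)} (h : V.withSpending.Step c v c') :
    (∃ q q' : Fin V.numStates, c.1 = q.castSucc ∧ c'.1 = q'.castSucc ∧ v = [] ∧
      V.Step (q, c.2) [] (q', c'.2)) ∨
    (∃ q : Fin V.numStates, c.1 = q.castSucc ∧ c'.1 = Fin.last _ ∧ v = [] ∧
      c'.2 ⟨0, hd⟩ = c.2 ⟨0, hd⟩) ∨
    (c.1 = Fin.last _ ∧ c'.1 = Fin.last _ ∧ ((v = [opn] ∧ c'.2 ⟨0, hd⟩ + 2 = c.2 ⟨0, hd⟩) ∨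
      v = [cls] ∧ c'.2 ⟨0, hd⟩ = c.2 ⟨0, hd⟩ + 1)) := by
  obtain ⟨t, ht, h1, h2, h3, h4⟩ := h
  rcases mem_spendingTransitions.1 ht with ⟨t', ht', rfl⟩ | ⟨q, rfl⟩ | rfl | rfl
  · exact Or.inl ⟨_, _, h1.symm, h2.symm, h3 ▸ hV.1 _ ht', t', ht', rfl, rfl, hV.1 _ ht', h4⟩
  · have := fires_addFirst hd h4
    exact Or.inr (Or.inl ⟨q, h1.symm, h2.symm, h3.symm, by omega⟩)
  · have := fires_addFirst hd h4
    exact Or.inr (Or.inr ⟨h1.symm, h2.symm, Or.inl ⟨h3.symm, by omega⟩⟩)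
  · have := fires_addFirst hd h4
    exact Or.inr (Or.inr ⟨h1.symm, h2.symm, Or.inr ⟨h3.symm, by omega⟩⟩)

/-- Every word of `V.withSpending` has a short prefix with a negative balance, if the first counter
of `V` is bounded. -/
theorem balance_neg_of_bounded (hV : V.IsResetVASS) (hd : 0 < V.dim) {k : ℕ}
    (hk : ∀ c : V.Config, V.Reachable c → c.2 ⟨0, hd⟩ ≤ k) {w : ℕ → Letter 1}
    (hw : w ∈ V.withSpending.language) : balance 0 ((List.range (2 * k + 1)).map w) < 0 := by
  obtain ⟨c, u, h0, hs, -, hu⟩ := hw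
  have hs' := fun i => withSpending_step_cases hV hd (hs i)
  have hlen : ∀ i, (u i).length ≤ 1 := by
    intro i
    rcases hs' i with ⟨q, q', -, -, h, -⟩ | ⟨q, -, -, h, -⟩ | ⟨-, -, ⟨h, -⟩ | ⟨h, -⟩⟩ <;> simp [h]
  -- Before the new state nothing is read. In it, the first counter pays two for each opening letter
  -- and gains one for each closing letter, starting from at most `k`.
  have hinv : ∀ i, (∃ q : Fin V.numStates, (c i).1 = q.castSucc ∧ V.Reachable (q, (c i).2) ∧
      (List.range i).flatMap u = []) ∨ ((c i).1 = Fin.last V.numStates ∧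
        2 * ((List.range i).flatMap u).count opn + (c i).2 ⟨0, hd⟩ ≤
          ((List.range i).flatMap u).count cls + k) := by
    intro i
    induction i with
    | zero => rw [h0]; exact Or.inl ⟨V.start, rfl, Relation.ReflTransGen.refl, rfl⟩
    | succ i ih =>
      rw [range_flatMap_succ]
      rcases ih with ⟨q, h1, h2, h3⟩ | ⟨h1, h2⟩
      · rcases hs' i with ⟨p, p', k1, k2, k3, k4⟩ | ⟨p, k1, k2, k3, k4⟩ | ⟨k1, -⟩
        · obtain rfl : q = p := Fin.castSucc_injective _ (h1.symm.trans k1)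
          exact Or.inl ⟨p', k2, h2.tail ⟨_, k4⟩, by simp [h3, k3]⟩
        · have := hk _ h2
          refine Or.inr ⟨k2, ?_⟩
          simp only [h3, k3, List.nil_append, List.count_nil]
          simp only at this
          omega
        · exact absurd (h1.symm.trans k1) (Fin.castSucc_ne_last _)
      · rcases hs' i with ⟨p, p', k1, -⟩ | ⟨p, k1, -⟩ | ⟨-, k2, k3⟩
        · exact absurd (k1.symm.trans h1) (Fin.castSucc_ne_last _)
        · exact absurd (k1.symm.trans h1) (Fin.castSucc_ne_last _)
        · refine Or.inr ⟨k2, ?_⟩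
          rcases k3 with ⟨k3, k4⟩ | ⟨k3, k4⟩ <;>
            simp only [k3, List.count_append, List.count_singleton] <;> simp <;> omega
  -- Labels have at most one letter, so a prefix of exactly this length is met.
  have hn : ((List.range (stepsFor u (2 * k + 1))).flatMap u).length = 2 * k + 1 := by
    have h1 := le_length_stepsFor hu (2 * k + 1)
    cases h : stepsFor u (2 * k + 1) with
    | zero => simp [h] at h1
    | succ i =>
      have h2 := (lt_stepsFor hu (i := i) (p := 2 * k + 1)).1 (by omega)
      have h3 := hlen i
      rw [h] at h1
      rw [range_flatMap_succ, List.length_append] at h1 ⊢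
      omega
  have h1 := hu.1 (stepsFor u (2 * k + 1))
  rw [hn] at h1
  rw [← h1]
  rcases hinv (stepsFor u (2 * k + 1)) with ⟨q, -, -, h2⟩ | ⟨-, h2⟩
  · rw [h2] at hn; simp at hn
  -- Adding this count to the invariant shows that there are at most `k` opening letters, hence at
  -- least `k + 1` closing ones.
  · have := count_opn_add_count_cls ((List.range (stepsFor u (2 * k + 1))).flatMap u)
    rw [balance_zero_eq]
    omega

/-- The configurations of `V` as configurations of `V.withSpending`. -/
def spendingConfig (c : V.Config) : V.withSpending.toTS.State := (c.1.castSucc, c.2)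

theorem reachable_withSpending (hV : V.IsResetVASS) {c : V.Config} (h : V.Reachable c) :
    ∃ l, SPath V.withSpending.toTS V.withSpending.toTS.start l (spendingConfig c) ∧ l.flatMap Prod.snd = [] := by
  induction h with
  | refl => exact ⟨[], rfl, rfl⟩
  | @tail c c' _ h ih =>
    obtain ⟨v, t, ht, h1, h2, h3, h4⟩ := h
    obtain ⟨l, h5, h6⟩ := ih
    refine ⟨l ++ [(spendingConfig c, [])],
      spath_append.2 ⟨_, h5, rfl, _, ?_, rfl⟩, by simp [h6]⟩
    exact ⟨t.lift, mem_spendingTransitions.2 (Or.inl ⟨t, ht, rfl⟩), congrArg Fin.castSucc h1, congrArg Fin.castSucc h2,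
      hV.1 t ht, h4⟩

theorem map_range_flatMap_singleton {α : Type} (w : ℕ → α) (n : ℕ) :
    (List.range n).flatMap (fun i => [w i]) = (List.range n).map w := by
  rw [← List.map_eq_flatMap]

theorem mem_language_withSpending (hV : V.IsResetVASS) (hd : 0 < V.dim) {c : V.Config}
    (hc : V.Reachable c) {w : ℕ → Letter 1} (hw : ∀ n, 2 * ((List.range n).map w).count opn ≤
      ((List.range n).map w).count cls + c.2 ⟨0, hd⟩) : w ∈ V.withSpending.language := by
  obtain ⟨l, h1, h2⟩ := reachable_withSpending hV hc
  -- The value that the first counter must have after `n` letters; `hw` says that the subtraction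
  -- does not truncate.
  let e : ℕ → V.withSpending.toTS.State := fun n => (Fin.last V.numStates, fun i => if i.val = 0 then
    ((List.range n).map w).count cls + c.2 ⟨0, hd⟩ - 2 * ((List.range n).map w).count opn else c.2 i)
  have he : ∀ n, V.withSpending.toTS.step (e n) [w n] (e (n + 1)) := by
    intro n
    have k1 := hw n
    have k2 := hw (n + 1)
    have k3 := map_range_succ_count w n opn
    have k4 := map_range_succ_count w n cls
    rcases letter_cases (w n) with hx | hx
    · refine ⟨⟨Fin.last _, addFirst (-2), [opn], Fin.last _⟩, mem_spendingTransitions.2 (by simp), rfl, rfl,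
        by rw [hx], fun i => ?_⟩
      rw [hx] at k3 k4
      rw [if_pos rfl] at k3
      rw [if_neg (by simp)] at k4
      by_cases hi : i.val = 0
      · simp only [e, if_pos hi]; omega
      · simp only [e, if_neg hi]; omega
    · refine ⟨⟨Fin.last _, addFirst 1, [cls], Fin.last _⟩, mem_spendingTransitions.2 (by simp), rfl, rfl,
        by rw [hx], fun i => ?_⟩
      rw [hx] at k3 k4
      rw [if_neg (by simp)] at k3
      rw [if_pos rfl] at k4
      by_cases hi : i.val = 0
      · simp only [e, if_pos hi]; omega
      · simp only [e, if_neg hi]; omega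
  have h3 : V.withSpending.toTS.step (spendingConfig c) [] (e 0) := by
    refine ⟨⟨c.1.castSucc, addFirst 0, [], Fin.last _⟩, mem_spendingTransitions.2 (by simp), rfl, rfl, rfl,
      fun i => ?_⟩
    by_cases hi : i.val = 0
    · obtain rfl : i = ⟨0, hd⟩ := Fin.ext hi
      simp [e, spendingConfig]
    · simp [e, spendingConfig, hi]
  refine mem_language_of_segments (S := V.withSpending.toTS)
    (d := fun n => if n = 0 then V.withSpending.toTS.start else e n)
    (l := fun n => if n = 0 then l ++ [(spendingConfig c, []), (e 0, [w 0])]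
      else [(e n, [w n])]) (if_pos rfl) (fun n => ?_) (fun n => ⟨(e n, [w n]), ?_, ?_⟩) ?_
  · rcases n.eq_zero_or_pos with rfl | hn
    · exact spath_append.2 ⟨_, h1, rfl, _, h3, rfl, _, he 0, rfl⟩
    · simpa only [if_neg hn.ne', if_neg (Nat.succ_ne_zero n)] using ⟨rfl, _, he n, rfl⟩
  · split_ifs with hn <;> simp [hn]
  · exact List.mem_singleton.2 rfl
  · have : (fun n => ((if n = 0 then l ++ [(spendingConfig c, []),
        (e 0, [w 0])] else [(e n, [w n])] :
          List (V.withSpending.toTS.State × List (Letter 1))).flatMap Prod.snd)) = fun n => [w n] := by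
      funext n
      split_ifs with hn
      · subst hn; simpa using h2
      · rfl
    have h4 := map_range_flatMap_singleton w
    refine (congrArg (fun u => IsInfiniteConcat u w) this).mpr ⟨fun n => ?_, fun N => ⟨N, ?_⟩⟩
    · rw [h4]; simp
    · rw [h4]; simp

/-! ### Regular separators, and the equivalence with place boundedness -/

/-- The transitions of an automaton for the words with a prefix of length `p` of negative balance. -/
noncomputable def negativeTransitions (p : ℕ) : List (Transition 2 0 (Letter 1)) :=
  [⟨1, addFirst 0, [opn], 1⟩, ⟨1, addFirst 0, [cls], 1⟩] ++
    (((Finset.univ : Finset (Fin p → Letter 1)).toList.map List.ofFn).filter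
      (fun v => balance 0 v < 0)).map fun v => ⟨0, addFirst 0, v, 1⟩

/-- The automaton for the words with a prefix of length `p` of negative balance. -/
noncomputable abbrev negativeAutomaton (p : ℕ) : BuchiResetVASS (Letter 1) where
  numStates := 2
  dim := 0
  start := 0
  transitions := negativeTransitions p
  finals := [1]

theorem mem_negativeTransitions {p : ℕ} {t : Transition 2 0 (Letter 1)} :
    t ∈ negativeTransitions p ↔ (∃ x, t = ⟨1, addFirst 0, [x], 1⟩) ∨
      ∃ v : List (Letter 1), v.length = p ∧ balance 0 v < 0 ∧ t = ⟨0, addFirst 0, v, 1⟩ := by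
  simp only [negativeTransitions, List.mem_append, List.mem_cons, List.not_mem_nil, or_false,
    List.mem_map, List.mem_filter, Finset.mem_toList, Finset.mem_univ, true_and, decide_eq_true_eq]
  refine or_congr ⟨?_, ?_⟩ ⟨?_, ?_⟩
  · rintro (rfl | rfl) <;> exact ⟨_, rfl⟩
  · rintro ⟨x, rfl⟩
    rcases letter_cases x with rfl | rfl <;> simp
  · rintro ⟨v, ⟨⟨g, rfl⟩, h⟩, rfl⟩
    exact ⟨_, List.length_ofFn, h, rfl⟩
  · rintro ⟨v, rfl, h, rfl⟩
    exact ⟨v, ⟨⟨v.get, List.ofFn_get v⟩, h⟩, rfl⟩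

theorem language_negativeAutomaton_inter_dyck (p : ℕ) :
    (negativeAutomaton p).language ∩ Dyck 1 = ∅ := by
  rw [Set.eq_empty_iff_forall_notMem]
  rintro w ⟨⟨c, u, h0, hs, -, hu⟩, hD⟩
  obtain ⟨t, ht, h1, -, h3, -⟩ := hs 0
  rw [h0] at h1
  rcases mem_negativeTransitions.1 ht with ⟨x, rfl⟩ | ⟨v, hv, hb, rfl⟩
  · exact absurd h1 (show ¬ (1 : Fin 2) = 0 by decide)
  · have h4 := hu.1 1
    have h5 : (List.range 1).flatMap u = v := by simp [← h3]
    rw [h5] at h4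
    have := hD v.length 0
    rw [← h4] at this
    omega

theorem mem_language_negativeAutomaton {p : ℕ} {w : ℕ → Letter 1}
    (h : balance 0 ((List.range p).map w) < 0) : w ∈ (negativeAutomaton p).language := by
  let u : ℕ → List (Letter 1) := fun n => if n = 0 then (List.range p).map w else [w (p + (n - 1))]
  have hu : ∀ n, (List.range (n + 1)).flatMap u = (List.range (p + n)).map w := by
    intro n
    induction n with
    | zero => simp [u]
    | succ n ih => rw [range_flatMap_succ, ih, ← add_assoc, List.range_succ]; simp [u]
  refine ⟨fun n => ((if n = 0 then 0 else 1 : Fin 2), fun _ => 0), u, rfl, fun n => ?_, ?_, fun n => ?_,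
    fun N => ⟨N + 1, ?_⟩⟩
  · rcases n.eq_zero_or_pos with rfl | hn
    · exact ⟨⟨0, addFirst 0, _, 1⟩, mem_negativeTransitions.2 (Or.inr ⟨_, by simp, h, rfl⟩), rfl, rfl,
        rfl, fun i => i.elim0⟩
    · refine ⟨⟨1, addFirst 0, _, 1⟩, mem_negativeTransitions.2 (Or.inl ⟨w (p + (n - 1)), rfl⟩), ?_, rfl,
        ?_, fun i => i.elim0⟩
      · simp [hn.ne']
      · simp [u, hn.ne']
  · refine (frequently_atTop.2 fun N => ⟨N + 1, by omega, ?_⟩)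
    exact List.mem_singleton.2 rfl
  · cases n with
    | zero => rfl
    | succ n => rw [hu]; simp
  · rw [hu]; simp

/-- A bound `k` forces a negative balance after `2 * k + 1` letters, which a Büchi automaton can
check. Without a bound, some reachable configuration has the `2 * N` units that `blockWord N` needs,
where `N` is the pumping constant of an alleged separator `B`; then `B` also accepts a Dyck word. -/
theorem placeBounded_iff (hV : V.IsResetVASS) (hd : 0 < V.dim) :
    V.PlaceBounded hd ↔ RegSeparable V.withSpending.language (Dyck 1) := by
  constructor
  · rintro ⟨k, hk⟩
    exact ⟨_, ⟨negativeAutomaton (2 * k + 1), rfl, rfl⟩,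
      fun w hw => mem_language_negativeAutomaton (balance_neg_of_bounded hV hd hk hw),
      language_negativeAutomaton_inter_dyck _⟩
  · rintro ⟨R, ⟨B, hB, rfl⟩, hR, hRD⟩
    by_contra hcon
    let ℓ := (B.transitions.map fun t => t.label.length).sum
    have : Fintype B.toTS.State := by
      have : IsEmpty (Fin B.dim) := by rw [hB]; infer_instance
      exact inferInstanceAs (Fintype (Fin B.numStates × (Fin B.dim → ℕ)))
    let N := (Fintype.card B.toTS.State + 1) * (ℓ + 1)
    have hN : 0 < N := Nat.mul_pos (Nat.succ_pos _) (Nat.succ_pos _)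
    obtain ⟨c, hc, hcN⟩ : ∃ c : V.Config, V.Reachable c ∧ 2 * N ≤ c.2 ⟨0, hd⟩ := by
      by_contra h
      push Not at h
      exact hcon ⟨2 * N, fun c hc => (h c hc).le⟩
    have hw : blockWord N ∈ B.language := hR (mem_language_withSpending hV hd hc fun n =>
      (blockWord_balance hN n).trans (Nat.add_le_add_left hcN _))
    obtain ⟨x, hx⟩ := inter_dyck_nonempty (S := B.toTS) (ℓ := ℓ) (N := N) le_rfl
      (by
        rintro c v c' ⟨t, ht, -, -, rfl, -⟩
        exact List.single_le_sum (by simp) _ (List.mem_map.2 ⟨t, ht, rfl⟩))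
      hw (fun p hp => by simpa using blockWord_block hN 0 p hp)
      (fun M => ⟨3 * N * M, Nat.le_mul_of_pos_left _ (by omega), fun k hk => blockWord_block hN M k hk⟩)
    exact (Set.eq_empty_iff_forall_notMem.1 hRD x) hx

/-- The code of `V.withSpending` in terms of the code of `V`. -/
def spendingCode (c : VASSCode (Letter 1)) : VASSCode (Letter 1) :=
  (c.1 + 1, c.2.1, c.2.2.1, c.2.2.2.1 ++ ((List.range c.1).map (fun q =>
      (q, Sum.inl ((List.range c.2.1).map fun _ => (0, 0)), [], c.1)) ++
    [(c.1, Sum.inl ((List.range c.2.1).map fun i => if i = 0 then (0, 2) else (0, 0)), [opn], c.1),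
     (c.1, Sum.inl ((List.range c.2.1).map fun i => if i = 0 then (1, 0) else (0, 0)), [cls], c.1)]),
    [c.1])

theorem primrec_spendingCode : Primrec spendingCode := by
  unfold spendingCode
  fun_prop

theorem opCode_addFirst (d : ℕ) (k : ℤ) : opCode (addFirst k : (Fin d → ℤ) ⊕ Fin d) =
    Sum.inl ((List.range d).map fun i => if i = 0 then (k.toNat, (-k).toNat) else (0, 0)) := by
  simp only [opCode, addFirst]
  congr 1
  refine List.ext_getElem (by simp) fun i h1 h2 => ?_
  simp only [List.getElem_ofFn, List.getElem_map, List.getElem_range]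
  split_ifs <;> simp

theorem code_withSpending (V : BuchiResetVASS (Letter 1)) :
    spendingCode V.code = V.withSpending.code := by
  simp only [spendingCode, BuchiResetVASS.code, spendingTransitions, List.map_append, List.map_map,
    List.map_cons, List.map_nil]
  refine Prod.ext rfl (Prod.ext rfl (Prod.ext rfl (Prod.ext ?_ rfl)))
  dsimp only
  congr 1
  congr 1
  · rw [← List.map_coe_finRange_eq_range (n := V.numStates), List.map_map]
    refine List.map_congr_left fun q _ => ?_
    simp [Transition.code, opCode_addFirst]
  · simp [Transition.code, opCode_addFirst]

theorem placeBounded_reducesTo :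
    ReducesTo (fun V : ResetVASS => V.1.code) (fun V => V.1.PlaceBounded V.2.2)
      (fun V : WeakBRVASS (Letter 1) => V.1.code)
      (fun V => RegSeparable V.1.language (Dyck 1)) :=
  ⟨spendingCode, primrec_spendingCode.to_comp, fun V =>
    ⟨⟨V.1.withSpending, isWeak_withSpending⟩, code_withSpending V.1, placeBounded_iff V.2.1 V.2.2⟩⟩

end Spending

/-! ## The Dyck language is the language of a system with one counter -/

/-- The transitions of a system with one counter for the Dyck language. -/
def dyckTransitions : List (Transition 1 1 (Letter 1)) :=
  [⟨0, addFirst 1, [opn], 0⟩, ⟨0, addFirst (-1), [cls], 0⟩]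

theorem mem_dyckTransitions {t : Transition 1 1 (Letter 1)} : t ∈ dyckTransitions ↔
    t = ⟨0, addFirst 1, [opn], 0⟩ ∨ t = ⟨0, addFirst (-1), [cls], 0⟩ := by
  simp [dyckTransitions]

/-- A system with one counter for the Dyck language. -/
abbrev dyckVASS : BuchiResetVASS (Letter 1) where
  numStates := 1
  dim := 1
  start := 0
  transitions := dyckTransitions
  finals := [0]

theorem isWeak_dyckVASS : dyckVASS.IsWeak := by
  intro q _ t ht hr
  rcases mem_dyckTransitions.1 ht with rfl | rfl <;> cases hr

theorem dyckVASS_step {c c' : dyckVASS.Config} {x : Letter 1} :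
    dyckVASS.Step c [x] c' ↔ (c'.2 0 : ℤ) = c.2 0 + balance 0 [x] := by
  constructor
  · rintro ⟨t, ht, -, -, h3, h4⟩
    rcases mem_dyckTransitions.1 ht with rfl | rfl <;> obtain rfl := List.singleton_injective h3 <;>
      exact fires_addFirst Nat.one_pos h4
  · intro h
    rcases letter_cases x with rfl | rfl
    · refine ⟨⟨0, addFirst 1, [opn], 0⟩, mem_dyckTransitions.2 (by simp), Subsingleton.elim (α := Fin 1) _ _,
        Subsingleton.elim (α := Fin 1) _ _, rfl, fun i => ?_⟩
      rw [Subsingleton.elim (α := Fin 1) i 0, h]; rfl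
    · refine ⟨⟨0, addFirst (-1), [cls], 0⟩, mem_dyckTransitions.2 (by simp), Subsingleton.elim (α := Fin 1) _ _,
        Subsingleton.elim (α := Fin 1) _ _, rfl, fun i => ?_⟩
      rw [Subsingleton.elim (α := Fin 1) i 0, h]; rfl

/-- The counter always equals the balance of the word read so far, so a run exists as long as that
balance is nonnegative. -/
theorem language_dyckVASS : dyckVASS.language = Dyck 1 := by
  ext w
  constructor
  · rintro ⟨c, u, h0, hs, -, hu⟩
    have hlab : ∀ i, ∃ x, u i = [x] := by
      intro i
      obtain ⟨t, ht, -, -, h3, -⟩ := hs i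
      rcases mem_dyckTransitions.1 ht with rfl | rfl <;> exact ⟨_, h3.symm⟩
    choose x hx using hlab
    obtain rfl : u = fun i => [x i] := funext hx
    obtain rfl : x = w := by
      funext k
      have := hu.1 (k + 1)
      rw [map_range_flatMap_singleton] at this
      have := eq_map_range_iff.1 this k (by simp)
      simpa using this
    intro k i
    rw [Subsingleton.elim i 0]
    have : ∀ k, ((c k).2 (0 : Fin 1) : ℤ) = balance 0 ((List.range k).map x) := by
      intro k
      induction k with
      | zero => rw [h0]; rfl
      | succ k ih =>
        rw [List.range_succ, List.map_append, balance_append, ← ih]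
        exact dyckVASS_step.1 (hs k)
    rw [← this]
    exact Int.natCast_nonneg _
  · intro hw
    refine ⟨fun k => ((0 : Fin 1), fun _ => (balance 0 ((List.range k).map w)).toNat), fun k => [w k], rfl,
      fun k => dyckVASS_step.2 ?_, (frequently_atTop.2 fun N => ⟨N, le_rfl, List.mem_singleton.2 rfl⟩),
      fun n => ?_, fun N => ⟨N, ?_⟩⟩
    · have h1 := hw k 0
      have h2 := hw (k + 1) 0
      simp only
      rw [Int.toNat_of_nonneg h1, Int.toNat_of_nonneg h2, List.range_succ, List.map_append,
        balance_append]
      rfl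
    · rw [map_range_flatMap_singleton]; simp
    · rw [map_range_flatMap_singleton]; simp

/-! ## Programs over registers -/

/-- Programs over registers with natural numbers. `loop i p` decrements register `i` and runs `p` as
long as register `i` is positive. -/
inductive Prog : Type
  | skip : Prog
  | inc (i : ℕ) : Prog
  | seq (p q : Prog) : Prog
  | loop (i : ℕ) (p : Prog) : Prog

/-- The steps of a stack of programs. -/
inductive PStep : List Prog × (ℕ → ℕ) → List Prog × (ℕ → ℕ) → Prop
  | skip (K s) : PStep (.skip :: K, s) (K, s)
  | inc (i K s) : PStep (.inc i :: K, s) (K, Function.update s i (s i + 1))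
  | seq (p q K s) : PStep (.seq p q :: K, s) (p :: q :: K, s)
  | loop_zero (i p K s) (h : s i = 0) : PStep (.loop i p :: K, s) (K, s)
  | loop_succ (i p K s n) (h : s i = n + 1) :
      PStep (.loop i p :: K, s) (p :: .loop i p :: K, Function.update s i n)

/-- Sequences of steps. -/
abbrev PSteps : List Prog × (ℕ → ℕ) → List Prog × (ℕ → ℕ) → Prop := Relation.ReflTransGen PStep

theorem PStep.deterministic {a b c : List Prog × (ℕ → ℕ)} (h : PStep a b) (h' : PStep a c) :
    b = c := by
  cases h <;> cases h' <;> first | rfl | skip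
  · simp_all
  · simp_all
  · simp_all

/-- The program `p`, started in `s`, ends in `t`. -/
def Exec (p : Prog) (s t : ℕ → ℕ) : Prop := ∀ K, PSteps (p :: K, s) (K, t)

namespace Exec

variable {p q : Prog} {s t r : ℕ → ℕ} {i : ℕ}

theorem skip (s : ℕ → ℕ) : Exec .skip s s := fun K => .single (.skip K s)

theorem inc (i : ℕ) (s : ℕ → ℕ) : Exec (.inc i) s (Function.update s i (s i + 1)) :=
  fun K => .single (.inc i K s)

theorem seq (h : Exec p s t) (h' : Exec q t r) : Exec (.seq p q) s r :=
  fun K => .head (.seq p q K s) ((h _).trans (h' _))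

theorem loop_zero (h : s i = 0) : Exec (.loop i p) s s := fun K => .single (.loop_zero i p K s h)

theorem loop_succ {n : ℕ} (hn : s i = n + 1) (h : Exec p (Function.update s i n) t)
    (h' : Exec (.loop i p) t r) : Exec (.loop i p) s r :=
  fun K => .head (.loop_succ i p K s n hn) ((h _).trans (h' _))

/-- `I n` is the loop invariant when `n` rounds remain. -/
theorem loop_inv {I : ℕ → (ℕ → ℕ) → Prop} (h0 : ∀ s, I 0 s → s i = 0)
    (h1 : ∀ n s, I (n + 1) s → s i = n + 1 ∧ ∃ t, Exec p (Function.update s i n) t ∧ I n t)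
    {n : ℕ} (hs : I n s) : ∃ t, Exec (.loop i p) s t ∧ I 0 t := by
  induction n generalizing s with
  | zero => exact ⟨s, loop_zero (h0 s hs), hs⟩
  | succ n ih =>
    obtain ⟨h2, t, h3, h4⟩ := h1 n s hs
    obtain ⟨r, h5, h6⟩ := ih h4
    exact ⟨r, loop_succ h2 h3 h5, h6⟩

theorem clear (i : ℕ) (s : ℕ → ℕ) : Exec (.loop i .skip) s (Function.update s i 0) := by
  obtain ⟨t, h1, h2⟩ := loop_inv (p := .skip) (i := i) (s := s) (n := s i)
    (I := fun n t => t = Function.update s i n) (by rintro _ rfl; simp)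
    (by rintro n _ rfl; exact ⟨by simp, _, skip _, by simp⟩) (by simp)
  rwa [h2] at h1

/-- Move the contents of register `i` to register `j`. -/
theorem move {i j : ℕ} (hij : i ≠ j) (s : ℕ → ℕ) : ∃ t, Exec (.loop i (.inc j)) s t ∧
    t i = 0 ∧ t j = s j + s i ∧ ∀ k, k ≠ i → k ≠ j → t k = s k := by
  obtain ⟨t, h1, h2, h3, h4⟩ := loop_inv (p := .inc j) (i := i) (s := s) (n := s i)
    (I := fun n t => t i = n ∧ t j + n = s j + s i ∧ ∀ k, k ≠ i → k ≠ j → t k = s k)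
    (fun _ h => h.1) (fun n t ⟨h1, h2, h3⟩ => ⟨h1, _, inc _ _, by simp [hij], by
      simp [hij.symm]; omega, fun k hk hk' => by simp [hk, hk', h3]⟩) (by simp)
  exact ⟨t, h1, h2, h3, h4⟩

/-- Add the contents of register `i` to register `j`, with help of register `k`. -/
def _root_.RegSep.Prog.copy (i j k : ℕ) : Prog :=
  .seq (.loop i (.inc k)) (.loop k (.seq (.inc i) (.inc j)))

theorem copy {i j k : ℕ} (hij : i ≠ j) (hik : i ≠ k) (hjk : j ≠ k) (s : ℕ → ℕ) (hk : s k = 0) :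
    Exec (.copy i j k) s
      (Function.update s j (s j + s i)) := by
  obtain ⟨t, h1, h2, h3, h4⟩ := move hik s
  obtain ⟨r, k1, k2, k3, k4, k5⟩ := loop_inv (p := .seq (.inc i) (.inc j)) (i := k) (s := t) (n := t k)
    (I := fun n r => r k = n ∧ r i + n = s i ∧ r j + n = s j + s i ∧
      ∀ l, l ≠ i → l ≠ j → l ≠ k → r l = s l)
    (fun _ h => h.1) (fun n r ⟨h1, h2, h3, h4⟩ => ⟨h1, _, seq (inc _ _) (inc _ _), by
      simp [hik.symm, hjk.symm], by simp [hij, hik]; omega, by simp [hij.symm, hjk]; omega,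
        fun l hl hl' hl'' => by simp [hl, hl', hl'', h4]⟩)
      ⟨rfl, by omega, by rw [h4 j hij.symm hjk]; omega, fun l hl _ hl'' => h4 l hl hl''⟩
  have : r = Function.update s j (s j + s i) := by
    funext l
    by_cases hlj : l = j
    · subst hlj; simpa using k4
    rw [Function.update_of_ne hlj]
    by_cases hlk : l = k
    · subst hlk; omega
    by_cases hli : l = i
    · subst hli; simpa using k3
    · exact k5 l hli hlj hlk
  exact this ▸ seq h1 k1

end Exec

/-! ### Programs for primitive recursive functions -/

/-- For all choices of registers below `base` for the arguments and for the result, some program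
adds the value of `f` to the result; the registers from `base` on are scratch registers. -/
def Programmable {n : ℕ} (f : List.Vector ℕ n → ℕ) : Prop :=
  ∀ (ins : Fin n → ℕ) (out base : ℕ), (∀ i, ins i < base) → out < base → (∀ i, ins i ≠ out) →
    ∃ p, ∀ s : ℕ → ℕ, (∀ j, base ≤ j → s j = 0) →
      Exec p s (Function.update s out (s out + f (List.Vector.ofFn fun i => s (ins i))))

/-- The values are computed one after the other into the registers from `base` on; each program
takes its scratch registers behind those already filled. -/
theorem programmable_tuple {m n : ℕ} {g : Fin n → List.Vector ℕ m → ℕ}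
    (hg : ∀ i, Programmable (g i)) (ins : Fin m → ℕ) (base : ℕ) (hi : ∀ i, ins i < base) (k : ℕ)
    (hk : k ≤ n) : ∃ p, ∀ s : ℕ → ℕ, (∀ j, base ≤ j → s j = 0) → ∃ t, Exec p s t ∧
      (∀ j, j < base ∨ base + k ≤ j → t j = s j) ∧ ∀ i : Fin n, i.val < k →
        t (base + i) = g i (List.Vector.ofFn fun i => s (ins i)) := by
  induction k with
  | zero => exact ⟨.skip, fun s hs => ⟨s, Exec.skip s, fun _ _ => rfl, fun i hi => by omega⟩⟩
  | succ k ih =>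
    obtain ⟨p, hp⟩ := ih (by omega)
    obtain ⟨q, hq⟩ := hg ⟨k, hk⟩ ins (base + k) (base + k + 1) (fun i => by have := hi i; omega)
      (by omega) (fun i => by have := hi i; omega)
    refine ⟨.seq p q, fun s hs => ?_⟩
    obtain ⟨t, h1, h2, h3⟩ := hp s hs
    have h4 : (fun i => t (ins i)) = fun i => s (ins i) := funext fun i => h2 _ (Or.inl (hi i))
    have h5 := hq t fun j hj => (h2 j (by omega)).trans (hs j (by omega))
    rw [h4, h2 (base + k) (by omega), hs _ (by omega), zero_add] at h5
    refine ⟨_, h1.seq h5, fun j hj => ?_, fun i hi' => ?_⟩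
    · rw [Function.update_of_ne (by omega)]; exact h2 j (by omega)
    · by_cases hik : i.val = k
      · obtain rfl : i = ⟨k, hk⟩ := Fin.ext hik
        simp
      · rw [Function.update_of_ne (by omega)]; exact h3 i (by omega)

/-- A program that clears `k` registers from `base` on. -/
def clearFrom (base : ℕ) : ℕ → Prog
  | 0 => .skip
  | k + 1 => .seq (clearFrom base k) (.loop (base + k) .skip)

theorem exec_clearFrom (base k : ℕ) (s : ℕ → ℕ) :
    Exec (clearFrom base k) s fun j => if base ≤ j ∧ j < base + k then 0 else s j := by
  induction k with
  | zero =>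
    have : (fun j => if base ≤ j ∧ j < base + 0 then 0 else s j) = s := by
      funext j; rw [if_neg (by omega)]
    exact this.symm ▸ Exec.skip s
  | succ k ih =>
    refine (congrArg (Exec _ s) ?_).mpr (ih.seq (Exec.clear (base + k) _))
    funext j
    by_cases hj : j = base + k
    · subst hj; simp
    · rw [Function.update_of_ne hj]
      split_ifs <;> first | rfl | omega

/-- `Programmable` leaves all registers but the result unchanged. In particular the scratch
registers end empty, which is what lets programs be composed and iterated. -/
theorem programmable_of_primrec' {n : ℕ} {f : List.Vector ℕ n → ℕ} (hf : Nat.Primrec' f) :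
    Programmable f := by
  induction hf with
  | zero => exact fun _ _ _ _ _ _ => ⟨.skip, fun s _ => by simpa using Exec.skip s⟩
  | succ =>
    intro ins out base hi ho hne
    refine ⟨.seq (.copy (ins 0) out base) (.inc out), fun s hs => ?_⟩
    have h := (Exec.copy (k := base) (hne 0) (hi 0).ne ho.ne s (hs _ le_rfl)).seq (Exec.inc out _)
    refine (congrArg (Exec _ s) ?_).mpr h
    simp [List.Vector.ofFn, add_assoc]
  | get i =>
    intro ins out base hi ho hne
    refine ⟨.copy (ins i) out base, fun s hs => ?_⟩
    have h := Exec.copy (k := base) (hne i) (hi i).ne ho.ne s (hs _ le_rfl)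
    simpa using h
  | @comp m n f g _ _ ihf ihg =>
    intro ins out base hi ho hne
    obtain ⟨p, hp⟩ := programmable_tuple ihg ins base hi n le_rfl
    obtain ⟨q, hq⟩ := ihf (fun i => base + i) out (base + n) (fun i => by omega) (by omega)
      (fun i => by omega)
    refine ⟨.seq p (.seq q (clearFrom base n)), fun s hs => ?_⟩
    obtain ⟨t, h1, h2, h3⟩ := hp s hs
    have h4 := hq t fun j hj => (h2 j (by omega)).trans (hs j (by omega))
    have h5 : (fun i : Fin n => t (base + i)) = fun i => g i (List.Vector.ofFn fun i => s (ins i)) :=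
      funext fun i => h3 i i.2
    rw [h5, h2 out (by omega)] at h4
    refine (congrArg (Exec _ s) ?_).mpr (h1.seq (h4.seq (exec_clearFrom base n _)))
    funext j
    by_cases hj : j = out
    · subst hj; rw [if_neg (by omega)]; simp
    · rw [Function.update_of_ne hj, Function.update_of_ne hj]
      split_ifs with h
      · exact hs j h.1
      · exact (h2 j (by omega)).symm
  | @prec n f g _ _ ihf ihg =>
    intro ins out base hi ho hne
    obtain ⟨p, hp⟩ := ihf (fun i => ins i.succ) base (base + 4) (fun i => by have := hi i.succ; omega)
      (by omega) (fun i => by have := hi i.succ; omega)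
    obtain ⟨q, hq⟩ := ihg (Fin.cons (base + 1) (Fin.cons base fun i => ins i.succ)) (base + 3)
      (base + 4) (by
        refine Fin.cases (by simp) (Fin.cases (by simp) fun i => ?_)
        have := hi i.succ; simp; omega) (by omega) (by
        refine Fin.cases (by simp) (Fin.cases (by simp) fun i => ?_)
        have := hi i.succ; simp; omega)
    -- Register `base` holds the value reached so far, `base + 1` the recursion index, `base + 2`
    -- the number of rounds left, and `base + 3` receives the next value.
    let body : Prog := .seq q (.seq (.loop base .skip) (.seq (.loop (base + 3) (.inc base))
      (.inc (base + 1))))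
    refine ⟨.seq p (.seq (.copy (ins 0) (base + 2) (base + 3)) (.seq (.loop (base + 2) body) (.seq (.loop base (.inc out))
        (.loop (base + 1) .skip)))), fun s hs => ?_⟩
    have hi0 := hi 0
    have hno := hne 0
    set v : List.Vector ℕ n := List.Vector.ofFn fun i => s (ins i.succ) with hv
    have h1 := hp s fun j hj => hs j (by omega)
    rw [hs base le_rfl, zero_add, ← hv] at h1
    have h2 := Exec.copy (i := ins 0) (j := base + 2) (k := base + 3) (by omega) (by omega) (by omega)
      (Function.update s base (f v)) (by rw [Function.update_of_ne (by omega)]; exact hs _ (by omega))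
    rw [Function.update_of_ne (by omega), Function.update_of_ne (by omega), hs (base + 2) (by omega),
      zero_add] at h2
    let F : ℕ → ℕ := fun y => Nat.rec (f v) (fun y IH => g (y ::ᵥ IH ::ᵥ v)) y
    obtain ⟨t, h3, h4, h5, h6, h7⟩ := Exec.loop_inv (p := body) (i := base + 2) (n := s (ins 0))
      (s := Function.update (Function.update s base (f v)) (base + 2) (s (ins 0)))
      (I := fun n t => t (base + 2) = n ∧ t (base + 1) + n = s (ins 0) ∧ t base = F (t (base + 1)) ∧
        ∀ j, j ≠ base → j ≠ base + 1 → j ≠ base + 2 → t j = s j)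
      (fun _ h => h.1) (by
        rintro y t ⟨h1, h2, h3, h4⟩
        refine ⟨h1, ?_⟩
        have e1 := hq (Function.update t (base + 2) y) fun j hj => by
          rw [Function.update_of_ne (by omega), h4 j (by omega) (by omega) (by omega)]
          exact hs j (by omega)
        have e2 : (List.Vector.ofFn fun i : Fin (n + 2) => Function.update t (base + 2) y
            ((Fin.cons (base + 1) (Fin.cons base fun i => ins i.succ) : Fin (n + 2) → ℕ) i)) =
            t (base + 1) ::ᵥ t base ::ᵥ v := by
          have e3 : ∀ i : Fin n, Function.update t (base + 2) y (ins i.succ) = s (ins i.succ) := by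
            intro i
            have := hi i.succ
            rw [Function.update_of_ne (by omega), h4 _ (by omega) (by omega) (by omega)]
          simp [List.Vector.ofFn, e3, hv]
        rw [e2, Function.update_of_ne (by omega), h4 (base + 3) (by omega) (by omega) (by omega),
          hs _ (by omega), zero_add] at e1
        have e3 := Exec.clear base (Function.update (Function.update t (base + 2) y) (base + 3)
          (g (t (base + 1) ::ᵥ t base ::ᵥ v)))
        obtain ⟨r, k1, k2, k3, k4⟩ := Exec.move (i := base + 3) (j := base) (by omega)
          (Function.update (Function.update (Function.update t (base + 2) y) (base + 3)
          (g (t (base + 1) ::ᵥ t base ::ᵥ v))) base 0)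
        refine ⟨_, e1.seq (e3.seq (k1.seq (Exec.inc (base + 1) r))), ?_, ?_, ?_, fun j hj hj1 hj2 => ?_⟩
        · rw [Function.update_of_ne (by omega), k4 _ (by omega) (by omega)]
          simp
        · rw [Function.update_self, k4 _ (by omega) (by omega)]
          simp
          omega
        · rw [Function.update_self, Function.update_of_ne (by omega), k3, k4 _ (by omega) (by omega)]
          simp [h3, F]
        · rw [Function.update_of_ne hj1]
          by_cases hj3 : j = base + 3
          · subst hj3; rw [k2, hs _ (by omega)]
          · rw [k4 j hj3 hj]
            simp [hj, hj2, hj3, h4 j hj hj1 hj2])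
      ⟨by simp, by
        rw [Function.update_of_ne (by omega), Function.update_of_ne (by omega), hs _ (by omega), zero_add],
        by
          rw [Function.update_of_ne (by omega), Function.update_self, Function.update_of_ne (by omega),
            Function.update_of_ne (by omega), hs (base + 1) (by omega)]
          rfl,
        fun j hj _ hj' => by rw [Function.update_of_ne hj', Function.update_of_ne hj]⟩
    obtain ⟨r, k1, k2, k3, k4⟩ := Exec.move (i := base) (j := out) (by omega) t
    have k5 := Exec.clear (base + 1) r
    refine (congrArg (Exec _ s) ?_).mpr (h1.seq (h2.seq (h3.seq (k1.seq k5))))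
    have e : F (t (base + 1)) = Nat.rec (f v) (fun y IH => g (y ::ᵥ IH ::ᵥ v)) (s (ins 0)) := by
      rw [← h5, add_zero]
    funext j
    by_cases hj : j = out
    · subst hj
      rw [Function.update_self, Function.update_of_ne (by omega), k3, h7 _ (by omega) (by omega) (by omega),
        h6, e]
      rfl
    rw [Function.update_of_ne hj]
    by_cases hj1 : j = base + 1
    · subst hj1; rw [Function.update_self, hs _ (by omega)]
    rw [Function.update_of_ne hj1]
    by_cases hj0 : j = base
    · subst hj0; rw [k2, hs _ le_rfl]
    rw [k4 j hj0 hj]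
    by_cases hj2 : j = base + 2
    · subst hj2; rw [h4, hs _ (by omega)]
    · exact (h7 j hj0 hj1 hj2).symm

/-! ### Search programs -/

/-- The run of a deterministic system that reaches a configuration without a successor is bounded. -/
theorem bounded_of_terminates {α : Type} {R : α → α → Prop} (hR : ∀ a b c, R a b → R a c → b = c)
    {a b : α} (h : Relation.ReflTransGen R a b) (hb : ∀ c, ¬ R b c) (g : α → ℕ) :
    ∃ S, ∀ c, Relation.ReflTransGen R a c → g c ≤ S := by
  induction h using Relation.ReflTransGen.head_induction_on with
  | refl =>
    refine ⟨g b, fun c hc => ?_⟩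
    rcases hc.cases_head with rfl | ⟨d, h, -⟩
    · exact le_rfl
    · exact absurd h (hb d)
  | @head a a' h1 _ ih =>
    obtain ⟨S, hS⟩ := ih
    refine ⟨max (g a) S, fun c hc => ?_⟩
    rcases hc.cases_head with rfl | ⟨d, h, h'⟩
    · exact le_max_left _ _
    · obtain rfl := hR _ _ _ h1 h
      exact (hS c h').trans (le_max_right _ _)

/-- Valuations with `x` in register `0`. -/
def inputVal (x : ℕ) : ℕ → ℕ := fun j => if j = 0 then x else 0

/-- Some program searches for a zero of `T x`; its run is bounded if the search succeeds, and its
registers are unbounded otherwise. -/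
theorem exists_search_program {T : ℕ → ℕ → ℕ} (hT : Primrec₂ T) (hT1 : ∀ x n, T x n ≤ 1) :
    ∃ p : Prog, ∀ x, ((∃ n, T x n = 0) → ∀ g : List Prog × (ℕ → ℕ) → ℕ, ∃ S, ∀ c,
        PSteps ([p], inputVal x) c → g c ≤ S) ∧
      ((¬ ∃ n, T x n = 0) → ∀ S, ∃ c, PSteps ([p], inputVal x) c ∧ S ≤ c.2 1) := by
  obtain ⟨q, hq⟩ := programmable_of_primrec' (Nat.Primrec'.prim_iff₂.2 hT) (fun i => i.val) 2 3
    (fun i => by omega) (by omega) (fun i => by omega)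
  -- Register `0` holds the input, `1` the candidate, `2` the last value of `T`. Entering the loop
  -- empties register `2`, since that value is at most `1`; the loop stops once it is `0`.
  let L : Prog := .loop 2 (.seq q (.inc 1))
  refine ⟨.seq (.inc 2) L, fun x => ?_⟩
  let st : ℕ → ℕ → ℕ → ℕ := fun n r j => if j = 0 then x else if j = 1 then n else if j = 2 then r else 0
  have hiter : ∀ n, PSteps ([L], st n 1) ([L], st (n + 1) (T x n)) := by
    intro n
    have e1 : Function.update (st n 1) 2 0 = st n 0 := by
      funext j; by_cases hj : j = 2 <;> simp [st, hj]
    have h1 := hq (st n 0) fun j hj => by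
      simp only [st]; rw [if_neg (by omega), if_neg (by omega), if_neg (by omega)]
    have e2 : Function.update (st n 0) 2 (T x n) = st n (T x n) := by
      funext j; by_cases hj : j = 2 <;> simp [st, hj]
    have e3 : Function.update (st n (T x n)) 1 (n + 1) = st (n + 1) (T x n) := by
      funext j; by_cases hj : j = 1 <;> simp [st, hj]
    have h2 : Exec q (st n 0) (st n (T x n)) := by
      rw [← e2]; simpa [st, List.Vector.ofFn] using h1
    have h3 : Exec (.inc 1) (st n (T x n)) (st (n + 1) (T x n)) := by
      rw [← e3]; exact Exec.inc 1 _
    have h4 := PStep.loop_succ 2 (.seq q (.inc 1)) [] (st n 1) 0 (by simp [st])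
    rw [e1] at h4
    exact .head h4 ((h2.seq h3) _)
  have hstart : PSteps ([.seq (.inc 2) L], inputVal x) ([L], st 0 1) := by
    refine .head (.seq _ _ _ _) (.single ?_)
    have e1 : Function.update (inputVal x) 2 (inputVal x 2 + 1) = st 0 1 := by
      funext j
      by_cases hj : j = 2
      · subst hj; simp [st, inputVal]
      · simp [st, inputVal, hj]
    exact e1 ▸ PStep.inc 2 [L] (inputVal x)
  have hrun : ∀ n, (∀ m < n, T x m ≠ 0) → PSteps ([.seq (.inc 2) L], inputVal x) ([L], st n 1) := by
    intro n
    induction n with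
    | zero => exact fun _ => hstart
    | succ n ih =>
      intro h
      have h1 : T x n = 1 := by
        have := h n (by omega)
        have := hT1 x n
        omega
      have h2 := hiter n
      rw [h1] at h2
      exact (ih fun m hm => h m (by omega)).trans h2
  constructor
  · intro h g
    classical
    have h1 := hrun (Nat.find h) fun m hm => Nat.find_min h hm
    have h2 := hiter (Nat.find h)
    rw [Nat.find_spec h] at h2
    refine bounded_of_terminates (R := PStep) (fun _ _ _ => PStep.deterministic) (b := ([], st (Nat.find h + 1) 0))
      (h1.trans (h2.trans (.single (.loop_zero 2 _ [] _ (by simp [st]))))) ?_ g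
    rintro c ⟨⟩
  · intro h S
    push Not at h
    exact ⟨_, hrun S fun m _ => h m, by simp [st]⟩

/-! ## Reset VASS from lists of labelled edges -/

section Graph

variable {σ : Type} {d : ℕ}

open Classical in
/-- The number of a node. -/
noncomputable def nodeIndex (N : List σ) (hN : 0 < N.length) (q : σ) : Fin N.length :=
  if h : q ∈ N then ⟨N.idxOf q, List.idxOf_lt_length_iff.2 h⟩ else ⟨0, hN⟩

theorem nodeIndex_inj {N : List σ} {hN : 0 < N.length} {p q : σ} (hp : p ∈ N) (hq : q ∈ N)
    (h : nodeIndex N hN p = nodeIndex N hN q) : p = q := by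
  classical
  simp only [nodeIndex, dif_pos hp, dif_pos hq, Fin.mk.injEq] at h
  convert (List.idxOf_inj hp).1 (by convert h)

/-- Edges that carry an operation on `d` counters. -/
abbrev OpEdge (σ : Type) (d : ℕ) : Type := σ × ((Fin d → ℤ) ⊕ Fin d) × σ

/-- An edge as a transition between node numbers. -/
noncomputable def OpEdge.toTransition (N : List σ) (hN : 0 < N.length) (e : OpEdge σ d) :
    Transition N.length d (Letter 1) :=
  ⟨nodeIndex N hN e.1, e.2.1, [], nodeIndex N hN e.2.2⟩

/-- The reset VASS with nodes `N` and edges `E`. -/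
noncomputable abbrev graphVASS (N : List σ) (hN : 0 < N.length) (start : σ) (E : List (OpEdge σ d)) :
    BuchiResetVASS (Letter 1) where
  numStates := N.length
  dim := d
  start := nodeIndex N hN start
  transitions := E.map (OpEdge.toTransition N hN)
  finals := []

/-- The steps along the edges `E`. -/
def GStep (E : List (OpEdge σ d)) (c c' : σ × (Fin d → ℕ)) : Prop :=
  ∃ e ∈ E, e.1 = c.1 ∧ e.2.2 = c'.1 ∧ Fires e.2.1 c.2 c'.2

theorem isResetVASS_graphVASS (N : List σ) (hN : 0 < N.length) (start : σ) (E : List (OpEdge σ d)) :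
    (graphVASS N hN start E).IsResetVASS := by
  refine ⟨fun t ht => ?_, rfl⟩
  obtain ⟨e, -, rfl⟩ := List.mem_map.1 ht
  rfl

theorem placeBounded_graphVASS {N : List σ} (hN : 0 < N.length) {start : σ} {E : List (OpEdge σ d)}
    (hs : start ∈ N) (hE : ∀ e ∈ E, e.1 ∈ N ∧ e.2.2 ∈ N) (hd : 0 < d) :
    (graphVASS N hN start E).PlaceBounded hd ↔
      ∃ k, ∀ c, Relation.ReflTransGen (GStep E) (start, fun _ => 0) c → c.2 ⟨0, hd⟩ ≤ k := by
  have h1 : ∀ c : (graphVASS N hN start E).Config, (graphVASS N hN start E).Reachable c →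
      ∃ q ∈ N, nodeIndex N hN q = c.1 ∧
        Relation.ReflTransGen (GStep E) (start, fun _ => 0) (q, c.2) := by
    intro c hc
    induction hc with
    | refl => exact ⟨start, hs, rfl, .refl⟩
    | tail _ h ih =>
      obtain ⟨q, hq, h1, h2⟩ := ih
      obtain ⟨v, t, ht, h3, h4, -, h5⟩ := h
      obtain ⟨e, he, rfl⟩ := List.mem_map.1 ht
      have := nodeIndex_inj (hE e he).1 hq (h3.trans h1.symm)
      exact ⟨e.2.2, (hE e he).2, h4, h2.tail ⟨e, he, this, rfl, h5⟩⟩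
  have h2 : ∀ c, Relation.ReflTransGen (GStep E) (start, fun _ => 0) c →
      (graphVASS N hN start E).Reachable (nodeIndex N hN c.1, c.2) := by
    intro c hc
    induction hc with
    | refl => exact .refl
    | tail _ h ih =>
      obtain ⟨e, he, h3, h4, h5⟩ := h
      exact ih.tail ⟨[], _, List.mem_map.2 ⟨e, he, rfl⟩, congrArg (nodeIndex N hN) h3, congrArg (nodeIndex N hN) h4, rfl, h5⟩
  constructor
  · rintro ⟨k, hk⟩
    exact ⟨k, fun c hc => hk _ (h2 c hc)⟩
  · rintro ⟨k, hk⟩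
    refine ⟨k, fun c hc => ?_⟩
    obtain ⟨q, -, -, h⟩ := h1 c hc
    exact hk _ h

end Graph

/-! ## Stacks that occur in the run of a program -/

/-- The stacks that occur while `p` runs on top of `K`. -/
def Prog.frames : Prog → List Prog → List (List Prog)
  | .skip, K => [.skip :: K]
  | .inc i, K => [.inc i :: K]
  | .seq p q, K => (.seq p q :: K) :: (p.frames (q :: K) ++ q.frames K)
  | .loop i p, K => (.loop i p :: K) :: p.frames (.loop i p :: K)

/-- A bound on the registers of a program. -/
def Prog.width : Prog → ℕ
  | .skip => 0
  | .inc i => i + 1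
  | .seq p q => max p.width q.width
  | .loop i p => max (i + 1) p.width

theorem Prog.mem_frames_self (p : Prog) (K : List Prog) : p :: K ∈ p.frames K := by
  cases p <;> simp [frames]

/-- Thus only finitely many stacks occur, and they can serve as control states. -/
theorem Prog.frames_closed (p : Prog) {K K' K'' : List Prog} {s s' : ℕ → ℕ} (h : K' ∈ p.frames K)
    (hs : PStep (K', s) (K'', s')) : K'' ∈ p.frames K ∨ K'' = K := by
  induction p generalizing K with
  | skip => obtain rfl := List.mem_singleton.1 h; cases hs; exact Or.inr rfl
  | inc i => obtain rfl := List.mem_singleton.1 h; cases hs; exact Or.inr rfl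
  | seq p q ihp ihq =>
    simp only [frames, List.mem_cons, List.mem_append] at h ⊢
    rcases h with rfl | h | h
    · cases hs; exact Or.inl (Or.inr (Or.inl (p.mem_frames_self _)))
    · rcases ihp h with h | rfl
      · exact Or.inl (Or.inr (Or.inl h))
      · exact Or.inl (Or.inr (Or.inr (q.mem_frames_self _)))
    · rcases ihq h with h | h
      · exact Or.inl (Or.inr (Or.inr h))
      · exact Or.inr h
  | loop i p ih =>
    simp only [frames, List.mem_cons] at h ⊢
    rcases h with rfl | h
    · cases hs
      · exact Or.inr rfl
      · exact Or.inl (Or.inr (p.mem_frames_self _))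
    · rcases ih h with h | h
      · exact Or.inl (Or.inr h)
      · exact Or.inl (Or.inl h)

theorem Prog.width_le_of_mem_frames (p : Prog) {K K' : List Prog} {q : Prog}
    (h : q :: K' ∈ p.frames K) : q.width ≤ p.width := by
  induction p generalizing K with
  | skip => simp only [frames, List.mem_singleton, List.cons.injEq] at h; rw [h.1]
  | inc i => simp only [frames, List.mem_singleton, List.cons.injEq] at h; rw [h.1]
  | seq p₁ p₂ ihp ihq =>
    simp only [frames, List.mem_cons, List.mem_append, List.cons.injEq] at h
    rcases h with ⟨rfl, -⟩ | h | h
    · exact le_rfl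
    · exact (ihp h).trans (le_max_left _ _)
    · exact (ihq h).trans (le_max_right _ _)
  | loop i p ih =>
    simp only [frames, List.mem_cons, List.cons.injEq] at h
    rcases h with ⟨rfl, -⟩ | h
    · exact le_rfl
    · exact (ih h).trans (le_max_right _ _)

/-! ## Simulation of a program with a budget -/

/-- The nodes of the simulation. -/
inductive BState : Type
  | init : BState
  | rest : BState
  | run (K : List Prog) : BState
  | collect (j : ℕ) : BState

/-- The operation that moves `x` units from counter `a` to counter `b`. -/
def moveOp {d : ℕ} (x a b : ℕ) : (Fin d → ℤ) ⊕ Fin d :=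
  Sum.inl fun j => (if j.val = b then (x : ℤ) else 0) - if j.val = a then (x : ℤ) else 0

/-- The edges that simulate a step. Counter `0` holds the budget, counter `i + 1` is register `i`. -/
def simEdges (k : ℕ) : List Prog → List (OpEdge BState (k + 1))
  | [] => []
  | .skip :: K => [(.run (.skip :: K), moveOp 0 0 0, .run K)]
  | .inc i :: K => [(.run (.inc i :: K), moveOp 1 0 (i + 1), .run K)]
  | .seq p q :: K => [(.run (.seq p q :: K), moveOp 0 0 0, .run (p :: q :: K))]
  | .loop i p :: K => [(.run (.loop i p :: K), .inr (Fin.ofNat (k + 1) (i + 1)), .run K),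
      (.run (.loop i p :: K), moveOp 1 (i + 1) 0, .run (p :: .loop i p :: K))]

/-- The edges that do not depend on the input: simulate steps, give up, collect what is left in the
registers, and increment the budget. -/
def innerEdges (k : ℕ) (L : List (List Prog)) : List (OpEdge BState (k + 1)) :=
  L.flatMap (fun K => (.run K, .inr 0, .collect 0) :: simEdges k K) ++
    ((List.range k).flatMap (fun j => [(.collect j, moveOp 1 (j + 1) 0, .collect j),
      (.collect j, .inr (Fin.ofNat (k + 1) (j + 1)), .collect (j + 1))]) ++
    [(.collect k, addFirst 1, .rest)])

/-- The edges that depend on the input. -/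
def outerEdges (k : ℕ) (p : Prog) (x : ℕ) : List (OpEdge BState (k + 1)) :=
  [(.init, addFirst x, .rest), (.rest, moveOp x 0 1, .run [p])]

/-- The edges of the simulation of `p` on the input `x`. -/
def budgetEdges (k : ℕ) (L : List (List Prog)) (p : Prog) (x : ℕ) : List (OpEdge BState (k + 1)) :=
  innerEdges k L ++ outerEdges k p x

theorem mem_budgetEdges {k : ℕ} {L : List (List Prog)} {p : Prog} {x : ℕ}
    {e : OpEdge BState (k + 1)} : e ∈ budgetEdges k L p x ↔
      (∃ K ∈ L, e = (.run K, .inr 0, .collect 0) ∨ e ∈ simEdges k K) ∨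
      (∃ j < k, e = (.collect j, moveOp 1 (j + 1) 0, .collect j) ∨
        e = (.collect j, .inr (Fin.ofNat (k + 1) (j + 1)), .collect (j + 1))) ∨
      e = (.collect k, addFirst 1, .rest) ∨
      e = (.init, addFirst x, .rest) ∨ e = (.rest, moveOp x 0 1, .run [p]) := by
  simp only [budgetEdges, innerEdges, outerEdges, List.mem_append, List.mem_flatMap, List.mem_cons,
    List.mem_range, List.not_mem_nil, or_false, or_assoc]

section Simulation

variable {k : ℕ}

theorem fires_moveOp {x a b : ℕ} {m m' : Fin (k + 1) → ℕ} : Fires (moveOp x a b) m m' ↔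
    ((m' 0 : ℤ) = m 0 + ((if 0 = b then (x : ℤ) else 0) - if 0 = a then (x : ℤ) else 0)) ∧
    ∀ j : Fin k, (m' j.succ : ℤ) = m j.succ + ((if j.val + 1 = b then (x : ℤ) else 0) -
      if j.val + 1 = a then (x : ℤ) else 0) :=
  Fin.forall_fin_succ

theorem fires_addFirst_iff {x : ℤ} {m m' : Fin (k + 1) → ℕ} : Fires (addFirst x) m m' ↔
    ((m' 0 : ℤ) = m 0 + x) ∧ ∀ j : Fin k, (m' j.succ : ℤ) = m j.succ + 0 :=
  Fin.forall_fin_succ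

theorem sum_of_fires_moveOp {x a b : ℕ} (ha : a ≤ k) (hb : b ≤ k) {m m' : Fin (k + 1) → ℕ}
    (h : Fires (moveOp x a b) m m') : ∑ i, m' i = ∑ i, m i := by
  have h1 : ∀ c ≤ k, ∑ i : Fin (k + 1), (if i.val = c then (x : ℤ) else 0) = x := by
    intro c hc
    rw [Finset.sum_eq_single (⟨c, by omega⟩ : Fin (k + 1))]
    · simp
    · intro i _ hi
      exact if_neg fun h => hi (Fin.ext h)
    · simp
  zify
  rw [Finset.sum_congr rfl fun i _ => h i, Finset.sum_add_distrib, Finset.sum_sub_distrib, h1 a ha,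
    h1 b hb]
  simp

theorem sum_of_fires_reset {r : Fin (k + 1)} {m m' : Fin (k + 1) → ℕ}
    (h : Fires (.inr r) m m') : ∑ i, m' i + m r = ∑ i, m i := by
  obtain rfl : m' = Function.update m r 0 := h
  rw [Finset.sum_update_of_mem (Finset.mem_univ _), zero_add, add_comm,
    Finset.sdiff_singleton_eq_erase, Finset.add_sum_erase _ _ (Finset.mem_univ _)]

theorem ofNat_succ {i : ℕ} (hi : i < k) : Fin.ofNat (k + 1) (i + 1) = (⟨i, hi⟩ : Fin k).succ :=
  Fin.ext (Nat.mod_eq_of_lt (by omega))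

/-- The budget and the registers as a counter valuation. -/
def budgetVec (k b : ℕ) (s : ℕ → ℕ) : Fin (k + 1) → ℕ := Fin.cons b fun i => s i

theorem budgetVec_congr {b : ℕ} {s s' : ℕ → ℕ} (h : ∀ i < k, s i = s' i) :
    budgetVec k b s = budgetVec k b s' := by
  unfold budgetVec; congr 1; funext i; exact h i i.2

/-- What is true of all configurations of the simulation, if the registers of `p` on the input `x`
do not exceed `S` in total. -/
def BudgetInv (p : Prog) (x T : ℕ) : BState × (Fin (k + 1) → ℕ) → Prop
  | (.init, m) => ∀ i, m i = 0
  | (.rest, m) => ∑ i, m i ≤ T ∧ ∀ i : Fin k, m i.succ = 0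
  | (.run K, m) => ∑ i, m i ≤ T ∧ (∑ i, m i = T → ∃ s, PSteps ([p], inputVal x) (K, s) ∧
      ∀ i : Fin k, m i.succ = s i)
  | (.collect j, m) => ∑ i, m i < T ∧ ∀ i : Fin k, i.val < j → m i.succ = 0

/-- Moves keep the total and mirror true program steps. A reset of a positive register lowers the
total for good, after which nothing is claimed about the registers. -/
theorem budgetInv_sim {p : Prog} {x T : ℕ} {K : List Prog} (hw : ∀ q K', K = q :: K' → q.width ≤ k)
    {m m' : Fin (k + 1) → ℕ} {e : OpEdge BState (k + 1)} (he : e ∈ simEdges k K)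
    (h : BudgetInv p x T (.run K, m)) (hf : Fires e.2.1 m m') : BudgetInv p x T (e.2.2, m') := by
  obtain ⟨h1, h2⟩ := h
  match K, hw, he, h2 with
  | [], _, he, _ => cases he
  | .skip :: K, _, he, h2 =>
    obtain rfl := List.mem_singleton.1 he
    have h3 := sum_of_fires_moveOp (by omega) (by omega) hf
    refine ⟨h3 ▸ h1, fun h => ?_⟩
    obtain ⟨s, h4, h5⟩ := h2 (h3 ▸ h)
    refine ⟨s, h4.tail (.skip _ _), fun i => ?_⟩
    have := (fires_moveOp.1 hf).2 i
    have := h5 i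
    simp at *
    omega
  | .seq p q :: K, _, he, h2 =>
    obtain rfl := List.mem_singleton.1 he
    have h3 := sum_of_fires_moveOp (by omega) (by omega) hf
    refine ⟨h3 ▸ h1, fun h => ?_⟩
    obtain ⟨s, h4, h5⟩ := h2 (h3 ▸ h)
    refine ⟨s, h4.tail (.seq _ _ _ _), fun i => ?_⟩
    have := (fires_moveOp.1 hf).2 i
    have := h5 i
    simp at *
    omega
  | .inc i :: K, hw, he, h2 =>
    obtain rfl := List.mem_singleton.1 he
    have hik : i + 1 ≤ k := hw _ _ rfl
    have h3 := sum_of_fires_moveOp (by omega) (by omega) hf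
    refine ⟨h3 ▸ h1, fun h => ?_⟩
    obtain ⟨s, h4, h5⟩ := h2 (h3 ▸ h)
    refine ⟨_, h4.tail (.inc _ _ _), fun j => ?_⟩
    have h6 := (fires_moveOp.1 hf).2 j
    have h7 := h5 j
    by_cases hj : j.val = i
    · subst hj
      simp at *
      omega
    · rw [Function.update_of_ne hj]
      simp [hj] at *
      omega
  | .loop i q :: K, hw, he, h2 =>
    have hik : i + 1 ≤ k := (le_max_left _ _).trans (hw _ _ rfl)
    rcases List.mem_cons.1 he with rfl | he
    · have h3 := sum_of_fires_reset hf
      refine ⟨by omega, fun h => ?_⟩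
      obtain ⟨s, h4, h5⟩ := h2 (by omega)
      -- If the total is still `T`, the reset has lost nothing, so the zero test was correct.
      have h6 : m (Fin.ofNat (k + 1) (i + 1)) = 0 := by omega
      obtain rfl : m' = m := by
        have h7 : m' = Function.update m (Fin.ofNat (k + 1) (i + 1)) 0 := hf
        have h8 := Function.update_eq_self (Fin.ofNat (k + 1) (i + 1)) m
        rw [h6] at h8
        exact h7.trans h8
      rw [ofNat_succ hik, h5] at h6
      exact ⟨s, h4.tail (.loop_zero _ _ _ _ h6), h5⟩
    · obtain rfl := List.mem_singleton.1 he
      have h3 := sum_of_fires_moveOp (by omega) (by omega) hf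
      refine ⟨h3 ▸ h1, fun h => ?_⟩
      obtain ⟨s, h4, h5⟩ := h2 (h3 ▸ h)
      have h8 := (fires_moveOp.1 hf).2 ⟨i, hik⟩
      have h9 := h5 ⟨i, hik⟩
      refine ⟨_, h4.tail (.loop_succ i q _ _ (s i - 1) ?_), fun j => ?_⟩
      · simp at h8 h9
        omega
      have h6 := (fires_moveOp.1 hf).2 j
      have h7 := h5 j
      by_cases hj : j.val = i
      · subst hj
        simp at *
        omega
      · rw [Function.update_of_ne hj]
        simp [hj] at *
        omega

variable {L : List (List Prog)} {p : Prog} {x : ℕ}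

/-- With a total of `x + S + 1`, a faithful simulation always has budget left, so giving up loses at
least one unit and the final increment only makes up for it. The summand `x` covers the initial
budget. -/
theorem budget_bounded (hL : ∀ q K', q :: K' ∈ L → q.width ≤ k) (hk : 2 ≤ k) {S : ℕ}
    (hS : ∀ c, PSteps ([p], inputVal x) c → ∑ i : Fin k, c.2 i ≤ S)
    {c : BState × (Fin (k + 1) → ℕ)}
    (hc : Relation.ReflTransGen (GStep (budgetEdges k L p x)) (.init, fun _ => 0) c) :
    BudgetInv p x (x + S + 1) c := by
  induction hc with
  | refl => exact fun _ => rfl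
  | @tail c c' _ h ih =>
    obtain ⟨e, he, h1, h2, h3⟩ := h
    obtain ⟨q, m⟩ := c
    obtain ⟨q', m'⟩ := c'
    simp only at h1 h2 h3
    subst h1 h2
    rcases mem_budgetEdges.1 he with ⟨K, hK, rfl | he⟩ | ⟨j, hj, rfl | rfl⟩ | rfl | rfl | rfl
    · obtain ⟨h4, h5⟩ := ih
      have h6 := sum_of_fires_reset h3
      refine ⟨?_, fun i hi => by omega⟩
      -- Otherwise nothing was lost and the discarded budget was empty, so the registers of a true
      -- run would hold more than `S`.
      by_contra hcon
      obtain ⟨s, h7, h8⟩ := h5 (by omega)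
      have h9 := hS _ h7
      have h10 := Fin.sum_univ_succ m
      rw [Finset.sum_congr rfl fun i _ => h8 i] at h10
      simp only at h9
      omega
    · have hr : e.1 = .run K := by
        match K, he with
        | [], he => cases he
        | .skip :: K, he => rw [List.mem_singleton.1 he]
        | .inc i :: K, he => rw [List.mem_singleton.1 he]
        | .seq _ _ :: K, he => rw [List.mem_singleton.1 he]
        | .loop _ _ :: K, he =>
          rcases List.mem_cons.1 he with rfl | he
          · rfl
          · rw [List.mem_singleton.1 he]
      rw [hr] at ih
      exact budgetInv_sim (fun q K' h => hL q K' (h ▸ hK)) he ih h3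
    · obtain ⟨h4, h5⟩ := ih
      refine ⟨(sum_of_fires_moveOp (by omega) (by omega) h3).trans_lt h4, fun i hi => ?_⟩
      have h6 := (fires_moveOp.1 h3).2 i
      have h7 := h5 i hi
      rw [if_neg (by omega), if_neg (by omega)] at h6
      omega
    · obtain ⟨h4, h5⟩ := ih
      have h6 := sum_of_fires_reset h3
      refine ⟨by omega, fun i hi => ?_⟩
      have h7 : m' = Function.update m (Fin.ofNat (k + 1) (j + 1)) 0 := h3
      rw [ofNat_succ hj] at h7
      rw [h7]
      by_cases hij : i = ⟨j, hj⟩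
      · rw [hij, Function.update_self]
      · rw [Function.update_of_ne (fun h => hij (Fin.succ_injective _ h))]
        exact h5 i (lt_of_le_of_ne (Nat.le_of_lt_succ hi) fun h => hij (Fin.ext h))
    · obtain ⟨h4, h5⟩ := ih
      obtain ⟨h6, h7⟩ := fires_addFirst_iff.1 h3
      have h8 : ∀ i : Fin k, m' i.succ = 0 := fun i => by
        have := h7 i
        have := h5 i i.2
        omega
      refine ⟨?_, h8⟩
      rw [Fin.sum_univ_succ] at h4 ⊢
      simp only [h5 _ (Fin.is_lt _), h8, Finset.sum_const_zero, add_zero] at h4 ⊢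
      omega
    · obtain ⟨h6, h7⟩ := fires_addFirst_iff.1 h3
      have h8 : ∀ i : Fin k, m' i.succ = 0 := fun i => by
        have := h7 i
        have := ih i.succ
        omega
      refine ⟨?_, h8⟩
      rw [Fin.sum_univ_succ]
      simp only [h8, Finset.sum_const_zero, add_zero]
      have := ih 0
      omega
    · obtain ⟨h4, h5⟩ := ih
      refine ⟨(sum_of_fires_moveOp (by omega) (by omega) h3).trans_le h4, fun _ =>
        ⟨_, .refl, fun i => ?_⟩⟩
      have h6 := (fires_moveOp.1 h3).2 i
      have h7 := h5 i
      rw [if_neg (show ¬ i.val + 1 = 0 by omega)] at h6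
      simp only [inputVal]
      split_ifs with hi
      · rw [if_pos (by omega)] at h6; omega
      · rw [if_neg (by omega)] at h6; omega

/-! ### The simulation with a sufficient budget -/

/-- Reachability in the simulation. -/
abbrev BReach (k : ℕ) (L : List (List Prog)) (p : Prog) (x : ℕ) :
    BState × (Fin (k + 1) → ℕ) → BState × (Fin (k + 1) → ℕ) → Prop :=
  Relation.ReflTransGen (GStep (budgetEdges k L p x))

theorem fires_moveOp_budgetVec {y a b : ℕ} {B B' : ℕ} {s s' : ℕ → ℕ} :
    Fires (moveOp y a b) (budgetVec k B s) (budgetVec k B' s') ↔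
    ((B' : ℤ) = B + ((if 0 = b then (y : ℤ) else 0) - if 0 = a then (y : ℤ) else 0)) ∧
    ∀ j : Fin k, (s' j : ℤ) = s j + ((if j.val + 1 = b then (y : ℤ) else 0) -
      if j.val + 1 = a then (y : ℤ) else 0) := fires_moveOp

theorem fires_reset_budgetVec {i B : ℕ} (hi : i < k) {s s' : ℕ → ℕ} (h0 : s' i = 0)
    (h : ∀ j < k, j ≠ i → s' j = s j) :
    Fires (.inr (Fin.ofNat (k + 1) (i + 1))) (budgetVec k B s) (budgetVec k B s') := by
  show budgetVec k B s' = Function.update (budgetVec k B s) _ 0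
  rw [ofNat_succ hi]
  funext j
  refine Fin.cases ?_ (fun j => ?_) j
  · rw [Function.update_of_ne (Fin.succ_ne_zero _).symm]; rfl
  · by_cases hj : j = ⟨i, hi⟩
    · subst hj; rw [Function.update_self]; exact h0
    · rw [Function.update_of_ne fun h => hj (Fin.succ_injective _ h)]
      exact h j j.2 fun h => hj (Fin.ext h)

theorem sum_update_lt {i v : ℕ} (hi : i < k) (s : ℕ → ℕ) :
    ∑ j : Fin k, Function.update s i v j + s i = ∑ j : Fin k, s j + v := by
  have h : ∀ j : Fin k, Function.update s i v j = Function.update (fun j : Fin k => s j) ⟨i, hi⟩ v j := by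
    intro j
    by_cases hj : j = ⟨i, hi⟩
    · subst hj; simp
    · rw [Function.update_of_ne hj, Function.update_of_ne fun h => hj (Fin.ext h)]
  rw [Finset.sum_congr rfl fun j _ => h j, Finset.sum_update_of_mem (Finset.mem_univ _),
    Finset.sdiff_singleton_eq_erase, ← Finset.add_sum_erase _ (fun j : Fin k => s j)
      (Finset.mem_univ (⟨i, hi⟩ : Fin k))]
  dsimp only
  omega

/-- The budget is what the registers lack to `B`; it is positive before the step, so an increment
can be paid. -/
theorem breach_sim (hL : ∀ q K', q :: K' ∈ L → q.width ≤ k) {K K' : List Prog} {s s' : ℕ → ℕ}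
    (hK : K ∈ L) (h : PStep (K, s) (K', s')) {B : ℕ} (hB : ∑ i : Fin k, s i < B) :
    ∑ i : Fin k, s' i ≤ B ∧
    GStep (budgetEdges k L p x) (.run K, budgetVec k (B - ∑ i : Fin k, s i) s)
      (.run K', budgetVec k (B - ∑ i : Fin k, s' i) s') := by
  have hmem : ∀ e ∈ simEdges k K, e ∈ budgetEdges k L p x :=
    fun e he => mem_budgetEdges.2 (Or.inl ⟨K, hK, Or.inr he⟩)
  cases h with
  | skip =>
    exact ⟨hB.le, _, hmem _ (List.mem_singleton_self _), rfl, rfl,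
      fires_moveOp_budgetVec.2 ⟨by simp, fun j => by simp⟩⟩
  | seq q r =>
    exact ⟨hB.le, _, hmem _ (List.mem_singleton_self _), rfl, rfl,
      fires_moveOp_budgetVec.2 ⟨by simp, fun j => by simp⟩⟩
  | inc i =>
    have hik : i < k := hL _ _ hK
    have h1 := sum_update_lt (v := s i + 1) hik s
    refine ⟨by omega, _, hmem _ (List.mem_singleton_self _), rfl, rfl,
      fires_moveOp_budgetVec.2 ⟨?_, fun j => ?_⟩⟩
    · simp only [if_pos, if_neg (show ¬ 0 = i + 1 by omega)]
      omega
    · by_cases hj : j.val = i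
      · rw [hj]; simp
      · rw [Function.update_of_ne hj]; simp [hj]
  | loop_zero i q _ _ h0 =>
    have hik : i < k := (le_max_left _ _).trans (hL _ _ hK)
    exact ⟨hB.le, _, hmem _ (List.mem_cons_self), rfl, rfl,
      fires_reset_budgetVec hik h0 fun _ _ _ => rfl⟩
  | loop_succ i q _ _ n hn =>
    have hik : i < k := (le_max_left _ _).trans (hL _ _ hK)
    have h1 := sum_update_lt (v := n) hik s
    refine ⟨by omega, _, hmem _ (List.mem_cons_of_mem _ (List.mem_singleton_self _)), rfl, rfl,
      fires_moveOp_budgetVec.2 ⟨?_, fun j => ?_⟩⟩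
    · simp only [if_pos, if_neg (show ¬ 0 = i + 1 by omega)]
      omega
    · by_cases hj : j.val = i
      · rw [hj]; simp [hn]
      · rw [Function.update_of_ne hj]; simp [hj]

theorem breach_collect_move {j b v : ℕ} {s : ℕ → ℕ} (hj : j < k) (hs : s j = v) :
    BReach k L p x (.collect j, budgetVec k b s)
      (.collect j, budgetVec k (b + v) (Function.update s j 0)) := by
  induction v generalizing b s with
  | zero => rw [← hs, Function.update_eq_self]; simpa [hs] using Relation.ReflTransGen.refl
  | succ v ih =>
    have h1 := ih (b := b + 1) (s := Function.update s j v) (by simp)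
    rw [Function.update_idem, add_assoc, Nat.add_comm 1] at h1
    refine .head ⟨_, mem_budgetEdges.2 (Or.inr (Or.inl ⟨j, hj, Or.inl rfl⟩)), rfl, rfl,
      fires_moveOp_budgetVec.2 ⟨?_, fun i => ?_⟩⟩ h1
    · simp
    · by_cases hi : i.val = j
      · rw [hi]; simp [hs]
      · rw [Function.update_of_ne hi]; simp [hi]

theorem breach_collect (s : ℕ → ℕ) {j : ℕ} (hj : j ≤ k) :
    BReach k L p x (.collect 0, budgetVec k 0 s)
      (.collect j, budgetVec k (∑ i ∈ Finset.range j, s i) fun i => if i < j then 0 else s i) := by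
  induction j with
  | zero => simpa using Relation.ReflTransGen.refl
  | succ j ih =>
    have h1 := breach_collect_move (k := k) (L := L) (p := p) (x := x)
      (b := ∑ i ∈ Finset.range j, s i) (s := fun i => if i < j then 0 else s i) (v := s j) hj (by simp)
    rw [← Finset.sum_range_succ] at h1
    refine ((ih (by omega)).trans h1).tail ⟨_, mem_budgetEdges.2 (Or.inr (Or.inl ⟨j, hj, Or.inr rfl⟩)),
      rfl, rfl, ?_⟩
    dsimp only
    refine fires_reset_budgetVec hj ?_ fun i _ hi => ?_
    · simp
    rw [Function.update_of_ne hi]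
    split_ifs <;> first | rfl | omega

/-- An unbounded program run eventually uses up the budget exactly. Giving up at that moment loses
nothing, the registers return all `B` units, and one is added. -/
theorem breach_round (hL : ∀ q K', q :: K' ∈ L → q.width ≤ k) (hk : 2 ≤ k) (hp : [p] ∈ L)
    (hcl : ∀ K K' s s', K ∈ L → PStep (K, s) (K', s') → K' ∈ L)
    (hun : ∀ S, ∃ c, PSteps ([p], inputVal x) c ∧ S ≤ c.2 1) {B : ℕ} (hB : x ≤ B) :
    BReach k L p x (.rest, budgetVec k B fun _ => 0) (.rest, budgetVec k (B + 1) fun _ => 0) := by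
  have hx : ∑ i : Fin k, inputVal x i = x := by
    rw [Finset.sum_eq_single (⟨0, by omega⟩ : Fin k)]
    · simp [inputVal]
    · intro i _ hi
      exact if_neg fun h => hi (Fin.ext h)
    · simp
  have h1 : BReach k L p x (.rest, budgetVec k B fun _ => 0)
      (.run [p], budgetVec k (B - ∑ i : Fin k, inputVal x i) (inputVal x)) := by
    refine .single ⟨_, mem_budgetEdges.2 (Or.inr (Or.inr (Or.inr (Or.inr rfl)))), rfl, rfl, ?_⟩
    dsimp only
    refine fires_moveOp_budgetVec.2 ⟨?_, fun j => ?_⟩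
    · simp [hx]; omega
    · simp [inputVal]
  -- Either the registers have reached the total `B` at some earlier point, or the simulation has
  -- kept up with `c`.
  have h2 : ∀ c, PSteps ([p], inputVal x) c → (∃ K s, K ∈ L ∧ ∑ i : Fin k, s i = B ∧
      BReach k L p x (.rest, budgetVec k B fun _ => 0) (.run K, budgetVec k 0 s)) ∨
      (c.1 ∈ L ∧ ∑ i : Fin k, c.2 i ≤ B ∧ BReach k L p x (.rest, budgetVec k B fun _ => 0)
        (.run c.1, budgetVec k (B - ∑ i : Fin k, c.2 i) c.2)) := by
    intro c hc
    induction hc with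
    | refl => exact Or.inr ⟨hp, hx.trans_le hB, h1⟩
    | @tail c c' _ h ih =>
      rcases ih with ih | ⟨i1, i2, i3⟩
      · exact Or.inl ih
      rcases i2.eq_or_lt with i2 | i2
      · rw [i2, Nat.sub_self] at i3
        exact Or.inl ⟨_, _, i1, i2, i3⟩
      · obtain ⟨h3, h4⟩ := breach_sim (p := p) (x := x) hL i1 h i2
        exact Or.inr ⟨hcl _ _ _ _ i1 h, h3, i3.tail h4⟩
  obtain ⟨K, s, hK, hs, h3⟩ : ∃ K s, K ∈ L ∧ ∑ i : Fin k, s i = B ∧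
      BReach k L p x (.rest, budgetVec k B fun _ => 0) (.run K, budgetVec k 0 s) := by
    obtain ⟨c, hc, hcB⟩ := hun (B + 1)
    rcases h2 c hc with h | ⟨-, h, -⟩
    · exact h
    · have := Finset.single_le_sum (f := fun i : Fin k => c.2 i) (fun _ _ => Nat.zero_le _)
        (Finset.mem_univ (⟨1, by omega⟩ : Fin k))
      simp only at this
      omega
  have h4 : GStep (budgetEdges k L p x) (.run K, budgetVec k 0 s) (.collect 0, budgetVec k 0 s) := by
    refine ⟨_, mem_budgetEdges.2 (Or.inl ⟨K, hK, Or.inl rfl⟩), rfl, rfl, ?_⟩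
    show _ = Function.update _ _ _
    -- The budget is already zero, so its reset changes nothing.
    have := Function.update_eq_self (0 : Fin (k + 1)) (budgetVec k 0 s)
    exact this.symm
  have h5 := breach_collect (L := L) (p := p) (x := x) s (le_refl k)
  rw [← Fin.sum_univ_eq_sum_range, hs, budgetVec_congr (s' := fun _ => 0) fun i hi => if_pos hi] at h5
  refine ((h3.tail h4).trans h5).tail ⟨_, mem_budgetEdges.2 (Or.inr (Or.inr (Or.inl rfl))), rfl, rfl, ?_⟩
  exact fires_addFirst_iff.2 ⟨rfl, fun j => rfl⟩

theorem breach_rest (hL : ∀ q K', q :: K' ∈ L → q.width ≤ k) (hk : 2 ≤ k) (hp : [p] ∈ L)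
    (hcl : ∀ K K' s s', K ∈ L → PStep (K, s) (K', s') → K' ∈ L)
    (hun : ∀ S, ∃ c, PSteps ([p], inputVal x) c ∧ S ≤ c.2 1) (B : ℕ) :
    BReach k L p x (.init, fun _ => 0) (.rest, budgetVec k (x + B) fun _ => 0) := by
  induction B with
  | zero =>
    refine .single ⟨_, mem_budgetEdges.2 (Or.inr (Or.inr (Or.inr (Or.inl rfl)))), rfl, rfl,
      fires_addFirst_iff.2 ⟨?_, fun j => rfl⟩⟩
    simp [budgetVec]
  | succ B ih => exact ih.trans (breach_round hL hk hp hcl hun (Nat.le_add_right _ _))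

end Simulation

/-! ## Undecidability -/

theorem primrec_opCode_moveOp (d a b : ℕ) :
    Primrec fun x : ℕ => opCode (moveOp x a b : (Fin d → ℤ) ⊕ Fin d) := by
  refine Primrec.sumInl.comp (Primrec.list_ofFn fun i => ?_)
  refine Primrec.of_eq (f := fun x : ℕ => if i.val = b then (if i.val = a then (0, 0) else (x, 0)) else
    if i.val = a then (0, x) else (0, 0)) ?_ fun x => ?_
  · split_ifs <;> fun_prop
  · dsimp only
    split_ifs <;> simp

/-- If the zeros of `T x` are to be found, then some place bounded reset VASS is computed from `x`,
and if there are none, then a place unbounded one. -/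
theorem exists_resetVASS_search {T : ℕ → ℕ → ℕ} (hT : Primrec₂ T) (hT1 : ∀ x n, T x n ≤ 1) :
    ∃ f : ℕ → VASSCode (Letter 1), Primrec f ∧ ∀ x, ∃ V : ResetVASS, f x = V.1.code ∧
      (V.1.PlaceBounded V.2.2 ↔ ∃ n, T x n = 0) := by
  obtain ⟨p, hp⟩ := exists_search_program hT hT1
  -- At least two registers are needed: the input is in register `0`, and register `1` is the one
  -- that grows.
  let k := p.width + 2
  let L := [] :: p.frames []
  have hL : ∀ q K', q :: K' ∈ L → q.width ≤ k := by
    intro q K' h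
    rcases List.mem_cons.1 h with h | h
    · cases h
    · exact (p.width_le_of_mem_frames h).trans (Nat.le_add_right _ _)
  have hpL : [p] ∈ L := List.mem_cons_of_mem _ (p.mem_frames_self [])
  have hcl : ∀ K K' s s', K ∈ L → PStep (K, s) (K', s') → K' ∈ L := by
    intro K K' s s' hK h
    rcases List.mem_cons.1 hK with rfl | hK
    · cases h
    · rcases p.frames_closed hK h with h | rfl
      · exact List.mem_cons_of_mem _ h
      · exact List.mem_cons_self
  -- The nodes do not depend on the input, which occurs only in the operations of two edges. This
  -- makes the code primitive recursive in `x`.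
  let N : List BState := BState.init :: (budgetEdges k L p 0).flatMap fun e => [e.1, e.2.2]
  have hN : 0 < N.length := by simp [N]
  have hE : ∀ x, ∀ e ∈ budgetEdges k L p x, e.1 ∈ N ∧ e.2.2 ∈ N := by
    have h0 : ∀ e ∈ budgetEdges k L p 0, e.1 ∈ N ∧ e.2.2 ∈ N := fun e he =>
      ⟨List.mem_cons_of_mem _ (List.mem_flatMap.2 ⟨e, he, by simp⟩),
        List.mem_cons_of_mem _ (List.mem_flatMap.2 ⟨e, he, by simp⟩)⟩
    intro x e he
    rcases List.mem_append.1 he with he | he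
    · exact h0 e (List.mem_append_left _ he)
    · simp only [outerEdges, List.mem_cons, List.not_mem_nil, or_false] at he
      rcases he with rfl | rfl
      · exact h0 (.init, addFirst 0, .rest) (List.mem_append_right _ (by simp [outerEdges]))
      · exact h0 (.rest, moveOp 0 0 1, .run [p]) (List.mem_append_right _ (by simp [outerEdges]))
  let V : ℕ → BuchiResetVASS (Letter 1) := fun x => graphVASS N hN .init (budgetEdges k L p x)
  refine ⟨fun x => (V x).code, ?_, fun x => ⟨⟨V x, isResetVASS_graphVASS _ _ _ _, Nat.succ_pos _⟩, rfl, ?_⟩⟩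
  · have h1 := primrec_opCode_moveOp (k + 1) 0 1
    have h2 : Primrec fun x : ℕ => opCode (addFirst (x : ℤ) : (Fin (k + 1) → ℤ) ⊕ Fin (k + 1)) := by
      simp only [opCode_addFirst]
      simp only [Int.toNat_natCast, Int.toNat_neg_natCast]
      fun_prop
    have h3 : (fun x => (V x).code) = fun x : ℕ => (N.length, k + 1, (nodeIndex N hN .init).val,
        ((innerEdges k L).map fun e => (e.toTransition N hN).code) ++
        [((nodeIndex N hN .init).val, opCode (addFirst (x : ℤ) : (Fin (k + 1) → ℤ) ⊕ Fin (k + 1)), [],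
          (nodeIndex N hN .rest).val),
         ((nodeIndex N hN .rest).val, opCode (moveOp x 0 1 : (Fin (k + 1) → ℤ) ⊕ Fin (k + 1)), [],
          (nodeIndex N hN (.run [p])).val)], []) := by
      funext x
      simp only [V, BuchiResetVASS.code, budgetEdges, outerEdges, List.map_append, List.map_map,
        List.map_cons, List.map_nil]
      rfl
    rw [h3]
    fun_prop
  · show (graphVASS N hN .init (budgetEdges k L p x)).PlaceBounded (Nat.succ_pos _) ↔ _
    rw [placeBounded_graphVASS hN List.mem_cons_self (hE x)]
    constructor
    · rintro ⟨S, hS⟩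
      by_contra hcon
      have h := hS _ (breach_rest (k := k) hL (by omega) hpL hcl ((hp x).2 hcon) (S + 1))
      simp only [budgetVec, Fin.mk_zero', Fin.cons_zero] at h
      omega
    · intro h
      obtain ⟨S, hS⟩ := (hp x).1 h fun c => ∑ i : Fin k, c.2 i
      refine ⟨x + S + 1, fun c hc => ?_⟩
      have hI := budget_bounded (k := k) hL (by omega) hS hc
      have hle := Finset.single_le_sum (f := c.2) (fun _ _ => Nat.zero_le _)
        (Finset.mem_univ (⟨0, Nat.succ_pos _⟩ : Fin (k + 1)))
      obtain ⟨q, m⟩ := c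
      cases q with
      | init => exact (hI _).trans_le (Nat.zero_le _)
      | rest => exact hle.trans hI.1
      | run K => exact hle.trans hI.1
      | collect j => exact hle.trans hI.1.le

/-- Reduction from the halting problem: the search for a halting time is turned into a place
boundedness instance, and this into a separability instance. -/
theorem undecidable_regSeparable_dyck :
    ¬ DecidableProblem (fun V : WeakBRVASS (Letter 1) => V.1.code)
      (fun V => RegSeparable V.1.language (Dyck 1)) := by
  rintro ⟨g, hg, hgV⟩
  -- `T x n = 0` says that the program with code `x` halts on input `0` within the resource bound
  -- `n`.
  let T : ℕ → ℕ → ℕ := fun x n =>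
    if ((Nat.Partrec.Code.evaln n (Denumerable.ofNat Nat.Partrec.Code x) 0).isSome) then 0 else 1
  have hT : Primrec₂ T := by
    refine Primrec.ite (Primrec.eq.comp (Primrec.option_isSome.comp
      (Nat.Partrec.Code.primrec_evaln.comp (Primrec.pair (Primrec.pair Primrec.snd
        ((Primrec.ofNat _).comp Primrec.fst)) (Primrec.const 0)))) (Primrec.const true))
      (Primrec.const 0) (Primrec.const 1)
  obtain ⟨f, hf, hfV⟩ := exists_resetVASS_search hT fun x n => by simp only [T]; split_ifs <;> simp
  refine ComputablePred.halting_problem 0 (ComputablePred.computable_iff.2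
    ⟨fun c => g (spendingCode (f (Encodable.encode c))),
      hg.comp (primrec_spendingCode.comp (hf.comp Primrec.encode)).to_comp, ?_⟩)
  funext c
  obtain ⟨V, h1, h2⟩ := hfV (Encodable.encode c)
  have h3 := hgV ⟨V.1.withSpending, isWeak_withSpending⟩
  refine propext ?_
  show _ ↔ g (spendingCode (f (Encodable.encode c))) = true
  rw [h1, code_withSpending]
  refine Iff.trans ?_ h3.symm
  show _ ↔ RegSeparable V.1.withSpending.language (Dyck 1)
  rw [← placeBounded_iff V.2.1 V.2.2, h2, Part.dom_iff_mem]
  simp only [T, Denumerable.ofNat_encode, Nat.Partrec.Code.evaln_complete]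
  constructor
  · rintro ⟨y, n, hy⟩
    exact ⟨n, if_pos (Option.isSome_iff_exists.2 ⟨y, hy⟩)⟩
  · rintro ⟨n, hn⟩
    by_cases h : (Nat.Partrec.Code.evaln n c 0).isSome
    · obtain ⟨y, hy⟩ := Option.isSome_iff_exists.1 h
      exact ⟨y, n, hy⟩
    · rw [if_neg h] at hn; cases hn

/-- Fixing `dyckVASS` as the second system gives back the problem for the Dyck language. -/
theorem undecidable_regSeparable :
    ¬ DecidableProblem
      (fun V : WeakBRVASS (Letter 1) × WeakBRVASS (Letter 1) => (V.1.1.code, V.2.1.code))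
      (fun V => RegSeparable V.1.1.language V.2.1.language) := by
  rintro ⟨g, hg, hgV⟩
  refine undecidable_regSeparable_dyck ⟨fun c => g (c, dyckVASS.code),
    hg.comp (Computable.pair Computable.id (Computable.const _)), fun V => ?_⟩
  have h := hgV (V, ⟨dyckVASS, isWeak_dyckVASS⟩)
  simp only [language_dyckVASS] at h
  exact h

end RegSep

theorem mainTheorem6 :
    -- weak Büchi reset VASS are WSTS
    (∀ (A : Type) (V : WeakBRVASS A), V.1.toTS.IsWSTS V.1.configLE) ∧
    -- their emptiness problem is decidable
    (∀ (A : Type) [Primcodable A],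
      DecidableProblem (fun V : WeakBRVASS A => V.1.code) (fun V => V.1.language = ∅)) ∧
    -- their intersection problem is decidable
    (∀ (A : Type) [Primcodable A],
      DecidableProblem (fun V : WeakBRVASS A × WeakBRVASS A => (V.1.1.code, V.2.1.code))
        (fun V => V.1.1.language ∩ V.2.1.language = ∅)) ∧
    -- place boundedness of reset VASS reduces to regular separability from the Dyck language
    ReducesTo (fun V : ResetVASS => V.1.code) (fun V => V.1.PlaceBounded V.2.2)
      (fun V : WeakBRVASS (Letter 1) => V.1.code)
      (fun V => RegSeparable V.1.language (Dyck 1)) ∧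
    -- regular separability from the Dyck language is undecidable
    ¬ DecidableProblem (fun V : WeakBRVASS (Letter 1) => V.1.code)
      (fun V => RegSeparable V.1.language (Dyck 1)) ∧
    -- regular separability of two weak Büchi reset VASS is undecidable
    ¬ DecidableProblem
      (fun V : WeakBRVASS (Letter 1) × WeakBRVASS (Letter 1) => (V.1.1.code, V.2.1.code))
      (fun V => RegSeparable V.1.1.language V.2.1.language) := by
  exact ⟨fun _ V => isWSTS_configLE V.1, fun A _ => decidable_empty A,
    fun A _ => decidable_inter_empty A, placeBounded_reducesTo, undecidable_regSeparable_dyck,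
    undecidable_regSeparable⟩
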